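/- Conventions. Let $L_1,\dots,L_d$ be real polynomials of degree one in $x,y$ defining a generic arrangement $\mathcal A=\bigcup_i\{L_i=0\}\subset\mathbb R^2$ of $d$ lines (no two lines parallel or equal, no three through one point). Its nodes are the intersection points of pairs of lines, and its bounded edges are the bounded connected components of $\mathcal A$ minus the nodes. A small real deformation $\mathcal R$ of $\mathcal A$ is a family of curves $\mathcal R_i=\{F_i=0\}\subset\mathbb R^2$, where the $F_i$ are real polynomials of degree at most $d$ converging coefficientwise to $\prod_j L_j$ (along an arbitrary filter on the index set, e.g. a sequence, or $G+\epsilon H$ with $\epsilon\to0^+$), such that eventually $\mathcal R_i$ has no real singular point (so every node is resolved). A statement about $\mathcal R$ means that it holds for all $i$ far enough along the filter. $\mathcal R$ respects a bounded edge $e$ if, for all sufficiently small $\eta>0$, with $U$ the open $\eta$-neighbourhood of $e$, and for every $\rho>0$, for all $i$ far enough along the filter, each connected component of $\mathcal R_i\cap U$ has Hausdorff distance less than $\rho$ from $\partial D\cap U$ for some single connected component $D$ of $U\setminus\mathcal A$. A vertex of a curve is a point at which the derivative of its curvature vanishes. The evolute of a plane curve with local regular parametrization $(x(t),y(t))$ is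 the projective curve parametrized by $$[\,xW-y's : yW+x's : W\,],\qquad W=x'y''-y'x'',\quad s=x'^2+y'^2,$$ that is, by the centres of curvature, with the point at infinity of the normal at inflection points. A real cusp of the evolute is a point of a branch of it at which, in an affine chart of the projective plane, the velocity vanishes and the unit tangent vector has opposite one-sided limits. Cusps are counted by branches, i.e. by the corresponding points of the original curve, and a cusp may lie on the line at infinity. Proposition. (i) For every small real deformation $\mathcal R$ of a generic arrangement $\mathcal A$ of $d$ lines, the number of real cusps of the evolute of $\mathcal R$ is at least $d(d-1)$ plus the number of bounded edges of $\mathcal A$ respected by $\mathcal R$. (ii) The curves $\prod_{i=1}^d L_i=\epsilon$, $\epsilon\to0$, $\epsilon\ne0$ (of either sign), form a small real deformation of $\mathcal A$ that respects every bounded edge of $\mathcal A$. For all sufficiently small $\epsilon\ne0$, the evolute of the curve $\prod_{i=1}^d L_i=\epsilon$ has at least $d(2d-3)$ real cusps, and the curve has at least $d(2d-3)$ real vertices. -/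

import Mathlib

open Filter Topology
open scoped ContDiff

noncomputable section

/-- The Euclidean plane. -/
abbrev Plane : Type := EuclideanSpace ℝ (Fin 2)

/-! ### Plane curves, curvature, vertices -/

/-- The real zero locus of a real bivariate polynomial. -/
def realCurve (F : MvPolynomial (Fin 2) ℝ) : Set Plane :=
  {p | MvPolynomial.eval (fun i => p i) F = 0}

/-- The real zero locus of `F` has no singular point: at each of its points some first partial
derivative of `F` is nonzero. -/
def IsNonsingularCurve (F : MvPolynomial (Fin 2) ℝ) : Prop :=
  ∀ p ∈ realCurve F, ∃ j : Fin 2, MvPolynomial.eval (fun i => p i) (MvPolynomial.pderiv j F) ≠ 0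

/-- `γ` is a smooth regular local parametrization of the curve `Γ` at `p`, with `γ 0 = p`.
(At a nonsingular point of an algebraic curve any two of them differ, near `0`, by a smooth
change of the parameter.) -/
structure IsLocalParam (Γ : Set Plane) (p : Plane) (γ : ℝ → Plane) : Prop where
  base : γ 0 = p
  smooth : ContDiffAt ℝ ∞ γ 0
  regular : deriv γ 0 ≠ 0
  mem : ∀ᶠ t in 𝓝 (0 : ℝ), γ t ∈ Γ

/-- The determinant `x' y'' - y' x''` of a parametrized curve `γ = (x, y)`. -/
def wronskian₂ (γ : ℝ → Plane) (t : ℝ) : ℝ :=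
  deriv γ t 0 * deriv (deriv γ) t 1 - deriv γ t 1 * deriv (deriv γ) t 0

/-- The signed curvature `(x' y'' - y' x'') / (x' ^ 2 + y' ^ 2) ^ (3 / 2)`. -/
def signedCurvature (γ : ℝ → Plane) (t : ℝ) : ℝ :=
  wronskian₂ γ t / ‖deriv γ t‖ ^ 3

/-- The vertices of a curve: the critical points of its curvature. -/
def vertices (Γ : Set Plane) : Set Plane :=
  {p | ∃ γ : ℝ → Plane, IsLocalParam Γ p γ ∧ deriv (signedCurvature γ) 0 = 0}

/-! ### The evolute and its cusps -/

/-- Homogeneous coordinates `[X : Y : Z]` of the point of the evolute that corresponds to the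
parameter `t`. With `W = x' y'' - y' x''` and `s = x' ^ 2 + y' ^ 2`, the centre of curvature is
`(x - y' s / W, y + x' s / W)`, that is `[x W - y' s : y W + x' s : W]`. At an inflection point,
`W = 0`, this is the point at infinity of the normal line. -/
def evoluteLift (γ : ℝ → Plane) (t : ℝ) : Fin 3 → ℝ :=
  ![γ t 0 * wronskian₂ γ t - deriv γ t 1 * ‖deriv γ t‖ ^ 2,
    γ t 1 * wronskian₂ γ t + deriv γ t 0 * ‖deriv γ t‖ ^ 2,
    wronskian₂ γ t]

/-- The parametrized plane curve `c` has a cusp at the parameter `t₀`: its velocity vanishes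
there, and the unit tangent vector has one-sided limits there which are opposite to each other. -/
def HasCuspAt (c : ℝ → Plane) (t₀ : ℝ) : Prop :=
  ContDiffAt ℝ ∞ c t₀ ∧ deriv c t₀ = 0 ∧ ∃ u : Plane, ‖u‖ = 1 ∧
    Tendsto (fun t => ‖deriv c t‖⁻¹ • deriv c t) (𝓝[<] t₀) (𝓝 (-u)) ∧
    Tendsto (fun t => ‖deriv c t‖⁻¹ • deriv c t) (𝓝[>] t₀) (𝓝 u)

/-- A curve in the real projective plane, given by homogeneous coordinates `E t`, has a cusp at
`t₀`: it has one in an affine chart, i.e. after a linear change of the homogeneous coordinates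
for which `E t₀` is not on the line at infinity. -/
def HasProjCuspAt (E : ℝ → Fin 3 → ℝ) (t₀ : ℝ) : Prop :=
  ∃ A : (Fin 3 → ℝ) ≃ₗ[ℝ] (Fin 3 → ℝ), A (E t₀) 2 ≠ 0 ∧
    HasCuspAt (fun t => !₂[A (E t) 0 / A (E t) 2, A (E t) 1 / A (E t) 2]) t₀

/-- The real cusps of the (projectively closed) evolute of `Γ`. A cusp belongs to a branch of the
evolute, and is recorded by the point of `Γ` to which that branch corresponds. -/
def evoluteCusps (Γ : Set Plane) : Set Plane :=
  {p | ∃ γ : ℝ → Plane, IsLocalParam Γ p γ ∧ HasProjCuspAt (evoluteLift γ) 0}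

/-! ### Line arrangements -/

/-- An equation `a x + b y + c = 0` of a line in the plane. -/
structure LineEq where
  a : ℝ
  b : ℝ
  c : ℝ
  ne : a ≠ 0 ∨ b ≠ 0

/-- The linear polynomial `a x + b y + c`. -/
def LineEq.poly (L : LineEq) : MvPolynomial (Fin 2) ℝ :=
  MvPolynomial.C L.a * MvPolynomial.X 0 + MvPolynomial.C L.b * MvPolynomial.X 1 +
    MvPolynomial.C L.c

/-- The line `a x + b y + c = 0`. -/
def LineEq.line (L : LineEq) : Set Plane := realCurve L.poly

section Arrangement

variable {d : ℕ}

/-- No two lines are parallel (in particular, no two coincide), and no three lines have a common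
point. -/
structure IsGenericArrangement (L : Fin d → LineEq) : Prop where
  not_parallel : ∀ i j, i ≠ j → (L i).a * (L j).b ≠ (L j).a * (L i).b
  not_concurrent : ∀ i j k, i ≠ j → j ≠ k → i ≠ k →
    (L i).line ∩ (L j).line ∩ (L k).line = ∅

/-- The product of the linear polynomials. -/
def arrangementPoly (L : Fin d → LineEq) : MvPolynomial (Fin 2) ℝ := ∏ i, (L i).poly

/-- The union of the lines. -/
def arrangementSet (L : Fin d → LineEq) : Set Plane := ⋃ i, (L i).line

/-- The vertices (nodes) of the arrangement. -/
def arrangementNodes (L : Fin d → LineEq) : Set Plane :=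
  {p | ∃ i j, i ≠ j ∧ p ∈ (L i).line ∧ p ∈ (L j).line}

/-- The bounded edges: the bounded connected components of the arrangement without its nodes. -/
def boundedEdges (L : Fin d → LineEq) : Set (Set Plane) :=
  {e | Bornology.IsBounded e ∧ ∃ p ∈ arrangementSet L \ arrangementNodes L,
    e = connectedComponentIn (arrangementSet L \ arrangementNodes L) p}

/-- A small real deformation of the arrangement: a family `F i` of real polynomials of degree at
most `d` which converges, along the filter `l`, to the product of the `d` linear polynomials, and
whose real zero loci are nonsingular, so that every node is resolved. -/
structure IsSmallDeformation (L : Fin d → LineEq) {ι : Type*} (l : Filter ι)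
    (F : ι → MvPolynomial (Fin 2) ℝ) : Prop where
  degree_le : ∀ᶠ i in l, (F i).totalDegree ≤ d
  tendsto : ∀ m, Tendsto (fun i => (F i).coeff m) l (𝓝 ((arrangementPoly L).coeff m))
  nonsingular : ∀ᶠ i in l, IsNonsingularCurve (F i)

/-- The deformation with members `R i` (in the limit along `l`) respects the bounded edge `e`: for
all sufficiently small neighbourhoods `U` of `e` (the `η`-neighbourhoods), each connected component
of `R i ∩ U` is close to the part in `U` of the boundary of a single connected component of `U`
minus the arrangement. Close means: at Hausdorff distance less than any prescribed `ρ > 0`, for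
all `i` far enough along `l`. -/
def RespectsEdge (L : Fin d → LineEq) {ι : Type*} (l : Filter ι) (R : ι → Set Plane)
    (e : Set Plane) : Prop :=
  ∀ᶠ η in 𝓝[>] (0 : ℝ), ∀ ρ : ℝ, 0 < ρ → ∀ᶠ i in l,
    ∀ p ∈ R i ∩ Metric.thickening η e,
      ∃ q ∈ Metric.thickening η e \ arrangementSet L,
        Metric.hausdorffEDist
          (connectedComponentIn (R i ∩ Metric.thickening η e) p)
          (frontier (connectedComponentIn (Metric.thickening η e \ arrangementSet L) q) ∩
            Metric.thickening η e) < ENNReal.ofReal ρ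

end Arrangement

end

/-! Extrema of curvature produce cusps. Divided by the cube of the speed, the homogeneous lift of
the evolute is `κ (γ, 1) + (N, 0)` with `N` the unit normal. Since `N' = -κ γ'`, its derivative is
`κ' (γ, 1)` (`hasDerivAt_evoluteUnitLift`). In an affine chart the velocity of the evolute is
therefore `κ'` times a continuous nonvanishing vector, and there is a cusp wherever `κ'` changes
sign. The curves are analytic, so this happens at every local extremum of `κ` near which `κ` is not
constant. These points form `curvExtrema F`; they are cusps and vertices at once
(`curvExtrema_subset`), and the rest of the proof counts them.

Maxima at the nodes. Near a node the limit is a product `U V H` with `H` nonzero, which is convex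
along the axis of a sector where `U V H` is positive. A nonsingular nearby curve runs through one of
the two pairs of opposite sectors (`Corner.open_or_adj_open`). Each of its two branches follows one
side of the sector and then the other, so its tangent turns by a fixed amount within a box of size
comparable to `r`. Somewhere its curvature exceeds a bound `ε`, whereas away from the node it is
below `ε` because the limit is straight. Hence each branch has an interior maximum of curvature
(`Corner.exists_isArc`). Two branches at each of the `d (d - 1) / 2` nodes give `d (d - 1)` extrema.

Minima along respected edges. If the branches at the two ends of an edge ran along it on different
sides, a connected piece of the curve would cross the line (`Edge.exists_crossing`), which respect
for the edge forbids (`not_cross_of_hausdorffEDist_lt`). So they lie on the same side, and the curve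
joins the two maxima by an arc that is nearly straight in the middle. With one orientation of the
curve, the curvature is above `ε` at both ends of this arc and below `ε` in between, which forces a
minimum (`Edge.exists_mem_curvExtrema`). Different edges give different minima
(`encard_add_encard_le`).

The product deformation. A product of positive affine functions is logarithmically concave. Each
sign pattern of the factors therefore allows at most one critical value, and small nonzero levels
are nonsingular (`finite_criticalValues`). For the same reason, in a small convex neighbourhood of
an edge, the part of a level curve with given signs is connected; it converges to the boundary of
its chamber as the level tends to `0`. Thus every bounded edge is respected
(`respectsEdge_of_mem_boundedEdges`). There are at least `d (d - 2)` of them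
(`le_encard_boundedEdges`), and `d (d - 1) + d (d - 2) = d (2 d - 3)`. -/

noncomputable section

namespace PlaneCurve

open MvPolynomial (pderiv C X)

/-! ### Bivariate polynomials as functions on the plane, and their directional derivatives. -/

/-- The value of a bivariate polynomial at a point of the plane. -/
def ev (F : MvPolynomial (Fin 2) ℝ) (p : Plane) : ℝ := MvPolynomial.eval (fun i => p i) F

/-- The derivative of a bivariate polynomial in the direction `v`. -/
def dirD (v : Plane) (F : MvPolynomial (Fin 2) ℝ) : MvPolynomial (Fin 2) ℝ :=
  C (v 0) * pderiv 0 F + C (v 1) * pderiv 1 F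

/-- The determinant of two plane vectors. -/
def det₂ (a b : Plane) : ℝ := a 0 * b 1 - a 1 * b 0

theorem mem_realCurve {F : MvPolynomial (Fin 2) ℝ} {p : Plane} : p ∈ realCurve F ↔ ev F p = 0 :=
  Iff.rfl

@[simp] theorem ev_add (F G : MvPolynomial (Fin 2) ℝ) (p : Plane) :
    ev (F + G) p = ev F p + ev G p := map_add _ _ _

@[simp] theorem ev_sub (F G : MvPolynomial (Fin 2) ℝ) (p : Plane) :
    ev (F - G) p = ev F p - ev G p := map_sub _ _ _

@[simp] theorem ev_neg (F : MvPolynomial (Fin 2) ℝ) (p : Plane) :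
    ev (-F) p = - ev F p := map_neg _ _

@[simp] theorem ev_mul (F G : MvPolynomial (Fin 2) ℝ) (p : Plane) :
    ev (F * G) p = ev F p * ev G p := map_mul _ _ _

@[simp] theorem ev_C (c : ℝ) (p : Plane) : ev (C c) p = c := MvPolynomial.eval_C _

@[simp] theorem ev_X (j : Fin 2) (p : Plane) : ev (X j) p = p j := MvPolynomial.eval_X _

@[simp] theorem ev_one (p : Plane) : ev 1 p = 1 := map_one _

@[simp] theorem ev_zero (p : Plane) : ev 0 p = 0 := map_zero _

theorem ev_prod {ι : Type*} (s : Finset ι) (f : ι → MvPolynomial (Fin 2) ℝ) (p : Plane) :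
    ev (∏ i ∈ s, f i) p = ∏ i ∈ s, ev (f i) p := map_prod _ _ _

theorem ev_dirD (v : Plane) (F : MvPolynomial (Fin 2) ℝ) (p : Plane) :
    ev (dirD v F) p = v 0 * ev (pderiv 0 F) p + v 1 * ev (pderiv 1 F) p := by
  simp [dirD]

theorem dirD_neg_poly (v : Plane) (F : MvPolynomial (Fin 2) ℝ) : dirD v (-F) = - dirD v F := by
  simp only [dirD, map_neg]; ring

theorem ev_dirD_neg (v : Plane) (F : MvPolynomial (Fin 2) ℝ) (p : Plane) :
    ev (dirD (-v) F) p = - ev (dirD v F) p := by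
  simp only [ev_dirD, PiLp.neg_apply]; ring

theorem dirD_mul (v : Plane) (F G : MvPolynomial (Fin 2) ℝ) :
    dirD v (F * G) = dirD v F * G + F * dirD v G := by
  simp only [dirD, Derivation.leibniz, smul_eq_mul]; ring

theorem dirD_add_poly (v : Plane) (F G : MvPolynomial (Fin 2) ℝ) :
    dirD v (F + G) = dirD v F + dirD v G := by
  simp only [dirD, map_add]; ring

@[simp] theorem dirD_C (v : Plane) (c : ℝ) : dirD v (C c) = 0 := by
  simp [dirD]

@[simp] theorem dirD_one (v : Plane) : dirD v 1 = 0 := by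
  simp [dirD]

/-- The commutator of two derivations is a derivation, so it vanishes once it kills the variables.
-/
theorem pderiv_comm (F : MvPolynomial (Fin 2) ℝ) :
    pderiv 1 (pderiv 0 F) = pderiv 0 (pderiv 1 F) := by
  have h0 : ⁅pderiv (R := ℝ) (1 : Fin 2), pderiv (R := ℝ) (0 : Fin 2)⁆ = 0 := by
    apply MvPolynomial.derivation_ext
    intro i
    simp [Derivation.commutator_apply, MvPolynomial.pderiv_X, Pi.single_apply]
    split_ifs <;> simp
  have := congrArg (fun D => D F) h0
  simpa [Derivation.commutator_apply, sub_eq_zero] using this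

theorem ev_dirD_dirD (v w : Plane) (F : MvPolynomial (Fin 2) ℝ) (p : Plane) :
    ev (dirD v (dirD w F)) p = v 0 * w 0 * ev (pderiv 0 (pderiv 0 F)) p
      + (v 0 * w 1 + v 1 * w 0) * ev (pderiv 0 (pderiv 1 F)) p
      + v 1 * w 1 * ev (pderiv 1 (pderiv 1 F)) p := by
  have h := pderiv_comm F
  simp only [dirD, map_add, Derivation.leibniz, MvPolynomial.pderiv_C,
    smul_eq_mul, ev_add, ev_mul, ev_C, ev_zero, h]
  ring

/-- Class `ω`, that is analyticity, is what later makes the critical points of a nonconstant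
curvature isolated. -/
theorem contDiff_ev (F : MvPolynomial (Fin 2) ℝ) : ContDiff ℝ ω (ev F) := by
  induction F using MvPolynomial.induction_on with
  | C a => simpa [funext (ev_C a)] using contDiff_const
  | add p q hp hq => simpa [funext (ev_add p q)] using hp.add hq
  | mul_X p i hp =>
    have : ev (p * X i) = fun x => ev p x * x i := by ext x; simp
    rw [this]
    exact hp.mul (by fun_prop)

theorem continuous_ev (F : MvPolynomial (Fin 2) ℝ) : Continuous (ev F) := (contDiff_ev F).continuous

theorem hasDerivAt_ev (F : MvPolynomial (Fin 2) ℝ) {γ : ℝ → Plane} {v : Plane} {t : ℝ}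
    (h : HasDerivAt γ v t) : HasDerivAt (fun s => ev F (γ s)) (ev (dirD v F) (γ t)) t := by
  have hc (i : Fin 2) : HasDerivAt (fun s => γ s i) (v i) t := by
    exact (EuclideanSpace.proj (𝕜 := ℝ) i).hasFDerivAt.comp_hasDerivAt t h
  induction F using MvPolynomial.induction_on with
  | C a => simpa using hasDerivAt_const t a
  | add p q hp hq => 
    simp only [dirD_add_poly, ev_add]
    exact hp.add hq
  | mul_X p i hp =>
    have hX : ev (dirD v (X i)) (γ t) = v i := by
      rw [ev_dirD]
      fin_cases i <;> simp [MvPolynomial.pderiv_X]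
    simp only [ev_mul, ev_X, dirD_mul, ev_add, hX]
    exact hp.mul (hc i)

theorem hasDerivAt_ev_line (F : MvPolynomial (Fin 2) ℝ) (p v : Plane) (t : ℝ) :
    HasDerivAt (fun s : ℝ => ev F (p + s • v)) (ev (dirD v F) (p + t • v)) t := by
  apply hasDerivAt_ev
  simpa using ((hasDerivAt_id t).smul_const v).const_add p

/-! ### Analytic graphs from the implicit function theorem. -/

/-- The analytic implicit function theorem for a function of two real variables. -/
theorem exists_analytic_graph {G : ℝ × ℝ → ℝ} {t₀ s₀ c : ℝ} (hG : ContDiffAt ℝ ω G (t₀, s₀))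
    (h0 : G (t₀, s₀) = 0) (hd : HasDerivAt (fun s => G (t₀, s)) c s₀) (hc : c ≠ 0) :
    ∃ σ : ℝ → ℝ, ContDiffAt ℝ ω σ t₀ ∧ σ t₀ = s₀ ∧ (∀ᶠ t in 𝓝 t₀, G (t, σ t) = 0) ∧
      ∀ᶠ v in 𝓝 (t₀, s₀), G v = 0 → v.2 = σ v.1 := by
  have hn : (ω : WithTop ℕ∞) ≠ 0 := by simp
  have hinv : (fderiv ℝ G (t₀, s₀) ∘L .inr ℝ ℝ ℝ).IsInvertible := by
    have h1 : HasFDerivAt G (fderiv ℝ G (t₀, s₀)) (t₀, s₀) :=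
      (hG.differentiableAt hn).hasFDerivAt
    have h2 : HasDerivAt (fun s => G (t₀, s)) ((fderiv ℝ G (t₀, s₀)) (0, 1)) s₀ :=
      h1.comp_hasDerivAt s₀ ((hasDerivAt_const s₀ t₀).prodMk (hasDerivAt_id s₀))
    have h3 : fderiv ℝ G (t₀, s₀) (0, 1) = c := h2.unique hd
    refine ⟨ContinuousLinearEquiv.smulLeft (Units.mk0 c hc), ?_⟩
    ext
    simp [h3]
  refine ⟨hG.implicitFunction hn hinv, ?_, ?_, ?_, ?_⟩
  · exact hG.contDiffAt_implicitFunction hn hinv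
  · exact hG.implicitFunction_apply_self hn hinv
  · have := hG.eventually_apply_implicitFunction hn hinv
    simpa [h0] using this
  · have := hG.eventually_apply_eq_iff_implicitFunction hn hinv
    filter_upwards [this] with v hv h
    exact (hv.1 (h.trans h0.symm)).symm

/-- Near a point with `∂F/∂a ≠ 0`, the curve `F = 0` is an analytic graph in the frame `b, a`. -/
theorem exists_local_graph {F : MvPolynomial (Fin 2) ℝ} {p a b : Plane} {t₀ s₀ : ℝ}
    (h0 : ev F (p + t₀ • b + s₀ • a) = 0) (hd : ev (dirD a F) (p + t₀ • b + s₀ • a) ≠ 0) :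
    ∃ σ : ℝ → ℝ, ContDiffAt ℝ ω σ t₀ ∧ σ t₀ = s₀ ∧
      (∀ᶠ t in 𝓝 t₀, ev F (p + t • b + σ t • a) = 0) ∧
      ∀ᶠ v in 𝓝 (t₀, s₀), ev F (p + v.1 • b + v.2 • a) = 0 → v.2 = σ v.1 := by
  apply exists_analytic_graph (G := fun v => ev F (p + v.1 • b + v.2 • a)) _ h0
    (hasDerivAt_ev_line F (p + t₀ • b) a s₀) hd
  apply (contDiff_ev F).contDiffAt.comp
  fun_prop

section



/-! ### The curvature of a level curve -/

/-- The squared norm of the gradient. -/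
def gradSq (F : MvPolynomial (Fin 2) ℝ) (p : Plane) : ℝ :=
  ev (pderiv 0 F) p ^ 2 + ev (pderiv 1 F) p ^ 2

/-- The numerator of the curvature of a level curve. -/
def curvNum (F : MvPolynomial (Fin 2) ℝ) (p : Plane) : ℝ :=
  ev (pderiv 0 (pderiv 0 F)) p * ev (pderiv 1 F) p ^ 2
    - 2 * ev (pderiv 0 (pderiv 1 F)) p * ev (pderiv 0 F) p * ev (pderiv 1 F) p
    + ev (pderiv 1 (pderiv 1 F)) p * ev (pderiv 0 F) p ^ 2

/-- The signed curvature of the level curve of `F`, oriented by the rotated gradient. -/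
def curv (F : MvPolynomial (Fin 2) ℝ) (p : Plane) : ℝ :=
  curvNum F p / √(gradSq F p) ^ 3

theorem curv_neg (F : MvPolynomial (Fin 2) ℝ) (p : Plane) : curv (-F) p = - curv F p := by
  simp only [curv, curvNum, gradSq, map_neg, ev_neg]
  ring_nf

theorem gradSq_neg (F : MvPolynomial (Fin 2) ℝ) (p : Plane) : gradSq (-F) p = gradSq F p := by
  simp only [gradSq, map_neg, ev_neg]
  ring_nf

theorem continuousAt_curv {F : MvPolynomial (Fin 2) ℝ} {p : Plane} (h : 0 < gradSq F p) :
    ContinuousAt (curv F) p := by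
  have hc := fun G => (continuous_ev G).continuousAt (x := p)
  unfold curv
  refine ContinuousAt.div ?_ ?_ (by positivity)
  · unfold curvNum
    exact (((hc _).mul ((hc _).pow 2)).sub (((continuousAt_const.mul (hc _)).mul (hc _)).mul
      (hc _))).add ((hc _).mul ((hc _).pow 2))
  · unfold gradSq
    exact (((hc _).pow 2).add ((hc _).pow 2)).sqrt.pow 3

theorem norm_sq_plane (v : Plane) : ‖v‖ ^ 2 = v 0 ^ 2 + v 1 ^ 2 := by
  rw [EuclideanSpace.norm_sq_eq, Fin.sum_univ_two]
  simp

theorem norm_plane (v : Plane) : ‖v‖ = √(v 0 ^ 2 + v 1 ^ 2) := by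
  rw [← norm_sq_plane, Real.sqrt_sq (norm_nonneg v)]

/-- Here `(x, y)` is the velocity, `(X, Y)` the acceleration, `g` the gradient and `h` the Hessian.
Orthogonality `h1` and the orientation `hd` make the velocity a positive multiple `l` of the rotated
gradient `(-g₂, g₁)`; the second derivative relation `h2` then eliminates the acceleration, and the
powers of `l` cancel. -/
theorem curvature_algebra {g₁ g₂ x y X Y h₁₁ h₁₂ h₂₂ : ℝ} (h1 : x * g₁ + y * g₂ = 0)
    (h2 : x * x * h₁₁ + (x * y + y * x) * h₁₂ + y * y * h₂₂ + (X * g₁ + Y * g₂) = 0)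
    (hd : 0 < g₁ * y - g₂ * x) :
    (x * Y - y * X) / √(x ^ 2 + y ^ 2) ^ 3
      = (h₁₁ * g₂ ^ 2 - 2 * h₁₂ * g₁ * g₂ + h₂₂ * g₁ ^ 2) / √(g₁ ^ 2 + g₂ ^ 2) ^ 3 := by
  have hG : 0 < g₁ ^ 2 + g₂ ^ 2 := by
    by_contra hn
    have h3 : g₁ ^ 2 = 0 := by nlinarith [sq_nonneg g₁, sq_nonneg g₂]
    have h4 : g₂ ^ 2 = 0 := by nlinarith [sq_nonneg g₁, sq_nonneg g₂]
    have h5 : g₁ = 0 := by simpa using h3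
    have h6 : g₂ = 0 := by simpa using h4
    simp [h5, h6] at hd
  obtain ⟨l, hl⟩ : ∃ l, l = (g₁ * y - g₂ * x) / (g₁ ^ 2 + g₂ ^ 2) := ⟨_, rfl⟩
  have hl0 : 0 < l := by rw [hl]; positivity
  have hlG : l * (g₁ ^ 2 + g₂ ^ 2) = g₁ * y - g₂ * x := by rw [hl]; field_simp
  have hx : x = -l * g₂ := by
    have : (x + l * g₂) * (g₁ ^ 2 + g₂ ^ 2) = 0 := by linear_combination g₂ * hlG + g₁ * h1
    have := (mul_eq_zero.1 this).resolve_right hG.ne'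
    linarith
  have hy : y = l * g₁ := by
    have : (y - l * g₁) * (g₁ ^ 2 + g₂ ^ 2) = 0 := by linear_combination -g₁ * hlG + g₂ * h1
    have := (mul_eq_zero.1 this).resolve_right hG.ne'
    linarith
  have hs : √(x ^ 2 + y ^ 2) = l * √(g₁ ^ 2 + g₂ ^ 2) := by
    rw [show x ^ 2 + y ^ 2 = l ^ 2 * (g₁ ^ 2 + g₂ ^ 2) by rw [hx, hy]; ring,
      Real.sqrt_mul (sq_nonneg l), Real.sqrt_sq hl0.le]
  have hW : x * Y - y * X = l ^ 3 * (h₁₁ * g₂ ^ 2 - 2 * h₁₂ * g₁ * g₂ + h₂₂ * g₁ ^ 2) := by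
    have : X * g₁ + Y * g₂ = -(x * x * h₁₁ + (x * y + y * x) * h₁₂ + y * y * h₂₂) := by linarith
    rw [hx, hy] at this ⊢
    linear_combination (-l) * this
  have hq : 0 < √(g₁ ^ 2 + g₂ ^ 2) := Real.sqrt_pos.2 hG
  rw [hs, hW, mul_pow]
  field_simp

theorem hasDerivAt_coord {γ : ℝ → Plane} {v : Plane} {t : ℝ} (h : HasDerivAt γ v t) (i : Fin 2) :
    HasDerivAt (fun s => γ s i) (v i) t :=
  (EuclideanSpace.proj (𝕜 := ℝ) i).hasFDerivAt.comp_hasDerivAt t h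

section OnCurve

variable {F : MvPolynomial (Fin 2) ℝ} {γ : ℝ → Plane} {t : ℝ}

theorem eventually_hasDerivAt (hγ : AnalyticAt ℝ γ t) :
    ∀ᶠ s in 𝓝 t, HasDerivAt γ (deriv γ s) s :=
  hγ.eventually_analyticAt.mono fun _ h => h.differentiableAt.hasDerivAt

theorem ev_dirD_deriv_eq_zero (hγ : AnalyticAt ℝ γ t) (h0 : ∀ᶠ s in 𝓝 t, ev F (γ s) = 0) :
    ∀ᶠ s in 𝓝 t, ev (dirD (deriv γ s) F) (γ s) = 0 := by
  filter_upwards [eventually_hasDerivAt hγ, h0.eventually_nhds] with s hs hs0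
  exact (hasDerivAt_ev F hs).unique
    ((hasDerivAt_const s (0 : ℝ)).congr_of_eventuallyEq hs0)

theorem second_derivative_relation (hγ : AnalyticAt ℝ γ t) (h0 : ∀ᶠ s in 𝓝 t, ev F (γ s) = 0) :
    ev (dirD (deriv γ t) (dirD (deriv γ t) F)) (γ t)
      + ev (dirD (deriv (deriv γ) t) F) (γ t) = 0 := by
  have h1 := ev_dirD_deriv_eq_zero hγ h0
  have hd := (eventually_hasDerivAt hγ).self_of_nhds
  have hdd := (eventually_hasDerivAt hγ.deriv).self_of_nhds
  have h2 : HasDerivAt (fun s => ev (dirD (deriv γ s) F) (γ s))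
      (ev (dirD (deriv γ t) (dirD (deriv γ t) F)) (γ t)
      + ev (dirD (deriv (deriv γ) t) F) (γ t)) t := by
    rw [ev_dirD_dirD]
    simp only [ev_dirD]
    have e0 := (hasDerivAt_coord hdd 0).mul (hasDerivAt_ev (pderiv 0 F) hd)
    have e1 := (hasDerivAt_coord hdd 1).mul (hasDerivAt_ev (pderiv 1 F) hd)
    have := e0.add e1
    convert! this using 1
    simp only [ev_dirD, pderiv_comm]
    ring
  exact h2.unique ((hasDerivAt_const t (0 : ℝ)).congr_of_eventuallyEq h1)

theorem signedCurvature_eq_curv (hγ : AnalyticAt ℝ γ t) (h0 : ∀ᶠ s in 𝓝 t, ev F (γ s) = 0)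
    (hd : 0 < ev (pderiv 0 F) (γ t) * deriv γ t 1 - ev (pderiv 1 F) (γ t) * deriv γ t 0) :
    signedCurvature γ t = curv F (γ t) := by
  have h1 := (ev_dirD_deriv_eq_zero hγ h0).self_of_nhds
  have h2 := second_derivative_relation hγ h0
  rw [ev_dirD_dirD, ev_dirD] at h2
  rw [ev_dirD] at h1
  rw [signedCurvature, wronskian₂, norm_plane, curv, curvNum, gradSq]
  exact curvature_algebra h1 h2 hd

/-- Replacing `F` by `-F` reverses the orientation and the sign of `curv`. -/
theorem signedCurvature_eq_neg_curv (hγ : AnalyticAt ℝ γ t) (h0 : ∀ᶠ s in 𝓝 t, ev F (γ s) = 0)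
    (hd : ev (pderiv 0 F) (γ t) * deriv γ t 1 - ev (pderiv 1 F) (γ t) * deriv γ t 0 < 0) :
    signedCurvature γ t = - curv F (γ t) := by
  rw [← curv_neg]
  apply signedCurvature_eq_curv hγ
  · simpa using h0
  · simp only [map_neg, ev_neg]; linarith

end OnCurve

/-! ### Sign changes of the derivative at a local extremum -/

/-- Without zeros to the left of `t`, the continuous derivative keeps one sign there. A positive
sign would make `k` strictly increasing up to `t`, against minimality. -/
theorem eventually_deriv_neg_left {k : ℝ → ℝ} {t : ℝ} (hk : AnalyticAt ℝ k t)
    (hne : ∀ᶠ s in 𝓝[≠] t, deriv k s ≠ 0) (hmin : IsLocalMin k t) :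
    ∀ᶠ s in 𝓝[<] t, deriv k s < 0 := by
  have h1 : ∀ᶠ s in 𝓝 t, AnalyticAt ℝ k s ∧ k t ≤ k s ∧ (s ≠ t → deriv k s ≠ 0) := by
    filter_upwards [hk.eventually_analyticAt, hmin, eventually_nhdsWithin_iff.1 hne]
      with s h1 h2 h3 using ⟨h1, h2, h3⟩
  obtain ⟨e, he, hball⟩ := Metric.eventually_nhds_iff.1 h1
  have hI : ∀ s ∈ Set.Ioc (t - e) t, AnalyticAt ℝ k s ∧ k t ≤ k s ∧ (s ≠ t → deriv k s ≠ 0) := by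
    intro s hs
    apply hball
    rw [Real.dist_eq, abs_lt]
    constructor <;> linarith [hs.1, hs.2]
  have hcont : ContinuousOn (deriv k) (Set.Ioo (t - e) t) := fun s hs =>
    (hI s ⟨hs.1, hs.2.le⟩).1.deriv.continuousAt.continuousWithinAt
  have hmem : Set.Ioo (t - e) t ∈ 𝓝[<] t := Ioo_mem_nhdsLT (by linarith)
  rcases isPreconnected_Ioo.mapsTo_Ioi_or_Iio hcont
    (b := 0) (fun s hs => (hI s ⟨hs.1, hs.2.le⟩).2.2 hs.2.ne) with h | h
  · exfalso
    have hmono : StrictMonoOn k (Set.Ioc (t - e) t) := by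
      apply strictMonoOn_of_deriv_pos (convex_Ioc _ _)
      · exact fun s hs => (hI s hs).1.continuousAt.continuousWithinAt
      · rw [interior_Ioc]; exact fun s hs => h hs
    have h3 : t - e / 2 ∈ Set.Ioc (t - e) t := ⟨by linarith, by linarith⟩
    have := hmono h3 ⟨by linarith, le_rfl⟩ (by linarith)
    linarith [(hI _ h3).2.1]
  · exact mem_of_superset hmem h

/-- The left-hand statement applied to `s ↦ k (-s)`. -/
theorem eventually_deriv_pos_right {k : ℝ → ℝ} {t : ℝ} (hk : AnalyticAt ℝ k t)
    (hne : ∀ᶠ s in 𝓝[≠] t, deriv k s ≠ 0) (hmin : IsLocalMin k t) :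
    ∀ᶠ s in 𝓝[>] t, 0 < deriv k s := by
  have hd (s : ℝ) : deriv (fun s => k (-s)) s = - deriv k (-s) := deriv_comp_neg k s
  have hneg : Tendsto (fun s : ℝ => -s) (𝓝 (-t)) (𝓝 t) := by
    simpa using (continuous_neg.tendsto (-t))
  have hk' : AnalyticAt ℝ (fun s => k (-s)) (-t) := by
    apply AnalyticAt.comp (g := k) (f := fun s : ℝ => -s)
    · simpa using hk
    · exact analyticAt_id.neg
  have hmin' : IsLocalMin (fun s => k (-s)) (-t) := by
    have := hneg.eventually hmin
    simpa [IsLocalMin, IsMinFilter] using this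
  have hne' : ∀ᶠ s in 𝓝[≠] (-t), deriv (fun s => k (-s)) s ≠ 0 := by
    rw [eventually_nhdsWithin_iff] at hne ⊢
    filter_upwards [hneg.eventually hne] with s hs hst
    rw [hd, neg_ne_zero]
    exact hs (fun h => hst (by rw [Set.mem_singleton_iff] at h ⊢; linarith))
  have h := eventually_deriv_neg_left hk' hne' hmin'
  have hneg2 : Tendsto (fun s : ℝ => -s) (𝓝[>] t) (𝓝[<] (-t)) := by
    apply tendsto_nhdsWithin_of_tendsto_nhds_of_eventually_within
    · exact (continuous_neg.tendsto t).mono_left nhdsWithin_le_nhds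
    · filter_upwards [self_mem_nhdsWithin] with s hs
      exact neg_lt_neg (Set.mem_Ioi.1 hs)
  filter_upwards [hneg2.eventually h] with s hs
  rw [hd, neg_neg] at hs
  linarith

/-- The zeros of the analytic function `deriv k` are isolated unless it vanishes near `t`, and then
`k` is locally constant. -/
theorem eventually_deriv_ne_zero {k : ℝ → ℝ} {t : ℝ} (hk : AnalyticAt ℝ k t)
    (hc : ¬ ∀ᶠ s in 𝓝 t, k s = k t) : ∀ᶠ s in 𝓝[≠] t, deriv k s ≠ 0 := by
  refine hk.deriv.eventually_eq_zero_or_eventually_ne_zero.resolve_left fun h => hc ?_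
  obtain ⟨e, he, hball⟩ := Metric.eventually_nhds_iff_ball.1 (h.and hk.eventually_analyticAt)
  refine Metric.eventually_nhds_iff_ball.2 ⟨e, he, fun s hs => ?_⟩
  exact Metric.isOpen_ball.is_const_of_deriv_eq_zero (convex_ball t e).isPreconnected
    (fun x hx => (hball x hx).2.differentiableAt.differentiableWithinAt)
    (fun x hx => (hball x hx).1) hs (Metric.mem_ball_self he)

end

section



/-! ### Cusps of the evolute -/

/-- The unit tangent is `B / ‖B‖` times the sign of `f`, so a change of sign of `f` reverses it. -/
theorem hasCuspAt_of_deriv_eq_smul {c B : ℝ → Plane} {f : ℝ → ℝ} {t : ℝ}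
    (hc : ContDiffAt ℝ ∞ c t) (hB : ContinuousAt B t) (hB0 : B t ≠ 0)
    (hd : ∀ᶠ s in 𝓝 t, deriv c s = f s • B s) (hf : f t = 0)
    (hl : ∀ᶠ s in 𝓝[<] t, f s < 0) (hr : ∀ᶠ s in 𝓝[>] t, 0 < f s) : HasCuspAt c t := by
  have hlim : Tendsto (fun s => ‖B s‖⁻¹ • B s) (𝓝 t) (𝓝 (‖B t‖⁻¹ • B t)) :=
    (hB.norm.inv₀ (norm_ne_zero_iff.2 hB0)).smul hB
  refine ⟨hc, by rw [hd.self_of_nhds, hf, zero_smul], ‖B t‖⁻¹ • B t, ?_, ?_, ?_⟩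
  · rw [norm_smul, norm_inv, norm_norm, inv_mul_cancel₀ (norm_ne_zero_iff.2 hB0)]
  · refine (hlim.neg.mono_left nhdsWithin_le_nhds).congr' ?_
    filter_upwards [hl, nhdsWithin_le_nhds hd] with s hs hds
    rw [hds, norm_smul, Real.norm_eq_abs, abs_of_neg hs, mul_inv, smul_smul, ← neg_smul]
    congr 1
    field_simp [hs.ne]
  · refine (hlim.mono_left nhdsWithin_le_nhds).congr' ?_
    filter_upwards [hr, nhdsWithin_le_nhds hd] with s hs hds
    rw [hds, norm_smul, Real.norm_eq_abs, abs_of_pos hs, mul_inv, smul_smul]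
    congr 1
    field_simp [hs.ne']

section Evolute

variable {γ : ℝ → Plane} {t : ℝ}

theorem analyticAt_coord (hγ : AnalyticAt ℝ γ t) (i : Fin 2) : AnalyticAt ℝ (fun s => γ s i) t :=
  ((EuclideanSpace.proj (𝕜 := ℝ) i).analyticAt (γ t)).comp hγ

theorem analyticAt_norm (hγ : AnalyticAt ℝ γ t) (h0 : γ t ≠ 0) :
    AnalyticAt ℝ (fun s => ‖γ s‖) t :=
  (hγ.contDiffAt.norm ℝ h0).analyticAt

theorem analyticAt_wronskian₂ (hγ : AnalyticAt ℝ γ t) : AnalyticAt ℝ (wronskian₂ γ) t :=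
  ((analyticAt_coord hγ.deriv 0).mul (analyticAt_coord hγ.deriv.deriv 1)).sub
    ((analyticAt_coord hγ.deriv 1).mul (analyticAt_coord hγ.deriv.deriv 0))

theorem analyticAt_signedCurvature (hγ : AnalyticAt ℝ γ t) (h0 : deriv γ t ≠ 0) :
    AnalyticAt ℝ (signedCurvature γ) t :=
  (analyticAt_wronskian₂ hγ).div ((analyticAt_norm hγ.deriv h0).pow 3)
    (pow_ne_zero _ (norm_ne_zero_iff.2 h0))

/-- The homogeneous coordinates of the evolute, divided by the cube of the speed. -/
def evoluteUnitLift (γ : ℝ → Plane) (t : ℝ) : Fin 3 → ℝ :=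
  ![γ t 0 * signedCurvature γ t - deriv γ t 1 / ‖deriv γ t‖,
    γ t 1 * signedCurvature γ t + deriv γ t 0 / ‖deriv γ t‖,
    signedCurvature γ t]

theorem evoluteLift_eq_smul (h0 : deriv γ t ≠ 0) :
    evoluteLift γ t = ‖deriv γ t‖ ^ 3 • evoluteUnitLift γ t := by
  have hv : ‖deriv γ t‖ ≠ 0 := norm_ne_zero_iff.2 h0
  ext i
  fin_cases i <;> simp [evoluteLift, evoluteUnitLift, signedCurvature] <;> field_simp

/-- The normalised lift is `κ (γ, 1) + (N, 0)` with `N = (-y', x') / ‖γ'‖`. By the Frenet formula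
`N' = -κ γ'`, the terms containing `γ'` cancel. In the proof `hnn` is half the derivative of `‖γ'‖²`
and `hW` defines `κ`. -/
theorem hasDerivAt_evoluteUnitLift (hγ : AnalyticAt ℝ γ t) (h0 : deriv γ t ≠ 0) :
    HasDerivAt (evoluteUnitLift γ)
      (deriv (signedCurvature γ) t • ![γ t 0, γ t 1, 1]) t := by
  have hv : 0 < ‖deriv γ t‖ := norm_pos_iff.2 h0
  have hk := (analyticAt_signedCurvature hγ h0).differentiableAt.hasDerivAt
  have h1 := hγ.differentiableAt.hasDerivAt
  have h2 := hγ.deriv.differentiableAt.hasDerivAt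
  have hn := (analyticAt_norm hγ.deriv h0).differentiableAt.hasDerivAt
  obtain ⟨n', hn'⟩ : ∃ n', n' = deriv (fun s => ‖deriv γ s‖) t := ⟨_, rfl⟩
  rw [← hn'] at hn
  have hnn : ‖deriv γ t‖ * n'
      = deriv γ t 0 * deriv (deriv γ) t 0 + deriv γ t 1 * deriv (deriv γ) t 1 := by
    have e1 := hn.pow 2
    have e2 := ((hasDerivAt_coord h2 0).pow 2).add ((hasDerivAt_coord h2 1).pow 2)
    have e3 : (fun s => ‖deriv γ s‖) ^ 2
        = (fun s => deriv γ s 0) ^ 2 + (fun s => deriv γ s 1) ^ 2 := by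
      ext s; simpa using norm_sq_plane (deriv γ s)
    rw [← e3] at e2
    have := e1.unique e2
    norm_num at this
    linarith
  have hsq := norm_sq_plane (deriv γ t)
  have hW : signedCurvature γ t * ‖deriv γ t‖ ^ 3
      = deriv γ t 0 * deriv (deriv γ) t 1 - deriv γ t 1 * deriv (deriv γ) t 0 := by
    rw [signedCurvature, wronskian₂]; field_simp
  obtain ⟨v, hv'⟩ : ∃ v, v = ‖deriv γ t‖ := ⟨_, rfl⟩
  obtain ⟨k, hk'⟩ : ∃ k, k = signedCurvature γ t := ⟨_, rfl⟩
  rw [hasDerivAt_pi]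
  intro i
  fin_cases i
  · have e := ((hasDerivAt_coord h1 0).mul hk).sub ((hasDerivAt_coord h2 1).div hn hv.ne')
    convert! e using 1
    simp only [← hv', ← hk'] at *
    simp
    field_simp
    apply mul_left_cancel₀ hv.ne'
    linear_combination (deriv (deriv γ) t 1) * hsq - deriv γ t 0 * hW - deriv γ t 1 * hnn
  · have e := ((hasDerivAt_coord h1 1).mul hk).add ((hasDerivAt_coord h2 0).div hn hv.ne')
    convert! e using 1
    simp only [← hv', ← hk'] at *
    simp
    field_simp
    apply mul_left_cancel₀ hv.ne'
    linear_combination -(deriv (deriv γ) t 0) * hsq - deriv γ t 1 * hW + deriv γ t 0 * hnn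
  · have e := hk
    convert! e using 1
    simp

theorem analyticAt_evoluteUnitLift (hγ : AnalyticAt ℝ γ t) (h0 : deriv γ t ≠ 0) :
    AnalyticAt ℝ (evoluteUnitLift γ) t := by
  have hk := analyticAt_signedCurvature hγ h0
  have hn := analyticAt_norm hγ.deriv h0
  have hv := norm_ne_zero_iff.2 h0
  rw [analyticAt_pi_iff]
  intro i
  fin_cases i
  · exact ((analyticAt_coord hγ 0).mul hk).sub ((analyticAt_coord hγ.deriv 1).div hn hv)
  · exact ((analyticAt_coord hγ 1).mul hk).add ((analyticAt_coord hγ.deriv 0).div hn hv)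
  · exact hk

theorem evoluteUnitLift_ne_zero (h0 : deriv γ t ≠ 0) : evoluteUnitLift γ t ≠ 0 := by
  intro h
  have hv : ‖deriv γ t‖ ≠ 0 := norm_ne_zero_iff.2 h0
  have hk : signedCurvature γ t = 0 := congrFun h 2
  have e0 : γ t 0 * signedCurvature γ t - deriv γ t 1 / ‖deriv γ t‖ = 0 := congrFun h 0
  have e1 : γ t 1 * signedCurvature γ t + deriv γ t 0 / ‖deriv γ t‖ = 0 := congrFun h 1
  rw [hk] at e0 e1
  apply h0
  ext i
  fin_cases i
  · simpa [hv] using e1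
  · simpa [hv] using e0

/-- A permutation of the coordinates moves a nonzero one to the last place and gives the chart.
There the velocity is `κ'` times a nonvanishing vector `B`, and `κ'` changes sign at an isolated
local extremum. -/
theorem hasProjCuspAt_evoluteLift (hγ : AnalyticAt ℝ γ t) (h0 : deriv γ t ≠ 0)
    (hc : ¬ ∀ᶠ s in 𝓝 t, signedCurvature γ s = signedCurvature γ t)
    (hex : IsLocalExtr (signedCurvature γ) t) : HasProjCuspAt (evoluteLift γ) t := by
  have hk := analyticAt_signedCurvature hγ h0
  obtain ⟨i, hi⟩ : ∃ i, evoluteUnitLift γ t i ≠ 0 :=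
    Function.ne_iff.1 (evoluteUnitLift_ne_zero h0)
  obtain ⟨A, hA⟩ : ∃ A : (Fin 3 → ℝ) ≃ₗ[ℝ] (Fin 3 → ℝ), A (evoluteUnitLift γ t) 2 ≠ 0 :=
    ⟨LinearEquiv.funCongrLeft ℝ ℝ (Equiv.swap i 2), by
      simpa [LinearEquiv.funCongrLeft_apply, LinearMap.funLeft_apply] using hi⟩
  have hnear : ∀ᶠ s in 𝓝 t, AnalyticAt ℝ γ s ∧ deriv γ s ≠ 0 :=
    hγ.eventually_analyticAt.and (hγ.deriv.continuousAt.eventually_ne h0)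
  obtain ⟨A', hA'⟩ : ∃ A' : (Fin 3 → ℝ) →L[ℝ] (Fin 3 → ℝ), ∀ x, A' x = A x :=
    ⟨LinearMap.toContinuousLinearMap A.toLinearMap, fun x => rfl⟩
  have hAan : AnalyticAt ℝ (fun s => A (evoluteUnitLift γ s)) t := by
    have := (A'.analyticAt _).comp (analyticAt_evoluteUnitLift hγ h0)
    simpa only [Function.comp_def, hA'] using this
  have hAanj (j : Fin 3) : AnalyticAt ℝ (fun s => A (evoluteUnitLift γ s) j) t :=
    analyticAt_pi_iff.1 hAan j
  have hA2 : ∀ᶠ s in 𝓝 t, A (evoluteUnitLift γ s) 2 ≠ 0 :=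
    (hAanj 2).continuousAt.eventually_ne hA
  let q : ℝ → Fin 3 → ℝ := fun s => ![γ s 0, γ s 1, 1]
  have hqc : ContinuousAt q t := by
    rw [continuousAt_pi]
    intro j
    fin_cases j
    · exact (analyticAt_coord hγ 0).continuousAt
    · exact (analyticAt_coord hγ 1).continuousAt
    · exact continuousAt_const
  have hAq (j : Fin 3) : ContinuousAt (fun s => A (q s) j) t := by
    have h1 : ContinuousAt (fun s => A' (q s)) t := A'.continuous.continuousAt.comp hqc
    simp only [hA'] at h1
    exact continuousAt_pi.1 h1 j
  -- The quotient rule: `b j` is the derivative of the chart coordinate `j` when the lift moves in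
  -- the direction `q = (γ, 1)`.
  let b : Fin 3 → ℝ → ℝ := fun j s => (A (q s) j * A (evoluteUnitLift γ s) 2
    - A (evoluteUnitLift γ s) j * A (q s) 2) / A (evoluteUnitLift γ s) 2 ^ 2
  have hbc (j : Fin 3) : ContinuousAt (b j) t :=
    (((hAq j).mul (hAanj 2).continuousAt).sub ((hAanj j).continuousAt.mul (hAq 2))).div
      ((hAanj 2).continuousAt.pow 2) (pow_ne_zero _ hA)
  let B : ℝ → Plane := fun s => !₂[b 0 s, b 1 s]
  have hBc : ContinuousAt B t := by
    have : ContinuousAt (fun s => ![b 0 s, b 1 s]) t := by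
      rw [continuousAt_pi]
      intro j
      fin_cases j
      · exact hbc 0
      · exact hbc 1
    exact (PiLp.continuous_toLp 2 _).continuousAt.comp this
  -- If `B` vanished, `q` and the lift would be proportional. This is impossible, since the lift
  -- minus `κ q` is `(N, 0)` with `N` a unit vector.
  have hB0 : B t ≠ 0 := by
    intro hB
    have e (j : Fin 3) (hj : b j t = 0) : A (q t) j * A (evoluteUnitLift γ t) 2
        = A (evoluteUnitLift γ t) j * A (q t) 2 := by
      have := (div_eq_zero_iff.1 hj).resolve_right (pow_ne_zero _ hA)
      linarith
    have e0 := e 0 (congrFun (congrArg WithLp.ofLp hB) 0)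
    have e1 := e 1 (congrFun (congrArg WithLp.ofLp hB) 1)
    have e3 : A (evoluteUnitLift γ t) 2 • q t = A (q t) 2 • evoluteUnitLift γ t := by
      apply A.injective
      rw [map_smul, map_smul]
      ext j
      fin_cases j
      · simpa [mul_comm] using e0
      · simpa [mul_comm] using e1
      · simp [mul_comm]
    have hv : ‖deriv γ t‖ ≠ 0 := norm_ne_zero_iff.2 h0
    have f0 := congrFun e3 0
    have f1 := congrFun e3 1
    have f2 := congrFun e3 2
    simp only [Pi.smul_apply, smul_eq_mul, q, evoluteUnitLift, Matrix.cons_val_zero,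
      Matrix.cons_val_one, Matrix.cons_val] at f0 f1 f2
    have hq2 : A (q t) 2 ≠ 0 := by
      intro h
      simp only [q] at h
      rw [h] at f2
      apply hA
      simp only [evoluteUnitLift]
      linarith
    apply h0
    ext j
    fin_cases j
    · have h5 : A (q t) 2 * (deriv γ t 0 / ‖deriv γ t‖) = 0 := by
        simp only [q]
        linear_combination f2 * γ t 1 - f1
      simpa [hq2, hv] using h5
    · have h5 : A (q t) 2 * (deriv γ t 1 / ‖deriv γ t‖) = 0 := by
        simp only [q]
        linear_combination f1 * 0 + f0 - f2 * γ t 0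
      simpa [hq2, hv] using h5
  let c : ℝ → Plane := fun s => !₂[A (evoluteUnitLift γ s) 0 / A (evoluteUnitLift γ s) 2,
    A (evoluteUnitLift γ s) 1 / A (evoluteUnitLift γ s) 2]
  -- The factor `‖γ'‖ ^ 3` between the two lifts cancels in affine coordinates.
  have hcE : (fun s => !₂[A (evoluteLift γ s) 0 / A (evoluteLift γ s) 2,
      A (evoluteLift γ s) 1 / A (evoluteLift γ s) 2]) =ᶠ[𝓝 t] c := by
    filter_upwards [hnear] with s hs
    have hv : ‖deriv γ s‖ ^ 3 ≠ 0 := pow_ne_zero _ (norm_ne_zero_iff.2 hs.2)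
    simp only [evoluteLift_eq_smul hs.2, map_smul, Pi.smul_apply, smul_eq_mul, c,
      mul_div_mul_left _ _ hv]
  have hcsm : ContDiffAt ℝ ∞ c t := by
    rw [contDiffAt_euclidean]
    intro j
    fin_cases j
    · exact ((hAanj 0).div (hAanj 2) hA).contDiffAt
    · exact ((hAanj 1).div (hAanj 2) hA).contDiffAt
  have hcd : ∀ᶠ s in 𝓝 t, deriv c s = deriv (signedCurvature γ) s • B s := by
    filter_upwards [hnear, hA2] with s hs hs2
    have h1 := hasDerivAt_evoluteUnitLift hs.1 hs.2
    have h2 : HasDerivAt (fun s => A (evoluteUnitLift γ s))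
        (deriv (signedCurvature γ) s • A (q s)) s := by
      have := A'.hasFDerivAt.comp_hasDerivAt s h1
      simpa only [Function.comp_def, hA', map_smul] using this
    have h3 := hasDerivAt_pi.1 h2
    have h4 (j : Fin 3) : HasDerivAt (fun s => A (evoluteUnitLift γ s) j
        / A (evoluteUnitLift γ s) 2) (deriv (signedCurvature γ) s * b j s) s := by
      have := (h3 j).div (h3 2) hs2
      convert! this using 1
      simp only [b, Pi.smul_apply, smul_eq_mul]
      ring
    apply HasDerivAt.deriv
    have h5 : HasDerivAt (fun s => ![A (evoluteUnitLift γ s) 0 / A (evoluteUnitLift γ s) 2,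
        A (evoluteUnitLift γ s) 1 / A (evoluteUnitLift γ s) 2])
        ![deriv (signedCurvature γ) s * b 0 s, deriv (signedCurvature γ) s * b 1 s] s := by
      rw [hasDerivAt_pi]
      intro j
      fin_cases j
      · exact h4 0
      · exact h4 1
    have h6 := (PiLp.continuousLinearEquiv 2 ℝ
      (fun _ : Fin 2 => ℝ)).symm.hasFDerivAt.comp_hasDerivAt s h5
    convert! h6 using 1
    ext j
    fin_cases j <;> simp [B]
  refine ⟨A, ?_, ?_⟩
  · rw [evoluteLift_eq_smul h0, map_smul]
    exact mul_ne_zero (pow_ne_zero _ (norm_ne_zero_iff.2 h0)) hA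
  have hcusp : HasCuspAt c t := by
    have hne := eventually_deriv_ne_zero hk hc
    rcases hex with (hmin : IsLocalMin _ _) | (hmax : IsLocalMax _ _)
    · exact hasCuspAt_of_deriv_eq_smul hcsm hBc hB0 hcd hmin.deriv_eq_zero
        (eventually_deriv_neg_left hk hne hmin) (eventually_deriv_pos_right hk hne hmin)
    · have hdn (s : ℝ) : deriv (-signedCurvature γ) s = - deriv (signedCurvature γ) s :=
        deriv.neg
      have hne' : ∀ᶠ s in 𝓝[≠] t, deriv (-signedCurvature γ) s ≠ 0 := by
        simpa [hdn] using hne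
      have hmin : IsLocalMin (-signedCurvature γ) t := hmax.neg
      refine hasCuspAt_of_deriv_eq_smul (B := fun s => - B s)
        (f := deriv (-signedCurvature γ)) hcsm hBc.neg (neg_ne_zero.2 hB0) ?_
        hmin.deriv_eq_zero (eventually_deriv_neg_left hk.neg hne' hmin)
        (eventually_deriv_pos_right hk.neg hne' hmin)
      filter_upwards [hcd] with s hs
      rw [hs, hdn, smul_neg, neg_smul, neg_neg]
  obtain ⟨g1, g2, u, hu, g3, g4⟩ := hcusp
  have hder := hcE.deriv
  refine ⟨g1.congr_of_eventuallyEq hcE, ?_, u, hu, ?_, ?_⟩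
  · rw [hder.self_of_nhds, g2]
  · refine g3.congr' ?_
    filter_upwards [nhdsWithin_le_nhds hder] with s hs
    rw [hs]
  · refine g4.congr' ?_
    filter_upwards [nhdsWithin_le_nhds hder] with s hs
    rw [hs]

end Evolute

end

/-! ### Affine frames of the plane -/

/-- The coordinate along `b` of the point `q` in the frame `(P; b, a)`. -/
def coordB (P a b q : Plane) : ℝ := det₂ (q - P) a / det₂ b a

/-- The coordinate along `a` of the point `q` in the frame `(P; b, a)`. -/
def coordA (P a b q : Plane) : ℝ := det₂ b (q - P) / det₂ b a

theorem continuous_coordB (P a b : Plane) : Continuous (coordB P a b) := by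
  unfold coordB det₂; fun_prop

theorem continuous_coordA (P a b : Plane) : Continuous (coordA P a b) := by
  unfold coordA det₂; fun_prop

theorem frame_expand {P a b : Plane} (h : det₂ b a ≠ 0) (q : Plane) :
    P + coordB P a b q • b + coordA P a b q • a = q := by
  obtain ⟨D, hD⟩ : ∃ D, D = det₂ b a := ⟨_, rfl⟩
  rw [← hD] at h
  have hD' : D = b 0 * a 1 - b 1 * a 0 := hD
  ext i
  fin_cases i <;> simp [coordA, coordB, ← hD] <;> field_simp <;> rw [hD'] <;> simp [det₂] <;> ring

theorem coordB_frame {P a b : Plane} (h : det₂ b a ≠ 0) (w s : ℝ) :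
    coordB P a b (P + w • b + s • a) = w := by
  rw [coordB, div_eq_iff h]
  simp [det₂]; ring

theorem coordA_frame {P a b : Plane} (h : det₂ b a ≠ 0) (w s : ℝ) :
    coordA P a b (P + w • b + s • a) = s := by
  rw [coordA, div_eq_iff h]
  simp [det₂]; ring

/-! ### Extrema of the curvature along the curve -/

/-- The curve is a graph over its tangent, in the frame formed by the gradient `a` and the rotated
gradient `b`; this choice of `b` makes the signed curvature equal to `curv F` without a sign. The
equality of filters says that `γ` covers exactly the neighbourhoods of `p` in the curve, which
transfers extrema along the curve to extrema in the parameter and back. -/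
theorem exists_param {F : MvPolynomial (Fin 2) ℝ} {p : Plane} (h : ev F p = 0)
    (hg : 0 < gradSq F p) : ∃ γ : ℝ → Plane, AnalyticAt ℝ γ 0 ∧ γ 0 = p ∧ deriv γ 0 ≠ 0 ∧
      (∀ᶠ t in 𝓝 0, ev F (γ t) = 0) ∧ map γ (𝓝 0) = 𝓝[realCurve F] p ∧
      ∀ᶠ t in 𝓝 0, signedCurvature γ t = curv F (γ t) := by
  obtain ⟨a, ha⟩ : ∃ a : Plane, a = !₂[ev (pderiv 0 F) p, ev (pderiv 1 F) p] := ⟨_, rfl⟩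
  obtain ⟨b, hb⟩ : ∃ b : Plane, b = !₂[-ev (pderiv 1 F) p, ev (pderiv 0 F) p] := ⟨_, rfl⟩
  have hdet : det₂ b a ≠ 0 := by
    rw [gradSq] at hg
    simp only [det₂, ha, hb]
    simp
    nlinarith
  have hd : ev (dirD a F) (p + (0 : ℝ) • b + (0 : ℝ) • a) ≠ 0 := by
    rw [gradSq] at hg
    rw [zero_smul, zero_smul, add_zero, add_zero, ev_dirD, ha]
    simp
    nlinarith
  obtain ⟨σ, hσ, hσ0, hz, hu⟩ := exists_local_graph (p := p) (b := b) (by simpa using h) hd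
  have hσa := hσ.analyticAt
  have hγ : AnalyticAt ℝ (fun t => p + t • b + σ t • a) 0 :=
    (analyticAt_const.add (analyticAt_id.smul analyticAt_const)).add (hσa.smul analyticAt_const)
  have hder : HasDerivAt (fun t => p + t • b + σ t • a) (b + deriv σ 0 • a) 0 := by
    have := (((hasDerivAt_id (0 : ℝ)).smul_const b).const_add p).add
      (hσa.differentiableAt.hasDerivAt.smul_const a)
    rw [one_smul] at this
    exact this
  have hγ0 : p + (0 : ℝ) • b + σ 0 • a = p := by simp [hσ0]
  have hreg : deriv (fun t => p + t • b + σ t • a) 0 ≠ 0 := by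
    rw [hder.deriv]
    intro h0
    apply hdet
    have e0 := congrArg (fun v : Plane => v 0) h0
    have e1 := congrArg (fun v : Plane => v 1) h0
    simp at e0 e1
    rw [det₂]
    linear_combination e0 * a 1 - e1 * a 0
  refine ⟨fun t => p + t • b + σ t • a, hγ, hγ0, hreg, hz, ?_, ?_⟩
  · apply le_antisymm
    · refine tendsto_nhdsWithin_iff.2 ⟨?_, hz⟩
      have := hγ.continuousAt.tendsto
      rwa [hγ0] at this
    · intro S hS
      -- The frame coordinate along `b` recovers the parameter, so nearby points of the curve are
      -- values of `γ` at small parameters.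
      have hc : Tendsto (fun q => (coordB p a b q, coordA p a b q)) (𝓝 p) (𝓝 (0, 0)) := by
        have hB := (continuous_coordB p a b).tendsto p
        have hA := (continuous_coordA p a b).tendsto p
        have e1 : coordB p a b p = 0 := by simp [coordB, det₂]
        have e2 : coordA p a b p = 0 := by simp [coordA, det₂]
        rw [e1] at hB; rw [e2] at hA
        exact hB.prodMk_nhds hA
      have h1 := hc.eventually hu
      have h2 : ∀ᶠ q in 𝓝 p, coordB p a b q ∈ (fun t => p + t • b + σ t • a) ⁻¹' S :=
        (hc.fst_nhds).eventually hS
      rw [mem_nhdsWithin_iff_eventually]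
      filter_upwards [h1, h2] with q hq1 hq2 hq
      have h3 := hq1 (by simp only [frame_expand hdet]; exact hq)
      rw [Set.mem_preimage, ← h3, frame_expand hdet] at hq2
      exact hq2
  · have hpos : ∀ᶠ t in 𝓝 (0 : ℝ), 0 < ev (pderiv 0 F) (p + t • b + σ t • a)
          * deriv (fun t => p + t • b + σ t • a) t 1
        - ev (pderiv 1 F) (p + t • b + σ t • a) * deriv (fun t => p + t • b + σ t • a) t 0 := by
      have hc : ContinuousAt (fun t => ev (pderiv 0 F) (p + t • b + σ t • a)
          * deriv (fun t => p + t • b + σ t • a) t 1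
        - ev (pderiv 1 F) (p + t • b + σ t • a)
          * deriv (fun t => p + t • b + σ t • a) t 0) 0 := by
        have c1 (G) : ContinuousAt (fun t => ev G (p + t • b + σ t • a)) 0 :=
          (continuous_ev G).continuousAt.comp hγ.continuousAt
        exact ((c1 _).mul (analyticAt_coord hγ.deriv 1).continuousAt).sub
          ((c1 _).mul (analyticAt_coord hγ.deriv 0).continuousAt)
      refine hc.eventually_const_lt ?_
      beta_reduce
      rw [hder.deriv, hγ0, ha, hb]
      rw [gradSq] at hg
      simp
      nlinarith
    filter_upwards [hpos, hz.eventually_nhds, hγ.eventually_analyticAt] with t h1 h2 h3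
    exact signedCurvature_eq_curv h3 h2 h1

/-- The points of the curve `F = 0` at which the curvature has a local extremum along the curve
and is not locally constant. -/
def curvExtrema (F : MvPolynomial (Fin 2) ℝ) : Set Plane :=
  {p | ev F p = 0 ∧ 0 < gradSq F p ∧ IsLocalExtrOn (curv F) (realCurve F) p ∧
    ¬ ∀ᶠ q in 𝓝[realCurve F] p, curv F q = curv F p}

theorem curvExtrema_subset (F : MvPolynomial (Fin 2) ℝ) :
    curvExtrema F ⊆ evoluteCusps (realCurve F) ∩ vertices (realCurve F) := by
  rintro p ⟨h, hg, hex, hc⟩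
  obtain ⟨γ, hγ, hγ0, hreg, hz, hmap, hk⟩ := exists_param h hg
  have hpar : IsLocalParam (realCurve F) p γ := ⟨hγ0, hγ.contDiffAt, hreg, hz⟩
  have hk0 := hk.self_of_nhds
  rw [hγ0] at hk0
  have hex' : IsLocalExtr (signedCurvature γ) 0 := by
    rcases hex with (h1 : IsLocalMinOn _ _ _) | (h1 : IsLocalMaxOn _ _ _)
    · left
      have : ∀ᶠ q in map γ (𝓝 0), curv F p ≤ curv F q := by rw [hmap]; exact h1
      filter_upwards [eventually_map.1 this, hk] with t h2 h3
      rw [hk0, h3]; exact h2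
    · right
      have : ∀ᶠ q in map γ (𝓝 0), curv F q ≤ curv F p := by rw [hmap]; exact h1
      filter_upwards [eventually_map.1 this, hk] with t h2 h3
      rw [hk0, h3]; exact h2
  have hc' : ¬ ∀ᶠ t in 𝓝 0, signedCurvature γ t = signedCurvature γ 0 := by
    intro h1
    apply hc
    rw [← hmap, eventually_map]
    filter_upwards [h1, hk] with t h2 h3
    rw [← h3, h2, hk0]
  exact ⟨⟨γ, hpar, hasProjCuspAt_evoluteLift hγ hreg hc' hex'⟩, ⟨γ, hpar, hex'.deriv_eq_zero⟩⟩

/-- If the curvature is locally constant along the curve at one point of a connected part, then it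
is constant on this part. -/
theorem curv_eq_of_isPreconnected {F : MvPolynomial (Fin 2) ℝ} {S : Set Plane}
    (hS : IsPreconnected S) (hF : S ⊆ realCurve F) (hg : ∀ p ∈ S, 0 < gradSq F p) {p q : Plane}
    (hp : p ∈ S) (hq : q ∈ S) (hc : ∀ᶠ x in 𝓝[realCurve F] p, curv F x = curv F p) :
    curv F q = curv F p := by
  let T : Plane → Prop := fun y => ∀ᶠ x in 𝓝[realCurve F] y, curv F x = curv F y
  -- The set of points of local constancy is open and closed along the curve: near a point outside
  -- it, the derivative of the curvature is nonzero at all other nearby parameters.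
  have key : ∀ y ∈ S, ∀ᶠ x in 𝓝[realCurve F] y, (T y ↔ T x) := by
    intro y hy
    obtain ⟨γ, hγ, hγ0, hreg, hz, hmap, hk⟩ := exists_param (hF hy) (hg y hy)
    have hkan := analyticAt_signedCurvature hγ hreg
    have hTγ : ∀ᶠ t in 𝓝 0, T (γ t) → ∀ᶠ s in 𝓝 t, signedCurvature γ s = signedCurvature γ t := by
      filter_upwards [hk.eventually_nhds, hz.eventually_nhds, hγ.eventually_analyticAt]
        with t h1 h2 h3 h4
      have h5 : Tendsto γ (𝓝 t) (𝓝[realCurve F] (γ t)) :=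
        tendsto_nhdsWithin_iff.2 ⟨h3.continuousAt, h2⟩
      filter_upwards [h5.eventually h4, h1] with s h6 h7
      rw [h7, h6, h1.self_of_nhds]
    by_cases hT : T y
    · have h1 := eventually_eventually_nhdsWithin.2 hT
      filter_upwards [h1, hT] with x hx hx2
      refine ⟨fun _ => ?_, fun _ => hT⟩
      filter_upwards [hx] with z hz
      rw [hz, hx2]
    · have hT' : ¬ ∀ᶠ t in 𝓝 0, signedCurvature γ t = signedCurvature γ 0 := by
        intro h1
        apply hT
        simp only [T]
        rw [← hmap, eventually_map]
        filter_upwards [h1, hk] with t h2 h3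
        rw [← h3, h2, hk.self_of_nhds, hγ0]
      have hne := eventually_nhdsWithin_iff.1 (eventually_deriv_ne_zero hkan hT')
      rw [← hmap, eventually_map]
      filter_upwards [hTγ, hne] with t h1 h2
      refine ⟨fun h => absurd h hT, fun h => ?_⟩
      by_cases ht : t = 0
      · rw [ht, hγ0] at h; exact h
      · exfalso
        apply h2 ht
        have h3 : signedCurvature γ =ᶠ[𝓝 t] fun _ => signedCurvature γ t := h1 h
        rw [h3.deriv_eq, deriv_const]
  have hTall : ∀ y ∈ S, T y := by
    intro y hy
    have := hS.induction₂ (fun x y => T x ↔ T y)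
      (fun x hx => nhdsWithin_mono x hF (key x hx))
      (fun x y z _ _ _ h1 h2 => h1.trans h2) (fun x y _ _ h => h.symm) hp hy
    exact this.1 hc
  exact (hS.induction₂ (fun x y => curv F x = curv F y)
    (fun x hx => nhdsWithin_mono x hF ((hTall x hx).mono fun _ h => h.symm))
    (fun x y z _ _ _ h1 h2 => h1.trans h2) (fun x y _ _ h => h.symm) hp hq).symm

section



/-! ### Convergence of polynomials of bounded degree -/

/-- Convergence of a family of polynomials within a finite-dimensional space. -/
def PolyTendsto {ι : Type*} (l : Filter ι) (F : ι → MvPolynomial (Fin 2) ℝ)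
    (G : MvPolynomial (Fin 2) ℝ) : Prop :=
  ∃ (s : Finset (Fin 2 →₀ ℕ)) (B : (Fin 2 →₀ ℕ) → MvPolynomial (Fin 2) ℝ)
    (c : ι → (Fin 2 →₀ ℕ) → ℝ) (c₀ : (Fin 2 →₀ ℕ) → ℝ),
    (∀ m, Tendsto (fun i => c i m) l (𝓝 (c₀ m))) ∧
    (∀ᶠ i in l, F i = ∑ m ∈ s, C (c i m) * B m) ∧ G = ∑ m ∈ s, C (c₀ m) * B m

section PolyTendsto

variable {ι : Type*} {l : Filter ι} {F : ι → MvPolynomial (Fin 2) ℝ} {G : MvPolynomial (Fin 2) ℝ}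

/-- A degree bound confines the family to the span of finitely many monomials. -/
theorem PolyTendsto.of_coeff {d : ℕ} (hd : ∀ᶠ i in l, (F i).totalDegree ≤ d)
    (hc : ∀ m, Tendsto (fun i => (F i).coeff m) l (𝓝 (G.coeff m))) : PolyTendsto l F G := by
  have hfin : {m : Fin 2 →₀ ℕ | m.degree ≤ max d G.totalDegree}.Finite :=
    Finsupp.finite_of_degree_le _
  have hsum (P : MvPolynomial (Fin 2) ℝ) (hP : P.totalDegree ≤ max d G.totalDegree) :
      P = ∑ m ∈ hfin.toFinset, C (P.coeff m) * MvPolynomial.monomial m 1 := by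
    conv_lhs => rw [MvPolynomial.as_sum P]
    simp only [MvPolynomial.C_mul_monomial, mul_one]
    apply Finset.sum_subset
    · intro m hm
      rw [Set.Finite.mem_toFinset, Set.mem_ofPred_eq]
      exact (MvPolynomial.le_totalDegree hm).trans hP
    · intro m _ hm
      rw [MvPolynomial.notMem_support_iff.1 hm, map_zero]
  refine ⟨hfin.toFinset, fun m => MvPolynomial.monomial m 1, fun i m => (F i).coeff m,
    fun m => G.coeff m, hc, ?_, hsum G (le_max_right _ _)⟩
  filter_upwards [hd] with i hi using hsum _ (hi.trans (le_max_left _ _))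

theorem PolyTendsto.neg (h : PolyTendsto l F G) : PolyTendsto l (fun i => - F i) (-G) := by
  obtain ⟨s, B, c, c₀, h1, h2, h3⟩ := h
  refine ⟨s, fun m => - B m, c, c₀, h1, ?_, ?_⟩
  · filter_upwards [h2] with i hi
    simp [hi]
  · simp [h3]

/-- A linear operator acts on the spanning polynomials and leaves the coefficients alone. This is
why `PolyTendsto` admits arbitrary spanning polynomials and not only monomials. -/
theorem PolyTendsto.linearMap (h : PolyTendsto l F G)
    (D : MvPolynomial (Fin 2) ℝ →ₗ[ℝ] MvPolynomial (Fin 2) ℝ) :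
    PolyTendsto l (fun i => D (F i)) (D G) := by
  obtain ⟨s, B, c, c₀, h1, h2, h3⟩ := h
  refine ⟨s, fun m => D (B m), c, c₀, h1, ?_, ?_⟩
  · filter_upwards [h2] with i hi
    rw [hi, map_sum]
    refine Finset.sum_congr rfl fun m _ => ?_
    rw [← MvPolynomial.smul_eq_C_mul, map_smul, MvPolynomial.smul_eq_C_mul]
  · rw [h3, map_sum]
    refine Finset.sum_congr rfl fun m _ => ?_
    rw [← MvPolynomial.smul_eq_C_mul, map_smul, MvPolynomial.smul_eq_C_mul]

theorem PolyTendsto.pderiv (h : PolyTendsto l F G) (j : Fin 2) :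
    PolyTendsto l (fun i => pderiv j (F i)) (pderiv j G) :=
  h.linearMap (MvPolynomial.pderiv j).toLinearMap

theorem PolyTendsto.dirD (h : PolyTendsto l F G) (v : Plane) :
    PolyTendsto l (fun i => dirD v (F i)) (dirD v G) := by
  have := h.linearMap (v 0 • (MvPolynomial.pderiv 0).toLinearMap
    + v 1 • (MvPolynomial.pderiv 1).toLinearMap)
  simpa [PlaneCurve.dirD, MvPolynomial.smul_eq_C_mul] using this

/-- Convergence is joint in the index and the point, which is the form needed for uniformity on
compact sets. -/
theorem PolyTendsto.tendsto_ev (h : PolyTendsto l F G) (p : Plane) :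
    Tendsto (fun z : ι × Plane => ev (F z.1) z.2) (l ×ˢ 𝓝 p) (𝓝 (ev G p)) := by
  obtain ⟨s, B, c, c₀, h1, h2, h3⟩ := h
  have e (P : (Fin 2 →₀ ℕ) → ℝ) (q : Plane) :
      ev (∑ m ∈ s, C (P m) * B m) q = ∑ m ∈ s, P m * ev (B m) q := by
    simp only [ev, map_sum, map_mul, MvPolynomial.eval_C]
  have h4 : Tendsto (fun z : ι × Plane => ∑ m ∈ s, c z.1 m * ev (B m) z.2) (l ×ˢ 𝓝 p)
      (𝓝 (∑ m ∈ s, c₀ m * ev (B m) p)) := by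
    refine tendsto_finsetSum _ fun m _ => ?_
    exact ((h1 m).comp tendsto_fst).mul (((continuous_ev (B m)).tendsto p).comp tendsto_snd)
  rw [h3, e]
  refine h4.congr' ?_
  filter_upwards [h2.prod_inl (𝓝 p)] with z hz
  rw [hz, e]

theorem PolyTendsto.tendsto_gradSq (h : PolyTendsto l F G) (p : Plane) :
    Tendsto (fun z : ι × Plane => gradSq (F z.1) z.2) (l ×ˢ 𝓝 p) (𝓝 (gradSq G p)) :=
  (((h.pderiv 0).tendsto_ev p).pow 2).add (((h.pderiv 1).tendsto_ev p).pow 2)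

theorem PolyTendsto.tendsto_curv (h : PolyTendsto l F G) {p : Plane} (hg : 0 < gradSq G p) :
    Tendsto (fun z : ι × Plane => curv (F z.1) z.2) (l ×ˢ 𝓝 p) (𝓝 (curv G p)) := by
  have e0 := (h.pderiv 0).tendsto_ev p
  have e1 := (h.pderiv 1).tendsto_ev p
  have e00 := ((h.pderiv 0).pderiv 0).tendsto_ev p
  have e01 := ((h.pderiv 1).pderiv 0).tendsto_ev p
  have e11 := ((h.pderiv 1).pderiv 1).tendsto_ev p
  refine Tendsto.div ?_ ((h.tendsto_gradSq p).sqrt.pow 3) (by positivity)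
  exact ((e00.mul (e1.pow 2)).sub (((e01.const_mul 2).mul e0).mul e1)).add
    (e11.mul (e0.pow 2))

/-- The tube lemma, with the filter `l` in place of the second space. -/
theorem eventually_forall_compact {K : Set Plane} (hK : IsCompact K) {P : ι → Plane → Prop}
    (h : ∀ p ∈ K, ∀ᶠ z : ι × Plane in l ×ˢ 𝓝 p, P z.1 z.2) : ∀ᶠ i in l, ∀ p ∈ K, P i p := by
  have := hK.mem_prod_nhdsSet_of_forall (l := l) (s := {z | P z.1 z.2}) h
  exact (Filter.Eventually.curry this).mono fun _ h => h.self_of_nhdsSet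

theorem PolyTendsto.eventually_pos (h : PolyTendsto l F G) {K : Set Plane} (hK : IsCompact K)
    (hpos : ∀ p ∈ K, 0 < ev G p) : ∀ᶠ i in l, ∀ p ∈ K, 0 < ev (F i) p :=
  eventually_forall_compact hK fun p hp => (h.tendsto_ev p).eventually_const_lt (hpos p hp)

theorem PolyTendsto.eventually_neg (h : PolyTendsto l F G) {K : Set Plane} (hK : IsCompact K)
    (hneg : ∀ p ∈ K, ev G p < 0) : ∀ᶠ i in l, ∀ p ∈ K, ev (F i) p < 0 :=
  eventually_forall_compact hK fun p hp => (h.tendsto_ev p).eventually_lt_const (hneg p hp)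

/-- On a compact set on which the limit curve is straight and nonsingular, the curvature of the
members of the family tends to `0`. -/
theorem PolyTendsto.eventually_curv_lt (h : PolyTendsto l F G) {K : Set Plane} (hK : IsCompact K)
    (h0 : ∀ p ∈ K, ev G p = 0 → 0 < gradSq G p ∧ curv G p = 0) {δ : ℝ} (hδ : 0 < δ) :
    ∀ᶠ i in l, ∀ p ∈ K, ev (F i) p = 0 → 0 < gradSq (F i) p ∧ |curv (F i) p| < δ := by
  refine eventually_forall_compact hK fun p hp => ?_
  by_cases hz : ev G p = 0
  · obtain ⟨h1, h2⟩ := h0 p hp hz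
    have h3 := (h.tendsto_curv h1).abs
    rw [h2, abs_zero] at h3
    filter_upwards [(h.tendsto_gradSq p).eventually_const_lt h1, h3.eventually_lt_const hδ]
      with z h4 h5 _ using ⟨h4, h5⟩
  · filter_upwards [(h.tendsto_ev p).eventually_ne hz] with z h4 h5
    exact absurd h5 h4

end PolyTendsto

/-- A product of a linear polynomial and another factor has a straight nonsingular zero locus where
only the linear polynomial vanishes. -/
theorem gradSq_pos_and_curv_eq_zero {U H : MvPolynomial (Fin 2) ℝ} {a b : ℝ} {p : Plane}
    (h0 : pderiv 0 U = C a) (h1 : pderiv 1 U = C b) (hab : a ≠ 0 ∨ b ≠ 0) (hU : ev U p = 0)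
    (hH : ev H p ≠ 0) : 0 < gradSq (U * H) p ∧ curv (U * H) p = 0 := by
  -- On `U = 0` the gradient of `U * H` is `H (a, b)`, and its second derivative along the line `U =
  -- 0` vanishes.
  constructor
  · simp only [gradSq, Derivation.leibniz, smul_eq_mul, ev_add, ev_mul, h0, h1, hU, ev_C]
    have e : 0 < (a ^ 2 + b ^ 2) * ev H p ^ 2 := by
      apply mul_pos _ (by positivity)
      rcases hab with h | h
      · have := pow_pos (abs_pos.2 h) 2; rw [sq_abs] at this; nlinarith [sq_nonneg b]
      · have := pow_pos (abs_pos.2 h) 2; rw [sq_abs] at this; nlinarith [sq_nonneg a]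
    linarith
  · rw [curv, curvNum]
    simp only [Derivation.leibniz, smul_eq_mul, map_add, ev_add, ev_mul, h0, h1, hU, ev_C,
      MvPolynomial.pderiv_C, ev_zero]
    rw [div_eq_zero_iff]
    left
    ring

end

section



/-! ### Zeros of convex functions of one variable -/

section ConvexZero

variable {φ φ' φ'' : ℝ → ℝ} {m M : ℝ}

theorem strictMonoOn_of_hasDerivAt_pos (h : ∀ x, HasDerivAt φ (φ' x) x) {s : Set ℝ}
    (hs : Convex ℝ s) (hpos : ∀ x ∈ s, 0 < φ' x) : StrictMonoOn φ s := by
  apply strictMonoOn_of_deriv_pos hs (fun x _ => (h x).continuousAt.continuousWithinAt)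
  intro x hx
  rw [(h x).deriv]
  exact hpos x (interior_subset hx)

/-- Convexity keeps the derivative positive to the right of `s`. -/
theorem pos_of_gt_zero_of_convex (h : ∀ x, HasDerivAt φ (φ' x) x)
    (h' : ∀ x, HasDerivAt φ' (φ'' x) x) (hc : ∀ x ∈ Set.Icc m M, 0 < φ'' x) {s t : ℝ}
    (hs : s ∈ Set.Icc m M) (ht : t ∈ Set.Icc m M) (hst : s < t) (h0 : 0 ≤ φ s) (h1 : 0 < φ' s) :
    0 < φ t := by
  have hm := strictMonoOn_of_hasDerivAt_pos h' (convex_Icc m M) hc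
  have hm2 : StrictMonoOn φ (Set.Icc s M) := by
    apply strictMonoOn_of_hasDerivAt_pos h (convex_Icc s M)
    intro x hx
    rcases hx.1.eq_or_lt with rfl | h3
    · exact h1
    · exact h1.trans (hm hs ⟨hs.1.trans hx.1, hx.2⟩ h3)
  exact h0.trans_lt (hm2 ⟨le_rfl, hs.2⟩ ⟨hst.le, ht.2⟩ hst)

/-- The mean slope between `t` and `s` is positive, and the derivative at the right end is larger.
-/
theorem deriv_pos_of_convex (h : ∀ x, HasDerivAt φ (φ' x) x)
    (h' : ∀ x, HasDerivAt φ' (φ'' x) x) (hc : ∀ x ∈ Set.Icc m M, 0 < φ'' x) {s t : ℝ}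
    (hs : s ∈ Set.Icc m M) (ht : t ∈ Set.Icc m M) (hst : t < s) (hlt : φ t < φ s) :
    0 < φ' s := by
  have hm := strictMonoOn_of_hasDerivAt_pos h' (convex_Icc m M) hc
  obtain ⟨x, hx, hxe⟩ := exists_hasDerivAt_eq_slope φ φ' hst
    (fun x _ => (h x).continuousAt.continuousWithinAt) (fun x _ => h x)
  have : 0 < φ' x := by rw [hxe]; apply div_pos <;> linarith
  exact this.trans (hm ⟨ht.1.trans hx.1.le, hx.2.le.trans hs.2⟩ hs hx.2)

/-- The larger zero of a convex function of one variable. -/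
theorem exists_upper_zero (h : ∀ x, HasDerivAt φ (φ' x) x)
    (h' : ∀ x, HasDerivAt φ' (φ'' x) x) (hc : ∀ x ∈ Set.Icc m M, 0 < φ'' x) {t u : ℝ}
    (ht : t ∈ Set.Icc m M) (hu : u ∈ Set.Icc m M) (hlt : φ t < 0) (hpos : 0 < φ u) (htu : t < u) :
    ∃ s ∈ Set.Ioo t u, φ s = 0 ∧ 0 < φ' s ∧
      ∀ s' ∈ Set.Icc m M, φ s' = 0 → 0 < φ' s' → s' = s := by
  have hcont : ContinuousOn φ (Set.Icc t u) := fun x _ => (h x).continuousAt.continuousWithinAt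
  obtain ⟨s, hs, hs0⟩ := intermediate_value_Icc htu.le hcont ⟨hlt.le, hpos.le⟩
  have h1 : t ≠ s := by rintro rfl; linarith
  have h2 : s ≠ u := by rintro rfl; linarith
  have hs' : s ∈ Set.Ioo t u := ⟨lt_of_le_of_ne hs.1 h1, lt_of_le_of_ne hs.2 h2⟩
  have hsI : s ∈ Set.Icc m M := ⟨ht.1.trans hs.1, hs.2.trans hu.2⟩
  have hd : 0 < φ' s := deriv_pos_of_convex h h' hc hsI ht hs'.1 (by rw [hs0]; exact hlt)
  refine ⟨s, hs', hs0, hd, fun s' hs'I hs'0 hs'd => ?_⟩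
  -- Beyond a zero with positive derivative the function is positive, so there cannot be two such
  -- zeros.
  rcases lt_trichotomy s' s with h3 | h3 | h3
  · have := pos_of_gt_zero_of_convex h h' hc hs'I hsI h3 hs'0.ge hs'd
    linarith
  · exact h3
  · have := pos_of_gt_zero_of_convex h h' hc hsI hs'I h3 hs0.ge hd
    linarith

end ConvexZero

/-! ### Arcs which are graphs -/

/-- Over `w ∈ I`, the part of the curve `F = 0` in the strip `m ≤ s ≤ M` of the frame `(P; b, a)`
on which `F` increases in the direction `a` is the graph of `s`. -/
structure GraphOn (F : MvPolynomial (Fin 2) ℝ) (P a b : Plane) (m M : ℝ) (I : Set ℝ)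
    (s : ℝ → ℝ) : Prop where
  det : det₂ b a ≠ 0
  mem : ∀ w ∈ I, s w ∈ Set.Ioo m M
  zero : ∀ w ∈ I, ev F (P + w • b + s w • a) = 0
  pos : ∀ w ∈ I, 0 < ev (dirD a F) (P + w • b + s w • a)
  uniq : ∀ w ∈ I, ∀ x ∈ Set.Icc m M, ev F (P + w • b + x • a) = 0 →
    0 < ev (dirD a F) (P + w • b + x • a) → x = s w

namespace GraphOn

variable {F : MvPolynomial (Fin 2) ℝ} {P a b : Plane} {m M : ℝ} {I : Set ℝ} {s : ℝ → ℝ}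

/-- The implicit function through a point of the graph stays in the strip and keeps the derivative
along `a` positive, so `uniq` identifies it with `s`. Regularity of `s` is thus a consequence and
not part of the structure. -/
theorem exists_local (h : GraphOn F P a b m M I s) {w : ℝ} (hw : w ∈ I) :
    ∃ σ : ℝ → ℝ, AnalyticAt ℝ σ w ∧ σ w = s w ∧ ∀ᶠ x in 𝓝[I] w, s x = σ x := by
  obtain ⟨σ, hσ, hσ0, hz, -⟩ := exists_local_graph (h.zero w hw) (h.pos w hw).ne'
  have hσa := hσ.analyticAt
  refine ⟨σ, hσa, hσ0, ?_⟩
  have hm : ∀ᶠ x in 𝓝 w, σ x ∈ Set.Ioo m M :=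
    hσa.continuousAt.eventually_mem (Ioo_mem_nhds (hσ0 ▸ (h.mem w hw).1) (hσ0 ▸ (h.mem w hw).2))
  have hp : ∀ᶠ x in 𝓝 w, 0 < ev (dirD a F) (P + x • b + σ x • a) := by
    have hc : ContinuousAt (fun x => ev (dirD a F) (P + x • b + σ x • a)) w := by
      refine ContinuousAt.comp (g := ev (dirD a F)) (continuous_ev _).continuousAt ?_
      exact (continuousAt_const.add (continuousAt_id.smul continuousAt_const)).add
        (hσa.continuousAt.smul continuousAt_const)
    exact hc.eventually_const_lt (by simpa only [hσ0] using h.pos w hw)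
  filter_upwards [nhdsWithin_le_nhds hm, nhdsWithin_le_nhds hp, nhdsWithin_le_nhds hz,
    self_mem_nhdsWithin] with x h1 h2 h3 h4
  exact (h.uniq x h4 _ ⟨h1.1.le, h1.2.le⟩ h3 h2).symm

theorem continuousOn (h : GraphOn F P a b m M I s) : ContinuousOn s I := by
  intro w hw
  obtain ⟨σ, h1, h2, h3⟩ := h.exists_local hw
  exact h1.continuousAt.continuousWithinAt.congr_of_eventuallyEq h3 h2.symm

theorem analyticAt (h : GraphOn F P a b m M I s) {w : ℝ} (hw : I ∈ 𝓝 w) : AnalyticAt ℝ s w := by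
  obtain ⟨σ, h1, h2, h3⟩ := h.exists_local (mem_of_mem_nhds hw)
  rw [nhdsWithin_eq_nhds.2 hw] at h3
  exact h1.congr (h3.mono fun _ hx => hx.symm)

/-- The parametrization of the arc. -/
def param (P a b : Plane) (s : ℝ → ℝ) (w : ℝ) : Plane := P + w • b + s w • a

theorem continuousOn_param (h : GraphOn F P a b m M I s) :
    ContinuousOn (param P a b s) I :=
  ((continuousOn_const.add (continuousOn_id.smul continuousOn_const))).add
    (h.continuousOn.smul continuousOn_const)

theorem gradSq_pos_of_dirD {v p : Plane} (h : ev (dirD v F) p ≠ 0) : 0 < gradSq F p := by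
  rw [gradSq]
  by_contra hn
  have h3 : ev (pderiv 0 F) p ^ 2 = 0 := by
    nlinarith [sq_nonneg (ev (pderiv 0 F) p), sq_nonneg (ev (pderiv 1 F) p)]
  have h4 : ev (pderiv 1 F) p ^ 2 = 0 := by
    nlinarith [sq_nonneg (ev (pderiv 0 F) p), sq_nonneg (ev (pderiv 1 F) p)]
  rw [pow_eq_zero_iff two_ne_zero] at h3 h4
  exact h (by rw [ev_dirD, h3, h4]; ring)

theorem gradSq_pos (h : GraphOn F P a b m M I s) {w : ℝ} (hw : w ∈ I) :
    0 < gradSq F (param P a b s w) := gradSq_pos_of_dirD (h.pos w hw).ne'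

theorem coordB_param (h : GraphOn F P a b m M I s) (w : ℝ) :
    coordB P a b (param P a b s w) = w := coordB_frame h.det w (s w)

theorem coordA_param (h : GraphOn F P a b m M I s) (w : ℝ) :
    coordA P a b (param P a b s w) = s w := coordA_frame h.det w (s w)

/-- A point of the curve in the region of the graph lies on it. -/
theorem eq_param (h : GraphOn F P a b m M I s) {q : Plane} (hq : q ∈ realCurve F)
    (hB : coordB P a b q ∈ I) (hA : coordA P a b q ∈ Set.Icc m M)
    (hp : 0 < ev (dirD a F) q) : q = param P a b s (coordB P a b q) := by
  have h1 := frame_expand (P := P) h.det q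
  have h2 := h.uniq _ hB _ hA (by rw [h1]; exact hq) (by rw [h1]; exact hp)
  rw [param, ← h2, h1]

/-- Near a point of the graph over an interior parameter, the curve coincides with the graph. -/
theorem eventually_eq_param (h : GraphOn F P a b m M I s) {w : ℝ} {J : Set ℝ} (hJI : J ⊆ I)
    (hw : J ∈ 𝓝 w) : ∀ᶠ q in 𝓝[realCurve F] (param P a b s w),
      coordB P a b q ∈ J ∧ q = param P a b s (coordB P a b q) := by
  have hwI : w ∈ I := hJI (mem_of_mem_nhds hw)
  have h1 : ∀ᶠ q in 𝓝 (param P a b s w), coordB P a b q ∈ J := by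
    apply (continuous_coordB P a b).continuousAt.eventually_mem
    rwa [h.coordB_param]
  have h2 : ∀ᶠ q in 𝓝 (param P a b s w), coordA P a b q ∈ Set.Ioo m M := by
    apply (continuous_coordA P a b).continuousAt.eventually_mem
    rw [h.coordA_param]
    exact isOpen_Ioo.mem_nhds (h.mem w hwI)
  have h3 : ∀ᶠ q in 𝓝 (param P a b s w), 0 < ev (dirD a F) q :=
    (continuous_ev _).continuousAt.eventually_const_lt (h.pos w hwI)
  filter_upwards [nhdsWithin_le_nhds h1, nhdsWithin_le_nhds h2, nhdsWithin_le_nhds h3,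
    self_mem_nhdsWithin] with q h4 h5 h6 h7
  exact ⟨h4, h.eq_param h7 (hJI h4) ⟨h5.1.le, h5.2.le⟩ h6⟩

theorem hasDerivAt_param {w : ℝ} {s' : ℝ} (hs : HasDerivAt s s' w) :
    HasDerivAt (param P a b s) (b + s' • a) w := by
  have := (((hasDerivAt_id w).smul_const b).const_add P).add (hs.smul_const a)
  rw [one_smul] at this
  exact this

theorem analyticAt_param (h : GraphOn F P a b m M I s) {w : ℝ} (hw : I ∈ 𝓝 w) :
    AnalyticAt ℝ (param P a b s) w :=
  (analyticAt_const.add (analyticAt_id.smul analyticAt_const)).add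
    ((h.analyticAt hw).smul analyticAt_const)

/-- The curvature of a graph. -/
theorem neg_curv_param (h : GraphOn F P a b m M I s) {w : ℝ} (hw : I ∈ 𝓝 w) :
    - curv F (param P a b s w)
      = |det₂ b a| * deriv (deriv s) w / ‖b + deriv s w • a‖ ^ 3 := by
  have hwI := mem_of_mem_nhds hw
  have hγ := h.analyticAt_param hw
  have hsa := h.analyticAt hw
  have hev : ∀ᶠ x in 𝓝 w, AnalyticAt ℝ s x := hsa.eventually_analyticAt
  have hd1 : deriv (param P a b s) =ᶠ[𝓝 w] fun x => b + deriv s x • a := by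
    filter_upwards [hev] with x hx
    exact (hasDerivAt_param hx.differentiableAt.hasDerivAt).deriv
  have hd2 : deriv (deriv (param P a b s)) w = deriv (deriv s) w • a := by
    rw [hd1.deriv_eq]
    exact ((hsa.deriv.differentiableAt.hasDerivAt.smul_const a).const_add b).deriv
  have hz : ∀ᶠ x in 𝓝 w, ev F (param P a b s x) = 0 := by
    filter_upwards [hw] with x hx using h.zero x hx
  have hW : signedCurvature (param P a b s) w
      = det₂ b a * deriv (deriv s) w / ‖b + deriv s w • a‖ ^ 3 := by
    rw [signedCurvature, wronskian₂, hd2, hd1.self_of_nhds]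
    congr 1
    simp [det₂]; ring
  have horth := (ev_dirD_deriv_eq_zero hγ hz).self_of_nhds
  have hpos : 0 < ev (dirD a F) (param P a b s w) := h.pos w hwI
  rw [ev_dirD] at horth hpos
  have hΓ0 : deriv (param P a b s) w 0 = b 0 + deriv s w * a 0 := by
    rw [hd1.self_of_nhds]; simp
  have hΓ1 : deriv (param P a b s) w 1 = b 1 + deriv s w * a 1 := by
    rw [hd1.self_of_nhds]; simp
  obtain ⟨x, hx⟩ : ∃ x, x = deriv (param P a b s) w 0 := ⟨_, rfl⟩
  obtain ⟨y, hy⟩ : ∃ y, y = deriv (param P a b s) w 1 := ⟨_, rfl⟩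
  obtain ⟨g, hg⟩ : ∃ g, g = ev (pderiv 0 F) (param P a b s w) := ⟨_, rfl⟩
  obtain ⟨k, hk⟩ : ∃ k, k = ev (pderiv 1 F) (param P a b s w) := ⟨_, rfl⟩
  have hdet : det₂ b a = x * a 1 - y * a 0 := by
    rw [hx, hy, hΓ0, hΓ1, det₂]; ring
  rw [← hx, ← hy, ← hg, ← hk] at horth
  rw [← hg, ← hk] at hpos
  -- The sign of `g * y - k * x` tells whether the graph is oriented like `curv`. Because `F`
  -- increases along `a`, it is opposite to the sign of `det₂ b a`; in both cases `-curv` has the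
  -- sign of the second derivative of `s`.
  have hkey : (g * y - k * x) * det₂ b a = -((a 0 * g + a 1 * k) * (x ^ 2 + y ^ 2)) := by
    rw [hdet]; linear_combination (y * a 1 + x * a 0) * horth
  have hxy : 0 < x ^ 2 + y ^ 2 := by
    by_contra hn
    have h3 : x ^ 2 = 0 := by nlinarith [sq_nonneg x, sq_nonneg y]
    have h4 : y ^ 2 = 0 := by nlinarith [sq_nonneg x, sq_nonneg y]
    rw [pow_eq_zero_iff two_ne_zero] at h3 h4
    exact h.det (by rw [hdet, h3, h4]; ring)
  have hneg : (g * y - k * x) * det₂ b a < 0 := by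
    rw [hkey]; exact neg_neg_of_pos (mul_pos hpos hxy)
  rcases h.det.lt_or_gt with hd | hd
  · have h5 : 0 < g * y - k * x := by nlinarith
    rw [hg, hk, hx, hy] at h5
    rw [← signedCurvature_eq_curv hγ hz h5, hW, abs_of_neg hd]
    ring
  · have h5 : g * y - k * x < 0 := by nlinarith
    rw [hg, hk, hx, hy] at h5
    rw [← signedCurvature_eq_neg_curv hγ hz h5, hW, abs_of_pos hd]

end GraphOn

end

/-! ### Turning of the tangent line along a graph -/

/-- The component along `a` of the unit tangent vector of a graph of slope `x`, times `‖a‖`. -/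
def tangentComp (a b : Plane) (x : ℝ) : ℝ :=
  (a 0 * (b 0 + x * a 0) + a 1 * (b 1 + x * a 1)) / ‖b + x • a‖

theorem frame_vector_ne_zero {a b : Plane} (h : det₂ b a ≠ 0) (x : ℝ) : b + x • a ≠ 0 := by
  intro h0
  apply h
  have e0 := congrArg (fun v : Plane => v 0) h0
  have e1 := congrArg (fun v : Plane => v 1) h0
  simp at e0 e1
  rw [det₂]
  linear_combination e0 * a 1 - e1 * a 0

/-- The factor is the one in `neg_curv_param`: along a graph, the derivative of `tangentComp a b
(deriv s w)` is `|det₂ b a|` times `-curv`. A mean value argument can then turn rotation of the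
tangent into curvature. -/
theorem hasDerivAt_tangentComp {a b : Plane} (h : det₂ b a ≠ 0) (x : ℝ) :
    HasDerivAt (tangentComp a b) (det₂ b a ^ 2 / ‖b + x • a‖ ^ 3) x := by
  have hv : 0 < ‖b + x • a‖ := norm_pos_iff.2 (frame_vector_ne_zero h x)
  have hsq : ‖b + x • a‖ ^ 2 = (b 0 + x * a 0) ^ 2 + (b 1 + x * a 1) ^ 2 := by
    rw [norm_sq_plane]; simp
  have hlin (i : Fin 2) : HasDerivAt (fun y : ℝ => b i + y * a i) (a i) x := by
    simpa using ((hasDerivAt_id x).mul_const (a i)).const_add (b i)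
  have hn : HasDerivAt (fun y : ℝ => ‖b + y • a‖)
      (((b 0 + x * a 0) * a 0 + (b 1 + x * a 1) * a 1) / ‖b + x • a‖) x := by
    have h1 := (((hlin 0).pow 2).add ((hlin 1).pow 2)).sqrt
      (by simp only [Pi.add_apply, Pi.pow_apply]; rw [← hsq]; positivity)
    have e : (fun y : ℝ => ‖b + y • a‖)
        = fun y => √((b 0 + y * a 0) ^ 2 + (b 1 + y * a 1) ^ 2) := by
      ext y; rw [norm_plane]; simp
    rw [e]
    convert! h1 using 1
    rw [norm_plane]
    simp
    field_simp
  have hnum := ((hlin 0).const_mul (a 0)).add ((hlin 1).const_mul (a 1))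
  have := hnum.div hn hv.ne'
  convert! this using 1
  simp only [Pi.add_apply]
  field_simp
  rw [hsq, det₂]
  ring

theorem strictMono_tangentComp {a b : Plane} (h : det₂ b a ≠ 0) :
    StrictMono (tangentComp a b) := by
  apply strictMono_of_deriv_pos
  intro x
  rw [(hasDerivAt_tangentComp h x).deriv]
  have := frame_vector_ne_zero h x
  positivity

/-- Rising by `r / 2` on both sides of `0` over a length `r`, the graph has somewhere a slope at
most `-1/2` and later a slope at least `1/2`. Its tangent turns by a fixed amount over a parameter
interval shorter than `2 * r`, and the mean value theorem bounds the curvature below. -/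
theorem GraphOn.exists_curv_ge {F : MvPolynomial (Fin 2) ℝ} {P a b : Plane} {m M r : ℝ}
    {s : ℝ → ℝ} (h : GraphOn F P a b m M (Set.Icc (-r) r) s) (hr : 0 < r)
    (h1 : r / 2 ≤ s (-r) - s 0) (h2 : r / 2 ≤ s r - s 0) :
    ∃ w ∈ Set.Ioo (-r) r, (tangentComp a b (1 / 2) - tangentComp a b (-(1 / 2)))
      / (2 * r * |det₂ b a|) ≤ - curv F (GraphOn.param P a b s w) := by
  have hI : ∀ w ∈ Set.Ioo (-r) r, Set.Icc (-r) r ∈ 𝓝 w := fun w hw => Icc_mem_nhds hw.1 hw.2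
  have hder : ∀ w ∈ Set.Ioo (-r) r, HasDerivAt s (deriv s w) w := fun w hw =>
    (h.analyticAt (hI w hw)).differentiableAt.hasDerivAt
  have hdd : ∀ w ∈ Set.Ioo (-r) r, HasDerivAt (deriv s) (deriv (deriv s) w) w := fun w hw =>
    (h.analyticAt (hI w hw)).deriv.differentiableAt.hasDerivAt
  obtain ⟨w₁, hw₁, e₁⟩ := exists_hasDerivAt_eq_slope s (deriv s) (show -r < 0 by linarith)
    (h.continuousOn.mono (Set.Icc_subset_Icc le_rfl hr.le))
    (fun x hx => hder x ⟨hx.1, hx.2.trans hr⟩)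
  obtain ⟨w₂, hw₂, e₂⟩ := exists_hasDerivAt_eq_slope s (deriv s) hr
    (h.continuousOn.mono (Set.Icc_subset_Icc (by linarith) le_rfl))
    (fun x hx => hder x ⟨by linarith [hx.1], hx.2⟩)
  have hs₁ : deriv s w₁ ≤ -(1 / 2) := by
    rw [e₁, div_le_iff₀ (by linarith)]; linarith
  have hs₂ : 1 / 2 ≤ deriv s w₂ := by
    rw [e₂, le_div_iff₀ (by linarith)]; linarith
  have hlt : w₁ < w₂ := hw₁.2.trans hw₂.1
  have hsub : ∀ x ∈ Set.Icc w₁ w₂, x ∈ Set.Ioo (-r) r := fun x hx =>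
    ⟨hw₁.1.trans_le hx.1, hx.2.trans_lt hw₂.2⟩
  have hT : ∀ x ∈ Set.Icc w₁ w₂, HasDerivAt (fun y => tangentComp a b (deriv s y))
      (det₂ b a ^ 2 / ‖b + deriv s x • a‖ ^ 3 * deriv (deriv s) x) x := fun x hx =>
    (hasDerivAt_tangentComp h.det (deriv s x)).comp x (hdd x (hsub x hx))
  obtain ⟨w, hw, e⟩ := exists_hasDerivAt_eq_slope _ _ hlt
    (fun x hx => (hT x hx).continuousAt.continuousWithinAt)
    (fun x hx => hT x ⟨hx.1.le, hx.2.le⟩)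
  have hwI := hsub w ⟨hw.1.le, hw.2.le⟩
  refine ⟨w, hwI, ?_⟩
  have hD : 0 < |det₂ b a| := abs_pos.2 h.det
  have hmono := (strictMono_tangentComp h.det).monotone
  have hm1 := hmono hs₁
  have hm2 := hmono hs₂
  have hm3 : tangentComp a b (-(1 / 2)) ≤ tangentComp a b (1 / 2) := hmono (by norm_num)
  have e' : det₂ b a ^ 2 / ‖b + deriv s w • a‖ ^ 3 * deriv (deriv s) w
      = |det₂ b a| * (- curv F (GraphOn.param P a b s w)) := by
    rw [h.neg_curv_param (hI w hwI), ← sq_abs]; ring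
  have h3 : (tangentComp a b (1 / 2) - tangentComp a b (-(1 / 2))) / (2 * r)
      ≤ |det₂ b a| * (- curv F (GraphOn.param P a b s w)) := by
    rw [← e', e]
    rw [div_le_div_iff₀ (by linarith) (by linarith)]
    have := hw₁.1
    have := hw₂.2
    apply mul_le_mul <;> linarith
  rw [← div_div, div_le_iff₀ hD]
  linarith

/-! ### Corners -/

/-- A corner: a node `P` together with one of the four sectors at it. The linear polynomials `U`
and `V` are positive in the sector, `p` and `q` are the directions of its sides. -/
structure Corner where
  P : Plane
  p : Plane
  q : Plane
  U : MvPolynomial (Fin 2) ℝ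
  V : MvPolynomial (Fin 2) ℝ
  H : MvPolynomial (Fin 2) ℝ
  det : det₂ p q ≠ 0
  evU : ∀ u v : ℝ, ev U (P + u • p + v • q) = u
  evV : ∀ u v : ℝ, ev V (P + u • p + v • q) = v
  dpU : dirD p U = 1
  dqU : dirD q U = 0
  dpV : dirD p V = 0
  dqV : dirD q V = 1
  posH : 0 < ev H P

namespace Corner

/-- The axis of the sector. -/
def a (c : Corner) : Plane := c.p + c.q

/-- The direction transversal to the axis of the sector. -/
def b (c : Corner) : Plane := c.p - c.q

/-- The limit polynomial at the corner. -/
def F₀ (c : Corner) : MvPolynomial (Fin 2) ℝ := c.U * c.V * c.H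

/-- The point with coordinates `w` and `s`. -/
def pt (c : Corner) (w s : ℝ) : Plane := c.P + w • c.b + s • c.a

theorem pt_eq (c : Corner) (w s : ℝ) : c.pt w s = c.P + (s + w) • c.p + (s - w) • c.q := by
  ext i; simp [pt, a, b]; ring

theorem det_ba (c : Corner) : det₂ c.b c.a ≠ 0 := by
  have : det₂ c.b c.a = 2 * det₂ c.p c.q := by simp [det₂, a, b]; ring
  rw [this]
  exact mul_ne_zero two_ne_zero c.det

theorem ev_F₀_pt (c : Corner) (w s : ℝ) :
    ev c.F₀ (c.pt w s) = (s ^ 2 - w ^ 2) * ev c.H (c.pt w s) := by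
  rw [F₀, ev_mul, ev_mul, pt_eq, c.evU, c.evV]; ring

/-- The adjacent corner on the other side of `V = 0`. -/
def adj (c : Corner) : Corner where
  P := c.P
  p := c.p
  q := -c.q
  U := c.U
  V := -c.V
  H := c.H
  det := by have := c.det; simp [det₂] at this ⊢; intro h; apply this; linarith
  evU u v := by simpa using c.evU u (-v)
  evV u v := by have := c.evV u (-v); simp at this ⊢; linarith
  dpU := c.dpU
  dqU := by
    have := c.dqU
    simp only [dirD, PiLp.neg_apply, map_neg] at this ⊢
    linear_combination -this
  dpV := by rw [dirD_neg_poly, c.dpV, neg_zero]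
  dqV := by
    have := c.dqV
    simp only [dirD, PiLp.neg_apply, map_neg] at this ⊢
    linear_combination this
  posH := c.posH

theorem adj_a (c : Corner) : c.adj.a = c.b := by simp [a, b, adj, sub_eq_add_neg]

theorem adj_b (c : Corner) : c.adj.b = c.a := by simp [a, b, adj]

theorem adj_pt (c : Corner) (w s : ℝ) : c.adj.pt w s = c.pt s w := by
  simp only [pt, adj_a, adj_b]
  rw [add_right_comm]
  rfl

/-- At the node both `U` and `V` vanish, so only the mixed term of the second derivative survives.
-/
theorem ev_dirD_dirD_F₀ (c : Corner) (v : Plane) {k₁ k₂ : ℝ} (h1 : dirD v c.U = C k₁)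
    (h2 : dirD v c.V = C k₂) : ev (dirD v (dirD v c.F₀)) c.P = 2 * k₁ * k₂ * ev c.H c.P := by
  have hU : ev c.U c.P = 0 := by simpa using c.evU 0 0
  have hV : ev c.V c.P = 0 := by simpa using c.evV 0 0
  simp only [F₀, dirD_mul, dirD_add_poly, h1, h2, dirD_C, ev_add, ev_mul, ev_C, hU, hV, ev_zero]
  ring

theorem dirD_a (c : Corner) (F : MvPolynomial (Fin 2) ℝ) :
    dirD c.a F = dirD c.p F + dirD c.q F := by
  simp only [a, dirD, PiLp.add_apply, map_add]; ring

theorem ev_aa (c : Corner) : 0 < ev (dirD c.a (dirD c.a c.F₀)) c.P := by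
  rw [c.ev_dirD_dirD_F₀ c.a (k₁ := 1) (k₂ := 1)]
  · have := c.posH; linarith
  · rw [dirD_a, c.dpU, c.dqU]; simp
  · rw [dirD_a, c.dpV, c.dqV]; simp

/-- The closed box of size `r` at the corner. -/
def box (c : Corner) (r : ℝ) : Set Plane :=
  (fun z : ℝ × ℝ => c.pt z.1 z.2) '' (Set.Icc (-(2 * r)) (2 * r) ×ˢ Set.Icc (-(2 * r)) (2 * r))

theorem continuous_pt (c : Corner) : Continuous fun z : ℝ × ℝ => c.pt z.1 z.2 := by
  unfold pt; fun_prop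

theorem isCompact_box (c : Corner) (r : ℝ) : IsCompact (c.box r) :=
  (isCompact_Icc.prod isCompact_Icc).image c.continuous_pt

theorem adj_box (c : Corner) (r : ℝ) : c.adj.box r = c.box r := by
  ext x
  simp only [box, Set.mem_image, Set.mem_prod, Prod.exists]
  constructor
  · rintro ⟨w, s, h, rfl⟩; exact ⟨s, w, h.symm, (c.adj_pt w s).symm⟩
  · rintro ⟨w, s, h, rfl⟩; exact ⟨s, w, h.symm, (c.adj_pt s w)⟩

theorem eventually_box_subset (c : Corner) {S : Set Plane} (hS : S ∈ 𝓝 c.P) :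
    ∀ᶠ r in 𝓝[>] (0 : ℝ), c.box r ⊆ S := by
  have h0 : c.pt 0 0 = c.P := by simp [pt]
  have h1 := c.continuous_pt.continuousAt (x := (0, 0))
  simp only [ContinuousAt, h0] at h1
  obtain ⟨e, he, hb⟩ := Metric.mem_nhds_iff.1 (h1 hS)
  filter_upwards [Ioo_mem_nhdsGT (show (0 : ℝ) < e / 2 by linarith)] with r hr
  rintro x ⟨⟨w, s⟩, ⟨hw, hs⟩, rfl⟩
  apply hb
  have h2 := hr.2
  rw [Metric.mem_ball, Prod.dist_eq, Real.dist_eq, Real.dist_eq, sub_zero, sub_zero, max_lt_iff,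
    abs_lt, abs_lt]
  simp only at hw hs
  refine ⟨⟨?_, ?_⟩, ?_, ?_⟩ <;> linarith [hw.1, hw.2, hs.1, hs.2]

/-- In the box of size `r`, the limit polynomial is convex along the axis. -/
structure Good (c : Corner) (r : ℝ) : Prop where
  pos : 0 < r
  posH : ∀ x ∈ c.box r, 0 < ev c.H x
  aa : ∀ x ∈ c.box r, 0 < ev (dirD c.a (dirD c.a c.F₀)) x

theorem eventually_good (c : Corner) : ∀ᶠ r in 𝓝[>] (0 : ℝ), c.Good r := by
  have h1 := c.eventually_box_subset ((continuous_ev c.H).continuousAt.eventually_const_lt c.posH)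
  have h2 := c.eventually_box_subset ((continuous_ev _).continuousAt.eventually_const_lt c.ev_aa)
  filter_upwards [h1, h2, self_mem_nhdsWithin] with r g1 g2 g0
  exact ⟨g0, g1, g2⟩

end Corner

section



/-! ### The branches of a nearby curve at a node. -/

namespace Corner

variable {c : Corner} {r : ℝ}

theorem hasDerivAt_pt_right (c : Corner) (F : MvPolynomial (Fin 2) ℝ) (w s : ℝ) :
    HasDerivAt (fun x => ev F (c.pt w x)) (ev (dirD c.a F) (c.pt w s)) s :=
  hasDerivAt_ev_line F (c.P + w • c.b) c.a s

theorem hasDerivAt_pt_left (c : Corner) (F : MvPolynomial (Fin 2) ℝ) (w s : ℝ) :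
    HasDerivAt (fun x => ev F (c.pt x s)) (ev (dirD c.b F) (c.pt w s)) w := by
  have := hasDerivAt_ev_line F (c.P + s • c.a) c.b w
  simpa only [pt, add_right_comm] using this

theorem pt_mem_box (c : Corner) {w s : ℝ} (hw : w ∈ Set.Icc (-(2 * r)) (2 * r))
    (hs : s ∈ Set.Icc (-(2 * r)) (2 * r)) : c.pt w s ∈ c.box r := ⟨(w, s), ⟨hw, hs⟩, rfl⟩

/-- The duality of `U` with `p` and `q` is a linear system for its two partial derivatives, solved
by Cramer's rule among polynomials. -/
theorem pderivU (c : Corner) : pderiv 0 c.U = C (c.q 1 / det₂ c.p c.q) ∧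
    pderiv 1 c.U = C (-c.q 0 / det₂ c.p c.q) := by
  have h1 := c.dpU
  have h2 := c.dqU
  have hd : C (det₂ c.p c.q) * C (1 / det₂ c.p c.q) = (1 : MvPolynomial (Fin 2) ℝ) := by
    rw [← map_mul, mul_one_div_cancel c.det, map_one]
  have hd2 : (C (det₂ c.p c.q) : MvPolynomial (Fin 2) ℝ)
      = C (c.p 0) * C (c.q 1) - C (c.p 1) * C (c.q 0) := by
    rw [det₂, map_sub, map_mul, map_mul]
  simp only [dirD] at h1 h2
  constructor
  · rw [div_eq_mul_one_div, map_mul]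
    linear_combination (C (1 / det₂ c.p c.q) * C (c.q 1)) * h1
      - (C (1 / det₂ c.p c.q) * C (c.p 1)) * h2 - pderiv 0 c.U * hd
      + (C (1 / det₂ c.p c.q) * pderiv 0 c.U) * hd2
  · rw [div_eq_mul_one_div, map_mul, map_neg]
    linear_combination -(C (1 / det₂ c.p c.q) * C (c.q 0)) * h1
      + (C (1 / det₂ c.p c.q) * C (c.p 0)) * h2 - pderiv 1 c.U * hd
      + (C (1 / det₂ c.p c.q) * pderiv 1 c.U) * hd2

theorem pderivV (c : Corner) : pderiv 0 c.V = C (-c.p 1 / det₂ c.p c.q) ∧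
    pderiv 1 c.V = C (c.p 0 / det₂ c.p c.q) := by
  have h1 := c.dpV
  have h2 := c.dqV
  have hd : C (det₂ c.p c.q) * C (1 / det₂ c.p c.q) = (1 : MvPolynomial (Fin 2) ℝ) := by
    rw [← map_mul, mul_one_div_cancel c.det, map_one]
  have hd2 : (C (det₂ c.p c.q) : MvPolynomial (Fin 2) ℝ)
      = C (c.p 0) * C (c.q 1) - C (c.p 1) * C (c.q 0) := by
    rw [det₂, map_sub, map_mul, map_mul]
  simp only [dirD] at h1 h2
  constructor
  · rw [div_eq_mul_one_div, map_mul, map_neg]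
    linear_combination (C (1 / det₂ c.p c.q) * C (c.q 1)) * h1
      - (C (1 / det₂ c.p c.q) * C (c.p 1)) * h2 - pderiv 0 c.V * hd
      + (C (1 / det₂ c.p c.q) * pderiv 0 c.V) * hd2
  · rw [div_eq_mul_one_div, map_mul]
    linear_combination -(C (1 / det₂ c.p c.q) * C (c.q 0)) * h1
      + (C (1 / det₂ c.p c.q) * C (c.p 0)) * h2 - pderiv 1 c.V * hd
      + (C (1 / det₂ c.p c.q) * pderiv 1 c.V) * hd2

/-- `U = s + w` and `V = s - w` vanish together only on the axis `w = 0`, so off the axis exactly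
one linear factor vanishes. -/
theorem limit_straight (c : Corner) {w s : ℝ} (hH : 0 < ev c.H (c.pt w s)) (hw : w ≠ 0)
    (h0 : ev c.F₀ (c.pt w s) = 0) :
    0 < gradSq c.F₀ (c.pt w s) ∧ curv c.F₀ (c.pt w s) = 0 := by
  have hU : ev c.U (c.pt w s) = s + w := by rw [pt_eq, c.evU]
  have hV : ev c.V (c.pt w s) = s - w := by rw [pt_eq, c.evV]
  have hdet := c.det
  rw [F₀, ev_mul, ev_mul, hU, hV] at h0
  rcases mul_eq_zero.1 ((mul_eq_zero.1 h0).resolve_right hH.ne') with h | h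
  · rw [F₀, mul_assoc]
    refine gradSq_pos_and_curv_eq_zero c.pderivU.1 c.pderivU.2 ?_ (hU.trans h) ?_
    · by_contra hn
      simp only [not_or, not_not, div_eq_zero_iff, hdet, or_false, neg_eq_zero] at hn
      apply hdet; rw [det₂, hn.1, hn.2]; ring
    · rw [ev_mul, hV]
      apply mul_ne_zero _ hH.ne'
      intro h'; apply hw; linarith
  · rw [F₀, mul_comm c.U, mul_assoc]
    refine gradSq_pos_and_curv_eq_zero c.pderivV.1 c.pderivV.2 ?_ (hV.trans h) ?_
    · by_contra hn
      simp only [not_or, not_not, div_eq_zero_iff, hdet, or_false, neg_eq_zero] at hn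
      apply hdet; rw [det₂, hn.1, hn.2]; ring
    · rw [ev_mul, hU]
      apply mul_ne_zero _ hH.ne'
      intro h'; apply hw; linarith

/-- The polynomial `F` is close to the limit polynomial in the box of size `r`. -/
structure Near (c : Corner) (r δ ε : ℝ) (F : MvPolynomial (Fin 2) ℝ) : Prop where
  aa : ∀ x ∈ c.box r, 0 < ev (dirD c.a (dirD c.a F)) x
  top : ∀ w ∈ Set.Icc (-r) r, 0 < ev F (c.pt w (2 * r))
  axis : ∀ s ∈ Set.Icc δ (2 * r), 0 < ev F (c.pt 0 s)
  outer : ∀ w ∈ Set.Icc (-r) r, r / 2 ≤ |w| → 0 < ev F (c.pt w (|w| + δ))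
  inner : ∀ w ∈ Set.Icc (-r) r, r / 2 ≤ |w| → ev F (c.pt w (|w| - δ)) < 0
  curv_lt : ∀ w ∈ Set.Icc (-r) r, r / 2 ≤ |w| → ∀ s ∈ Set.Icc (-(2 * r)) (2 * r),
    ev F (c.pt w s) = 0 → |curv F (c.pt w s)| < ε

theorem isCompact_ring (r : ℝ) : IsCompact {w : ℝ | w ∈ Set.Icc (-r) r ∧ r / 2 ≤ |w|} := by
  have : {w : ℝ | w ∈ Set.Icc (-r) r ∧ r / 2 ≤ |w|} = Set.Icc (-r) r ∩ {w | r / 2 ≤ |w|} := rfl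
  rw [this]
  exact isCompact_Icc.inter_right (isClosed_le continuous_const continuous_abs)

/-- Each condition is an open condition on a compact set, and it holds for `F₀ = (s ^ 2 - w ^ 2) H`.
The bound `δ ≤ r / 4` keeps `|w| ± δ` inside the box and `|w| - δ` positive when `|w| ≥ r / 2`. The
curvature estimate excludes `|w| < r / 2`, where the node lies. -/
theorem eventually_near {ι : Type*} {l : Filter ι} {F : ι → MvPolynomial (Fin 2) ℝ}
    (hF : PolyTendsto l F c.F₀) (hr : c.Good r) {δ ε : ℝ} (hδ : 0 < δ) (hδr : δ ≤ r / 4)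
    (hε : 0 < ε) : ∀ᶠ i in l, c.Near r δ ε (F i) := by
  have hr0 := hr.pos
  have hpt := c.continuous_pt
  have habs : ∀ w ∈ Set.Icc (-r) r, |w| ≤ r := fun w hw => abs_le.2 hw
  have e1 := ((hF.dirD c.a).dirD c.a).eventually_pos (c.isCompact_box r) hr.aa
  have e3 := hF.eventually_pos (K := (fun w => c.pt w (2 * r)) '' Set.Icc (-r) r)
    (isCompact_Icc.image (hpt.comp (by fun_prop : Continuous fun w : ℝ => (w, 2 * r)))) (by
      rintro _ ⟨w, hw, rfl⟩
      rw [ev_F₀_pt]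
      apply mul_pos
      · nlinarith [hw.1, hw.2]
      · exact hr.posH _ (c.pt_mem_box ⟨by linarith [hw.1], by linarith [hw.2]⟩
          ⟨by linarith, by linarith⟩))
  have e4 := hF.eventually_pos (K := (fun s => c.pt 0 s) '' Set.Icc δ (2 * r))
    (isCompact_Icc.image (hpt.comp (by fun_prop : Continuous fun s : ℝ => ((0 : ℝ), s)))) (by
      rintro _ ⟨s, hs, rfl⟩
      rw [ev_F₀_pt]
      apply mul_pos
      · nlinarith [hs.1, hs.2]
      · exact hr.posH _ (c.pt_mem_box ⟨by linarith [hs.1], by linarith [hs.2]⟩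
          ⟨by linarith [hs.1], by linarith [hs.2]⟩))
  have e5 := hF.eventually_pos
    (K := (fun w => c.pt w (|w| + δ)) '' {w : ℝ | w ∈ Set.Icc (-r) r ∧ r / 2 ≤ |w|})
    ((isCompact_ring r).image
      (hpt.comp (by fun_prop : Continuous fun w : ℝ => (w, |w| + δ)))) (by
      rintro _ ⟨w, ⟨hw, hw2⟩, rfl⟩
      have := habs w hw
      beta_reduce
      rw [ev_F₀_pt]
      apply mul_pos
      · rw [← sq_abs w]; nlinarith
      · exact hr.posH _ (c.pt_mem_box ⟨by linarith [hw.1], by linarith [hw.2]⟩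
          ⟨by linarith, by linarith⟩))
  have e6 := hF.eventually_neg
    (K := (fun w => c.pt w (|w| - δ)) '' {w : ℝ | w ∈ Set.Icc (-r) r ∧ r / 2 ≤ |w|})
    ((isCompact_ring r).image
      (hpt.comp (by fun_prop : Continuous fun w : ℝ => (w, |w| - δ)))) (by
      rintro _ ⟨w, ⟨hw, hw2⟩, rfl⟩
      have := habs w hw
      beta_reduce
      rw [ev_F₀_pt]
      apply mul_neg_of_neg_of_pos
      · rw [← sq_abs w]; nlinarith
      · exact hr.posH _ (c.pt_mem_box ⟨by linarith [hw.1], by linarith [hw.2]⟩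
          ⟨by linarith, by linarith⟩))
  have e7 := hF.eventually_curv_lt (K := (fun z : ℝ × ℝ => c.pt z.1 z.2) ''
      ({w : ℝ | w ∈ Set.Icc (-r) r ∧ r / 2 ≤ |w|} ×ˢ Set.Icc (-(2 * r)) (2 * r)))
    (((isCompact_ring r).prod isCompact_Icc).image hpt) (by
      rintro _ ⟨⟨w, s⟩, ⟨⟨hw, hw2⟩, hs⟩, rfl⟩ h0
      refine c.limit_straight (hr.posH _ (c.pt_mem_box ?_ hs)) ?_ h0
      · exact ⟨by linarith [hw.1], by linarith [hw.2]⟩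
      · rintro rfl; simp at hw2; linarith) hε
  filter_upwards [e1, e3, e4, e5, e6, e7] with i g1 g3 g4 g5 g6 g7
  exact ⟨g1, fun w hw => g3 _ ⟨w, hw, rfl⟩, fun s hs => g4 _ ⟨s, hs, rfl⟩,
    fun w hw hw2 => g5 _ ⟨w, ⟨hw, hw2⟩, rfl⟩, fun w hw hw2 => g6 _ ⟨w, ⟨hw, hw2⟩, rfl⟩,
    fun w hw hw2 s hs h0 => (g7 _ ⟨(w, s), ⟨⟨hw, hw2⟩, hs⟩, rfl⟩ h0).2⟩

/-- The curve `F = 0` is separated by the axis of the corner, so that a branch of it lies in the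
sector. -/
def Open (c : Corner) (r : ℝ) (F : MvPolynomial (Fin 2) ℝ) : Prop :=
  ∀ w ∈ Set.Icc (-r) r, ∃ s ∈ Set.Icc (-(2 * r)) (2 * r), ev F (c.pt w s) < 0

/-- The branch of the curve `F = 0` in the sector, with the parameter `w₁` of a point of maximal
curvature. -/
structure IsArc (c : Corner) (r δ ε : ℝ) (F : MvPolynomial (Fin 2) ℝ) (s : ℝ → ℝ) (w₁ : ℝ) :
    Prop where
  graph : GraphOn F c.P c.a c.b (-(2 * r)) (2 * r) (Set.Icc (-r) r) s
  mem : w₁ ∈ Set.Ioo (-(r / 2)) (r / 2)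
  max : ∀ w ∈ Set.Icc (-r) r,
    - curv F (GraphOn.param c.P c.a c.b s w) ≤ - curv F (GraphOn.param c.P c.a c.b s w₁)
  big : ε < - curv F (GraphOn.param c.P c.a c.b s w₁)
  small : ∀ w ∈ Set.Icc (-r) r, r / 2 ≤ |w| → |curv F (GraphOn.param c.P c.a c.b s w)| < ε
  close : ∀ w ∈ Set.Icc (-r) r, r / 2 ≤ |w| → abs (s w - |w|) < δ

/-- A lower bound for the maximal curvature of the branches at the corner. -/
def curvBound (c : Corner) (r : ℝ) : ℝ :=
  (tangentComp c.a c.b (1 / 2) - tangentComp c.a c.b (-(1 / 2))) / (2 * r * |det₂ c.b c.a|)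

theorem curvBound_pos (c : Corner) (hr : 0 < r) : 0 < c.curvBound r := by
  have := strictMono_tangentComp c.det_ba (show (-(1 / 2) : ℝ) < 1 / 2 by norm_num)
  have := abs_pos.2 c.det_ba
  apply div_pos
  · linarith
  · positivity

/-- On each line parallel to the axis, `F` is convex, negative somewhere and positive at the top, so
its upper zero defines a graph. This graph is `δ`-close to `|w|` far from the axis and below `δ` on
the axis, hence it turns and has a point of curvature above `ε`. Since the curvature is below `ε`
for `|w| ≥ r / 2`, the maximum is attained in the inner part. -/
theorem exists_isArc {δ ε : ℝ} {F : MvPolynomial (Fin 2) ℝ} (hr : 0 < r) (hδ : 0 < δ)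
    (hδr : δ ≤ r / 4) (hε : ε < c.curvBound r) (hN : c.Near r δ ε F) (hA : c.Open r F) :
    ∃ s w₁, c.IsArc r δ ε F s w₁ := by
  have hconv : ∀ w ∈ Set.Icc (-r) r, ∀ x ∈ Set.Icc (-(2 * r)) (2 * r),
      0 < ev (dirD c.a (dirD c.a F)) (c.pt w x) := fun w hw x hx =>
    hN.aa _ (c.pt_mem_box ⟨by linarith [hw.1], by linarith [hw.2]⟩ hx)
  have hex : ∀ w, ∃ x, w ∈ Set.Icc (-r) r → x ∈ Set.Ioo (-(2 * r)) (2 * r) ∧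
      ev F (c.pt w x) = 0 ∧ 0 < ev (dirD c.a F) (c.pt w x) ∧
      ∀ y ∈ Set.Icc (-(2 * r)) (2 * r), ev F (c.pt w y) = 0 → 0 < ev (dirD c.a F) (c.pt w y) →
        y = x := by
    intro w
    by_cases hw : w ∈ Set.Icc (-r) r
    · obtain ⟨t, ht, htn⟩ := hA w hw
      have hlt : t < 2 * r := by
        refine lt_of_le_of_ne ht.2 ?_
        rintro rfl
        linarith [hN.top w hw]
      obtain ⟨x, hx, h⟩ := exists_upper_zero (c.hasDerivAt_pt_right F w)
        (c.hasDerivAt_pt_right _ w) (hconv w hw) ht ⟨by linarith, le_rfl⟩ htn (hN.top w hw) hlt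
      exact ⟨x, fun _ => ⟨⟨ht.1.trans_lt hx.1, hx.2⟩, h⟩⟩
    · exact ⟨0, fun h => absurd h hw⟩
  choose s hs using hex
  have hG : GraphOn F c.P c.a c.b (-(2 * r)) (2 * r) (Set.Icc (-r) r) s :=
    ⟨c.det_ba, fun w hw => (hs w hw).1, fun w hw => (hs w hw).2.1, fun w hw => (hs w hw).2.2.1,
      fun w hw => (hs w hw).2.2.2⟩
  have hclose : ∀ w ∈ Set.Icc (-r) r, r / 2 ≤ |w| → abs (s w - |w|) < δ := by
    intro w hw hw2
    have := abs_le.2 hw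
    obtain ⟨x, hx, h1, h2, h3⟩ := exists_upper_zero (c.hasDerivAt_pt_right F w)
      (c.hasDerivAt_pt_right _ w) (hconv w hw) (t := |w| - δ) (u := |w| + δ)
      ⟨by linarith, by linarith⟩ ⟨by linarith, by linarith⟩ (hN.inner w hw hw2)
      (hN.outer w hw hw2) (by linarith)
    have h4 := h3 (s w) ⟨(hs w hw).1.1.le, (hs w hw).1.2.le⟩ (hs w hw).2.1 (hs w hw).2.2.1
    rw [h4, abs_lt]
    constructor <;> linarith [hx.1, hx.2]
  have h0 : s 0 < δ := by
    have h0I : (0 : ℝ) ∈ Set.Icc (-r) r := ⟨by linarith, hr.le⟩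
    obtain ⟨t, ht, htn⟩ := hA 0 h0I
    have hlt : t < δ := by
      by_contra hn
      linarith [hN.axis t ⟨not_lt.1 hn, ht.2⟩]
    obtain ⟨x, hx, h1, h2, h3⟩ := exists_upper_zero (c.hasDerivAt_pt_right F 0)
      (c.hasDerivAt_pt_right _ 0) (hconv 0 h0I) ht (u := δ) ⟨by linarith, by linarith⟩ htn
      (hN.axis δ ⟨le_rfl, by linarith⟩) hlt
    rw [h3 (s 0) ⟨(hs 0 h0I).1.1.le, (hs 0 h0I).1.2.le⟩ (hs 0 h0I).2.1 (hs 0 h0I).2.2.1]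
    exact hx.2
  have hsmall : ∀ w ∈ Set.Icc (-r) r, r / 2 ≤ |w| →
      |curv F (GraphOn.param c.P c.a c.b s w)| < ε := fun w hw hw2 =>
    hN.curv_lt w hw hw2 (s w) ⟨(hs w hw).1.1.le, (hs w hw).1.2.le⟩ (hs w hw).2.1
  have hr' : r ∈ Set.Icc (-r) r := ⟨by linarith, le_rfl⟩
  have hnr' : -r ∈ Set.Icc (-r) r := ⟨le_rfl, by linarith⟩
  have k1 := abs_lt.1 (hclose r hr' (by rw [abs_of_pos hr]; linarith))
  have k2 := abs_lt.1 (hclose (-r) hnr' (by rw [abs_neg, abs_of_pos hr]; linarith))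
  rw [abs_of_pos hr] at k1
  rw [abs_neg, abs_of_pos hr] at k2
  -- `s (± r) > r - δ` and `s 0 < δ`, so both rises exceed `r - 2 * δ ≥ r / 2`.
  obtain ⟨ξ, hξ, hξc⟩ := hG.exists_curv_ge hr (by linarith [k2.1]) (by linarith [k1.1])
  have hcont : ContinuousOn (fun w => - curv F (GraphOn.param c.P c.a c.b s w))
      (Set.Icc (-r) r) := by
    intro w hw
    exact ((continuousAt_curv (hG.gradSq_pos hw)).comp_continuousWithinAt
      (hG.continuousOn_param w hw)).neg
  obtain ⟨w₁, hw₁, hmax⟩ := isCompact_Icc.exists_isMaxOn ⟨0, by linarith, hr.le⟩ hcont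
  have hbig : ε < - curv F (GraphOn.param c.P c.a c.b s w₁) :=
    (hε.trans_le hξc).trans_le (hmax ⟨hξ.1.le, hξ.2.le⟩)
  refine ⟨s, w₁, hG, ?_, fun w hw => hmax hw, hbig, hsmall, hclose⟩
  rw [Set.mem_Ioo, ← abs_lt]
  by_contra hn
  have := (abs_lt.1 (hsmall w₁ hw₁ (not_lt.1 hn))).1
  linarith

theorem dirD_ne_zero_of_nonsingular {F : MvPolynomial (Fin 2) ℝ} {a b x : Plane}
    (hdet : det₂ b a ≠ 0) (hF : IsNonsingularCurve F) (hx : ev F x = 0)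
    (ha : ev (dirD a F) x = 0) : ev (dirD b F) x ≠ 0 := by
  intro hb
  rw [ev_dirD] at ha hb
  obtain ⟨j, hj⟩ := hF x hx
  change ev (pderiv j F) x ≠ 0 at hj
  have h0 : det₂ b a * ev (pderiv 0 F) x = 0 := by
    rw [det₂]; linear_combination a 1 * hb - b 1 * ha
  have h1 : det₂ b a * ev (pderiv 1 F) x = 0 := by
    rw [det₂]; linear_combination b 0 * ha - a 0 * hb
  fin_cases j
  · exact hj ((mul_eq_zero.1 h0).resolve_left hdet)
  · exact hj ((mul_eq_zero.1 h1).resolve_left hdet)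

/-- If the sector is not open, `F ≥ 0` on a whole line `w = w₀`. By convexity `F` has at most one
zero `s₀` there, with zero derivative along `a`. Nonsingularity makes the derivative along `b`
nonzero, and moving the line slightly towards increasing `F` gives a line on which `F > 0`. This
line separates in the adjacent direction, because `adj` exchanges `w` and `s`. -/
theorem open_or_adj_open {F : MvPolynomial (Fin 2) ℝ} (hr : 0 < r)
    (haa : ∀ x ∈ c.box r, 0 < ev (dirD c.a (dirD c.a F)) x) (hF : IsNonsingularCurve F) :
    c.Open r F ∨ c.adj.Open r (-F) := by
  by_contra! hcon
  obtain ⟨hA, hB⟩ := hcon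
  simp only [Open, not_forall, not_exists, not_and, not_lt] at hA
  obtain ⟨w₀, hw₀, hA⟩ := hA
  suffices h : ∃ w ∈ Set.Icc (-(2 * r)) (2 * r), ∀ s ∈ Set.Icc (-r) r, 0 < ev F (c.pt w s) by
    obtain ⟨w, hw, h⟩ := h
    exact hB fun s hs => ⟨w, hw, by rw [adj_pt, ev_neg]; linarith [h s hs]⟩
  by_cases hall : ∀ s ∈ Set.Icc (-r) r, 0 < ev F (c.pt w₀ s)
  · exact ⟨w₀, ⟨by linarith [hw₀.1], by linarith [hw₀.2]⟩, hall⟩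
  push Not at hall
  obtain ⟨s₀, hs₀, h0⟩ := hall
  have hIcc : ∀ s ∈ Set.Icc (-r) r, s ∈ Set.Icc (-(2 * r)) (2 * r) := fun s hs =>
    ⟨by linarith [hs.1], by linarith [hs.2]⟩
  have h0' : ev F (c.pt w₀ s₀) = 0 := le_antisymm h0 (hA s₀ (hIcc s₀ hs₀))
  have hd := c.hasDerivAt_pt_right F w₀
  have hnhds : Set.Icc (-(2 * r)) (2 * r) ∈ 𝓝 s₀ :=
    Icc_mem_nhds (by linarith [hs₀.1]) (by linarith [hs₀.2])
  have ha0 : ev (dirD c.a F) (c.pt w₀ s₀) = 0 := by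
    apply IsLocalMin.hasDerivAt_eq_zero _ (hd s₀)
    filter_upwards [hnhds] with s hs
    rw [h0']; exact hA s hs
  have hmono : StrictMonoOn (fun s => ev (dirD c.a F) (c.pt w₀ s))
      (Set.Icc (-(2 * r)) (2 * r)) :=
    strictMonoOn_of_hasDerivAt_pos (c.hasDerivAt_pt_right _ w₀) (convex_Icc _ _) fun s hs =>
      haa _ (c.pt_mem_box (hIcc w₀ hw₀) hs)
  have hpos : ∀ s ∈ Set.Icc (-r) r, s ≠ s₀ → 0 < ev F (c.pt w₀ s) := by
    intro s hs hne
    rcases hne.lt_or_gt with h | h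
    · obtain ⟨x, hx, hxe⟩ := exists_hasDerivAt_eq_slope _ _ h
        (fun x _ => (hd x).continuousAt.continuousWithinAt) (fun x _ => hd x)
      have h1 := hmono (hIcc x ⟨by linarith [hs.1, hx.1], by linarith [hs₀.2, hx.2]⟩)
        (hIcc s₀ hs₀) hx.2
      simp only [ha0] at h1
      rw [hxe, h0', div_neg_iff] at h1
      rcases h1 with h1 | h1 <;> linarith
    · obtain ⟨x, hx, hxe⟩ := exists_hasDerivAt_eq_slope _ _ h
        (fun x _ => (hd x).continuousAt.continuousWithinAt) (fun x _ => hd x)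
      have h1 := hmono (hIcc s₀ hs₀)
        (hIcc x ⟨by linarith [hs₀.1, hx.1], by linarith [hs.2, hx.2]⟩) hx.1
      simp only [ha0] at h1
      rw [hxe, h0', lt_div_iff₀ (by linarith)] at h1
      linarith
  -- The line is displaced to `w₀ + t * k` with small `t > 0`, so near `s₀` the function `F` grows
  -- at a rate close to `k ^ 2`.
  obtain ⟨k, hk⟩ : ∃ k, k = ev (dirD c.b F) (c.pt w₀ s₀) := ⟨_, rfl⟩
  have hk0 : k ≠ 0 := by
    rw [hk]; exact dirD_ne_zero_of_nonsingular c.det_ba hF h0' ha0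
  have hcont : ∀ G, Continuous fun z : ℝ × ℝ => ev G (c.pt (w₀ + z.1 * k) z.2) := fun G =>
    (continuous_ev G).comp (c.continuous_pt.comp
      (by fun_prop : Continuous fun z : ℝ × ℝ => (w₀ + z.1 * k, z.2)))
  -- Locally uniform positivity for small `t > 0`: near `s₀` it comes from the growth in `t`
  -- starting from `F ≥ 0`, elsewhere from continuity at `t = 0`. Compactness of the interval then
  -- gives a common `t`.
  have key : ∀ s₁ ∈ Set.Icc (-r) r,
      {z : ℝ × ℝ | z.2 ∈ Set.Icc (-r) r → 0 < ev F (c.pt (w₀ + z.1 * k) z.2)}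
        ∈ 𝓝[>] (0 : ℝ) ×ˢ 𝓝 s₁ := by
    intro s₁ hs₁
    by_cases hne : s₁ = s₀
    · subst hne
      have h1 : ∀ᶠ z in 𝓝 ((0 : ℝ), s₁), 0 < k * ev (dirD c.b F) (c.pt (w₀ + z.1 * k) z.2) := by
        refine (continuous_const.mul (hcont _)).continuousAt.eventually_const_lt ?_
        change 0 < k * ev (dirD c.b F) (c.pt (w₀ + 0 * k) s₁)
        rw [zero_mul, add_zero, ← hk]
        exact mul_self_pos.2 hk0
      obtain ⟨e, he, hball⟩ := Metric.eventually_nhds_iff.1 h1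
      have m1 : ∀ᶠ t in 𝓝[>] (0 : ℝ), t ∈ Set.Ioo 0 e := Ioo_mem_nhdsGT he
      have m2 : ∀ᶠ s in 𝓝 s₁, dist s s₁ < e := Metric.eventually_nhds_iff.2 ⟨e, he, fun _ h => h⟩
      filter_upwards [m1.prod_mk m2] with z hz hz2
      have hline (t : ℝ) : HasDerivAt (fun t => ev F (c.pt (w₀ + t * k) z.2))
          (ev (dirD c.b F) (c.pt (w₀ + t * k) z.2) * k) t := by
        have h2 : HasDerivAt (fun t => w₀ + t * k) k t := by
          simpa using ((hasDerivAt_id t).mul_const k).const_add w₀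
        exact (c.hasDerivAt_pt_left F (w₀ + t * k) z.2).comp t h2
      obtain ⟨x, hx, hxe⟩ := exists_hasDerivAt_eq_slope _ _ hz.1.1
        (fun x _ => (hline x).continuousAt.continuousWithinAt) (fun x _ => hline x)
      have h3 : 0 < k * ev (dirD c.b F) (c.pt (w₀ + x * k) z.2) := by
        apply hball (y := (x, z.2))
        rw [Prod.dist_eq, max_lt_iff]
        refine ⟨?_, hz.2⟩
        simp only [Real.dist_eq, sub_zero]
        rw [abs_of_pos hx.1]
        exact hx.2.trans hz.1.2
      rw [mul_comm k, hxe, sub_zero, lt_div_iff₀ hz.1.1] at h3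
      simp only [zero_mul, add_zero] at h3
      have := hA z.2 (hIcc _ hz2)
      linarith
    · have h1 : ∀ᶠ z in 𝓝 ((0 : ℝ), s₁), 0 < ev F (c.pt (w₀ + z.1 * k) z.2) := by
        refine (hcont F).continuousAt.eventually_const_lt ?_
        simpa using hpos s₁ hs₁ hne
      rw [nhds_prod_eq] at h1
      have h2 : 𝓝[>] (0 : ℝ) ×ˢ 𝓝 s₁ ≤ 𝓝 0 ×ˢ 𝓝 s₁ := prod_mono nhdsWithin_le_nhds le_rfl
      filter_upwards [h2 h1] with z hz _ using hz
  have hev := (Filter.Eventually.curry (isCompact_Icc.mem_prod_nhdsSet_of_forall key)).mono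
    fun _ h => h.self_of_nhdsSet
  have hrange : ∀ᶠ t in 𝓝[>] (0 : ℝ), w₀ + t * k ∈ Set.Icc (-(2 * r)) (2 * r) := by
    apply nhdsWithin_le_nhds
    apply ContinuousAt.eventually_mem (f := fun t => w₀ + t * k) (by fun_prop)
    rw [zero_mul, add_zero]
    exact Icc_mem_nhds (by linarith [hw₀.1]) (by linarith [hw₀.2])
  obtain ⟨t, ht1, ht2⟩ := (hev.and hrange).exists
  exact ⟨w₀ + t * k, ht2, fun s hs => ht1 s hs hs⟩

end Corner

end

/-! ### Extrema on arcs -/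

/-- The minimum of `-curv` on the compact set `X` is attained away from the end points `X \ X₀`,
where the value is larger than at `t`. It is then a local minimum along the curve. The larger value
at `z` excludes local constancy, because local constancy would spread over the connected set `X`. -/
theorem exists_mem_curvExtrema_of_min {F : MvPolynomial (Fin 2) ℝ} {X₀ X : Set Plane}
    (hX : X ⊆ realCurve F) (hg : ∀ p ∈ X, 0 < gradSq F p) (hc : IsCompact X)
    (hconn : IsPreconnected X) (hopen : ∀ p ∈ X₀, X ∈ 𝓝[realCurve F] p) {t z : Plane}
    (ht : t ∈ X) (hz : z ∈ X) (hend : ∀ p ∈ X \ X₀, - curv F t < - curv F p)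
    (hlt : - curv F t < - curv F z) : ∃ m ∈ X₀, m ∈ curvExtrema F := by
  have hcont : ContinuousOn (fun p => - curv F p) X := fun p hp =>
    (continuousAt_curv (hg p hp)).neg.continuousWithinAt
  obtain ⟨m, hm, hmin⟩ := hc.exists_isMinOn ⟨t, ht⟩ hcont
  have hmt : - curv F m ≤ - curv F t := hmin ht
  have hm₀ : m ∈ X₀ := by
    by_contra h
    linarith [hend m ⟨hm, h⟩]
  refine ⟨m, hm₀, hX hm, hg m hm, Or.inr ?_, fun hconst => ?_⟩
  · filter_upwards [hopen m hm₀] with p hp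
    have : - curv F m ≤ - curv F p := hmin hp
    linarith
  · have := curv_eq_of_isPreconnected hconn hX hg hm hz hconst
    linarith

/-- The value at `w₁` is maximal on the arc and above `ε`, while that at the end `r` is below `ε`;
so the curvature is not constant on the arc. -/
theorem Corner.IsArc.mem_curvExtrema {c : Corner} {r δ ε : ℝ} {F : MvPolynomial (Fin 2) ℝ}
    {s : ℝ → ℝ} {w₁ : ℝ} (h : c.IsArc r δ ε F s w₁) (hr : 0 < r) :
    GraphOn.param c.P c.a c.b s w₁ ∈ curvExtrema F := by
  have hw₁ : w₁ ∈ Set.Icc (-r) r := ⟨by linarith [h.mem.1], by linarith [h.mem.2]⟩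
  have hnhds : Set.Icc (-r) r ∈ 𝓝 w₁ :=
    Icc_mem_nhds (by linarith [h.mem.1]) (by linarith [h.mem.2])
  refine ⟨h.graph.zero w₁ hw₁, h.graph.gradSq_pos hw₁, Or.inl ?_, fun hconst => ?_⟩
  · filter_upwards [h.graph.eventually_eq_param subset_rfl hnhds] with q hq
    have := h.max _ hq.1
    rw [← hq.2] at this
    linarith
  · have hr' : r ∈ Set.Icc (-r) r := ⟨by linarith, le_rfl⟩
    have h1 := curv_eq_of_isPreconnected (F := F)
      (S := GraphOn.param c.P c.a c.b s '' Set.Icc (-r) r)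
      (isPreconnected_Icc.image _ h.graph.continuousOn_param)
      (by rintro _ ⟨w, hw, rfl⟩; exact h.graph.zero w hw)
      (by rintro _ ⟨w, hw, rfl⟩; exact h.graph.gradSq_pos hw)
      ⟨w₁, hw₁, rfl⟩ ⟨r, hr', rfl⟩ hconst
    have h2 := abs_lt.1 (h.small r hr' (by rw [abs_of_pos hr]; linarith))
    linarith [h.big, h2.1]

/-- The part of a curve between the points of maximal curvature of two corner arcs which are joined
by a third arc. -/
theorem exists_mem_curvExtrema_of_joined_arcs {F : MvPolynomial (Fin 2) ℝ}
    {P a b P' a' b' A n t : Plane} {m M m' M' m'' M'' r ε w₁ w₁' : ℝ} {s s' y : ℝ → ℝ}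
    (h₁ : GraphOn F P a b m M (Set.Icc (-r) r) s)
    (h₂ : GraphOn F A n t m' M' (Set.Icc 0 1) y)
    (h₃ : GraphOn F P' a' b' m'' M'' (Set.Icc (-r) r) s')
    (hw₁ : w₁ ∈ Set.Ioo (-r) r) (hw₁' : w₁' ∈ Set.Ioo (-r) r)
    (l₁ : ∃ x ∈ Set.Ioo (0 : ℝ) 1, GraphOn.param P a b s (-r) = GraphOn.param A n t y x)
    (l₂ : ∃ w ∈ Set.Ioo (-r) w₁, GraphOn.param A n t y 0 = GraphOn.param P a b s w)
    (l₁' : ∃ x ∈ Set.Ioo (0 : ℝ) 1, GraphOn.param P' a' b' s' (-r) = GraphOn.param A n t y x)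
    (l₂' : ∃ w ∈ Set.Ioo (-r) w₁', GraphOn.param A n t y 1 = GraphOn.param P' a' b' s' w)
    (hsmall : ∀ x ∈ Set.Icc (0 : ℝ) 1, - curv F (GraphOn.param A n t y x) < ε)
    (hbig : ε < - curv F (GraphOn.param P a b s w₁))
    (hbig' : ε < - curv F (GraphOn.param P' a' b' s' w₁')) :
    ∃ X₀ : Set Plane,
      X₀ = GraphOn.param P a b s '' Set.Ico (-r) w₁ ∪ GraphOn.param A n t y '' Set.Icc 0 1
        ∪ GraphOn.param P' a' b' s' '' Set.Ico (-r) w₁' ∧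
      X₀ ⊆ realCurve F ∧ IsPreconnected X₀ ∧ (∀ p ∈ X₀, X₀ ∈ 𝓝[realCurve F] p) ∧
      IsCompact (X₀ ∪ {GraphOn.param P a b s w₁, GraphOn.param P' a' b' s' w₁'}) ∧
      ∃ z ∈ X₀, z ∈ curvExtrema F := by
  have i1 : Set.Ico (-r) w₁ ⊆ Set.Icc (-r) r := fun w hw => ⟨hw.1, (hw.2.trans hw₁.2).le⟩
  have i3 : Set.Ico (-r) w₁' ⊆ Set.Icc (-r) r := fun w hw => ⟨hw.1, (hw.2.trans hw₁'.2).le⟩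
  have j1 : Set.Icc (-r) w₁ ⊆ Set.Icc (-r) r := fun w hw => ⟨hw.1, hw.2.trans hw₁.2.le⟩
  have j3 : Set.Icc (-r) w₁' ⊆ Set.Icc (-r) r := fun w hw => ⟨hw.1, hw.2.trans hw₁'.2.le⟩
  have e1 : GraphOn.param P a b s '' Set.Icc (-r) w₁
      = GraphOn.param P a b s '' Set.Ico (-r) w₁ ∪ {GraphOn.param P a b s w₁} := by
    rw [← Set.image_singleton, ← Set.image_union, Set.Ico_union_right hw₁.1.le]
  have e3 : GraphOn.param P' a' b' s' '' Set.Icc (-r) w₁'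
      = GraphOn.param P' a' b' s' '' Set.Ico (-r) w₁' ∪ {GraphOn.param P' a' b' s' w₁'} := by
    rw [← Set.image_singleton, ← Set.image_union, Set.Ico_union_right hw₁'.1.le]
  have hl1 := l₁
  have hl1' := l₁'
  obtain ⟨x, hx, hxe⟩ := l₁
  obtain ⟨x', hx', hxe'⟩ := l₁'
  have hxI : x ∈ Set.Icc (0 : ℝ) 1 := ⟨hx.1.le, hx.2.le⟩
  have hxI' : x' ∈ Set.Icc (0 : ℝ) 1 := ⟨hx'.1.le, hx'.2.le⟩
  have hT : IsPreconnected (GraphOn.param A n t y '' Set.Icc 0 1) :=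
    isPreconnected_Icc.image _ h₂.continuousOn_param
  obtain ⟨X₀, hX₀⟩ : ∃ X₀, X₀ = GraphOn.param P a b s '' Set.Ico (-r) w₁
    ∪ GraphOn.param A n t y '' Set.Icc 0 1
    ∪ GraphOn.param P' a' b' s' '' Set.Ico (-r) w₁' := ⟨_, rfl⟩
  have hXu : X₀ ∪ {GraphOn.param P a b s w₁, GraphOn.param P' a' b' s' w₁'}
      = GraphOn.param P a b s '' Set.Icc (-r) w₁ ∪ GraphOn.param A n t y '' Set.Icc 0 1
        ∪ GraphOn.param P' a' b' s' '' Set.Icc (-r) w₁' := by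
    rw [hX₀, e1, e3, Set.insert_eq]
    ext z; simp only [Set.mem_union]; tauto
  have hcurve : X₀ ∪ {GraphOn.param P a b s w₁, GraphOn.param P' a' b' s' w₁'} ⊆ realCurve F := by
    rw [hXu]
    rintro _ ((⟨w, hw, rfl⟩ | ⟨w, hw, rfl⟩) | ⟨w, hw, rfl⟩)
    · exact h₁.zero w (j1 hw)
    · exact h₂.zero w hw
    · exact h₃.zero w (j3 hw)
  have hgrad : ∀ p ∈ X₀ ∪ {GraphOn.param P a b s w₁, GraphOn.param P' a' b' s' w₁'},
      0 < gradSq F p := by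
    rw [hXu]
    rintro _ ((⟨w, hw, rfl⟩ | ⟨w, hw, rfl⟩) | ⟨w, hw, rfl⟩)
    · exact h₁.gradSq_pos (j1 hw)
    · exact h₂.gradSq_pos hw
    · exact h₃.gradSq_pos (j3 hw)
  have hpre : IsPreconnected X₀ := by
    rw [hX₀]
    refine IsPreconnected.union' ⟨GraphOn.param P' a' b' s' (-r), Or.inr ⟨x', hxI', hxe'.symm⟩,
      ⟨-r, ⟨le_rfl, hw₁'.1⟩, rfl⟩⟩ (IsPreconnected.union' ⟨GraphOn.param P a b s (-r),
      ⟨-r, ⟨le_rfl, hw₁.1⟩, rfl⟩, ⟨x, hxI, hxe.symm⟩⟩ ?_ hT) ?_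
    · exact isPreconnected_Ico.image _ (h₁.continuousOn_param.mono i1)
    · exact isPreconnected_Ico.image _ (h₃.continuousOn_param.mono i3)
  have hpre' : IsPreconnected (X₀ ∪ {GraphOn.param P a b s w₁, GraphOn.param P' a' b' s' w₁'}) := by
    rw [hXu]
    refine IsPreconnected.union' ⟨GraphOn.param P' a' b' s' (-r), Or.inr ⟨x', hxI', hxe'.symm⟩,
      ⟨-r, ⟨le_rfl, hw₁'.1.le⟩, rfl⟩⟩ (IsPreconnected.union' ⟨GraphOn.param P a b s (-r),
      ⟨-r, ⟨le_rfl, hw₁.1.le⟩, rfl⟩, ⟨x, hxI, hxe.symm⟩⟩ ?_ hT) ?_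
    · exact isPreconnected_Icc.image _ (h₁.continuousOn_param.mono j1)
    · exact isPreconnected_Icc.image _ (h₃.continuousOn_param.mono j3)
  have n1 : ∀ w ∈ Set.Ioo (-r) w₁, X₀ ∈ 𝓝[realCurve F] (GraphOn.param P a b s w) := by
    intro w hw
    filter_upwards [h₁.eventually_eq_param (J := Set.Ioo (-r) w₁)
      (fun v hv => i1 ⟨hv.1.le, hv.2⟩) (isOpen_Ioo.mem_nhds hw)] with q hq
    rw [hX₀]
    exact Or.inl (Or.inl ⟨_, ⟨hq.1.1.le, hq.1.2⟩, hq.2.symm⟩)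
  have n2 : ∀ w ∈ Set.Ioo (0 : ℝ) 1, X₀ ∈ 𝓝[realCurve F] (GraphOn.param A n t y w) := by
    intro w hw
    filter_upwards [h₂.eventually_eq_param (J := Set.Ioo (0 : ℝ) 1)
      (fun v hv => ⟨hv.1.le, hv.2.le⟩) (isOpen_Ioo.mem_nhds hw)] with q hq
    rw [hX₀]
    exact Or.inl (Or.inr ⟨_, ⟨hq.1.1.le, hq.1.2.le⟩, hq.2.symm⟩)
  have n3 : ∀ w ∈ Set.Ioo (-r) w₁', X₀ ∈ 𝓝[realCurve F] (GraphOn.param P' a' b' s' w) := by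
    intro w hw
    filter_upwards [h₃.eventually_eq_param (J := Set.Ioo (-r) w₁')
      (fun v hv => i3 ⟨hv.1.le, hv.2⟩) (isOpen_Ioo.mem_nhds hw)] with q hq
    rw [hX₀]
    exact Or.inr ⟨_, ⟨hq.1.1.le, hq.1.2⟩, hq.2.symm⟩
  -- The ends of each piece are interior to a neighbouring piece by the linking hypotheses, so the
  -- half-open union is open in the curve.
  have hopen : ∀ p ∈ X₀, X₀ ∈ 𝓝[realCurve F] p := by
    intro p hp
    rw [hX₀] at hp
    rcases hp with (⟨w, hw, rfl⟩ | ⟨w, hw, rfl⟩) | ⟨w, hw, rfl⟩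
    · rcases hw.1.eq_or_lt with rfl | h
      · rw [hxe]; exact n2 x hx
      · exact n1 w ⟨h, hw.2⟩
    · rcases hw.1.eq_or_lt with rfl | h
      · obtain ⟨v, hv, hve⟩ := l₂
        rw [hve]; exact n1 v hv
      · rcases hw.2.eq_or_lt with rfl | h'
        · obtain ⟨v, hv, hve⟩ := l₂'
          rw [hve]; exact n3 v hv
        · exact n2 w ⟨h, h'⟩
    · rcases hw.1.eq_or_lt with rfl | h
      · rw [hxe']; exact n2 x' hx'
      · exact n3 w ⟨h, hw.2⟩
  have hcpt : IsCompact (X₀ ∪ {GraphOn.param P a b s w₁, GraphOn.param P' a' b' s' w₁'}) := by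
    rw [hXu]
    exact ((isCompact_Icc.image_of_continuousOn (h₁.continuousOn_param.mono j1)).union
      (isCompact_Icc.image_of_continuousOn h₂.continuousOn_param)).union
      (isCompact_Icc.image_of_continuousOn (h₃.continuousOn_param.mono j3))
  refine ⟨X₀, hX₀, fun z hz => hcurve (Or.inl hz), hpre, hopen, hcpt, ?_⟩
  have ht0 := hsmall 0 ⟨le_rfl, zero_le_one⟩
  -- The comparison point is on the middle arc, with value below `ε`; at the two missing end points
  -- the value is above `ε`.
  refine exists_mem_curvExtrema_of_min (t := GraphOn.param A n t y 0)
    (z := GraphOn.param P a b s w₁) hcurve hgrad hcpt hpre'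
    (fun p hp => mem_of_superset (hopen p hp) Set.subset_union_left) ?_
    (Or.inr (Or.inl rfl)) ?_ (ht0.trans hbig)
  · left
    rw [hX₀]
    exact Or.inl (Or.inr ⟨0, ⟨le_rfl, zero_le_one⟩, rfl⟩)
  · rintro p ⟨hp | rfl | hp, hp'⟩
    · exact absurd hp hp'
    · exact ht0.trans hbig
    · rw [Set.mem_singleton_iff] at hp
      rw [hp]; exact ht0.trans hbig'

/-! ### Changes of sign -/

theorem realCurve_units_smul (σ : ℤˣ) (F : MvPolynomial (Fin 2) ℝ) :
    realCurve (σ • F) = realCurve F := by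
  rcases Int.units_eq_one_or σ with rfl | rfl
  · rw [one_smul]
  · ext p; simp [mem_realCurve]

theorem curvExtrema_units_smul (σ : ℤˣ) (F : MvPolynomial (Fin 2) ℝ) :
    curvExtrema (σ • F) = curvExtrema F := by
  rcases Int.units_eq_one_or σ with rfl | rfl
  · rw [one_smul]
  · have h : curv (-F) = fun p => - curv F p := funext fun p => curv_neg F p
    ext p
    have hc : realCurve (-F) = realCurve F := by simpa using realCurve_units_smul (-1) F
    have he : IsLocalExtrOn (fun p => - curv F p) (realCurve F) p ↔
        IsLocalExtrOn (curv F) (realCurve F) p :=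
      ⟨fun h => by simpa using h.neg, fun h => h.neg⟩
    simp [curvExtrema, gradSq_neg, h, hc, he]

theorem PolyTendsto.units_smul {ι : Type*} {l : Filter ι} {F : ι → MvPolynomial (Fin 2) ℝ}
    {G : MvPolynomial (Fin 2) ℝ} (h : PolyTendsto l F G) (σ : ℤˣ) :
    PolyTendsto l (fun i => σ • F i) (σ • G) := by
  rcases Int.units_eq_one_or σ with rfl | rfl
  · simpa using h
  · simpa using h.neg

namespace Corner

theorem ext_of {c c' : Corner} (hP : c.P = c'.P) (hp : c.p = c'.p) (hq : c.q = c'.q)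
    (hU : c.U = c'.U) (hV : c.V = c'.V) (hH : c.H = c'.H) : c = c' := by
  cases c; cases c'
  subst hP hp hq hU hV hH
  rfl

/-- The corner with the roles of the two sides exchanged. -/
def swap (c : Corner) : Corner where
  P := c.P
  p := c.q
  q := c.p
  U := c.V
  V := c.U
  H := c.H
  det := by have := c.det; simp only [det₂] at this ⊢; intro h; apply this; linarith
  evU u v := by rw [add_right_comm]; exact c.evV v u
  evV u v := by rw [add_right_comm]; exact c.evU v u
  dpU := c.dqV
  dqU := c.dpV
  dpV := c.dqU
  dqV := c.dpU
  posH := c.posH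

theorem swap_a (c : Corner) : c.swap.a = c.a := add_comm _ _

theorem swap_b (c : Corner) : c.swap.b = -c.b := by simp [b, swap]

theorem IsArc.swap {c : Corner} {r δ ε : ℝ} {F : MvPolynomial (Fin 2) ℝ} {s : ℝ → ℝ} {w₁ : ℝ}
    (h : c.IsArc r δ ε F s w₁) : c.swap.IsArc r δ ε F (fun w => s (-w)) (-w₁) := by
  have hP : c.swap.P = c.P := rfl
  have hI {w : ℝ} (hw : w ∈ Set.Icc (-r) r) : -w ∈ Set.Icc (-r) r :=
    ⟨by linarith [hw.2], by linarith [hw.1]⟩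
  have hpar (w : ℝ) : GraphOn.param c.swap.P c.swap.a c.swap.b (fun w => s (-w)) w
      = GraphOn.param c.P c.a c.b s (-w) := by
    simp [GraphOn.param, swap_a, swap_b, hP]
  have hpt (w x : ℝ) : c.swap.P + w • c.swap.b + x • c.swap.a = c.P + (-w) • c.b + x • c.a := by
    simp [swap_a, swap_b, hP]
  refine ⟨⟨c.swap.det_ba, fun w hw => h.graph.mem _ (hI hw), fun w hw => ?_, fun w hw => ?_,
    fun w hw x hx h1 h2 => ?_⟩, ⟨by linarith [h.mem.2], by linarith [h.mem.1]⟩, fun w hw => ?_, ?_,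
    fun w hw hw2 => ?_, fun w hw hw2 => ?_⟩
  · rw [hpt]; exact h.graph.zero _ (hI hw)
  · rw [hpt, swap_a]; exact h.graph.pos _ (hI hw)
  · rw [hpt] at h1 h2
    rw [swap_a] at h2
    exact h.graph.uniq _ (hI hw) x hx h1 h2
  · rw [hpar, hpar, neg_neg]; exact h.max _ (hI hw)
  · rw [hpar, neg_neg]; exact h.big
  · rw [hpar]; exact h.small _ (hI hw) (by rwa [abs_neg])
  · simpa only [abs_neg] using h.close _ (hI hw) (by rwa [abs_neg])

theorem IsArc.swap_param {c : Corner} {s : ℝ → ℝ} {w₁ : ℝ} :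
    GraphOn.param c.swap.P c.swap.a c.swap.b (fun w => s (-w)) (-w₁)
      = GraphOn.param c.P c.a c.b s w₁ := by
  have hP : c.swap.P = c.P := rfl
  simp [GraphOn.param, swap_a, swap_b, hP]

/-- The corner with the signs of its sides changed. -/
def signed (c : Corner) (σ τ : ℤˣ) : Corner where
  P := c.P
  p := σ • c.p
  q := τ • c.q
  U := σ • c.U
  V := τ • c.V
  H := c.H
  det := by
    have := c.det
    rcases Int.units_eq_one_or σ with rfl | rfl <;> rcases Int.units_eq_one_or τ with rfl | rfl <;>
    simp only [det₂, one_smul, Units.neg_smul, PiLp.neg_apply] at this ⊢ <;>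
    intro h <;> apply this <;> linarith
  evU u v := by
    have h1 := c.evU
    rcases Int.units_eq_one_or σ with rfl | rfl <;> rcases Int.units_eq_one_or τ with rfl | rfl <;>
    simp only [one_smul, Units.neg_smul, ev_neg, smul_neg, ← neg_smul, h1, neg_neg]
  evV u v := by
    have h1 := c.evV
    rcases Int.units_eq_one_or σ with rfl | rfl <;> rcases Int.units_eq_one_or τ with rfl | rfl <;>
    simp only [one_smul, Units.neg_smul, ev_neg, smul_neg, ← neg_smul, h1, neg_neg]
  dpU := by
    have h1 := c.dpU
    rcases Int.units_eq_one_or σ with rfl | rfl <;>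
    simp only [one_smul, Units.neg_smul, dirD, PiLp.neg_apply, map_neg] at h1 ⊢ <;>
    linear_combination h1
  dqU := by
    have h1 := c.dqU
    rcases Int.units_eq_one_or σ with rfl | rfl <;> rcases Int.units_eq_one_or τ with rfl | rfl <;>
    simp only [one_smul, Units.neg_smul, dirD, PiLp.neg_apply, map_neg] at h1 ⊢ <;>
    first | linear_combination h1 | linear_combination -h1
  dpV := by
    have h1 := c.dpV
    rcases Int.units_eq_one_or σ with rfl | rfl <;> rcases Int.units_eq_one_or τ with rfl | rfl <;>
    simp only [one_smul, Units.neg_smul, dirD, PiLp.neg_apply, map_neg] at h1 ⊢ <;>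
    first | linear_combination h1 | linear_combination -h1
  dqV := by
    have h1 := c.dqV
    rcases Int.units_eq_one_or τ with rfl | rfl <;>
    simp only [one_smul, Units.neg_smul, dirD, PiLp.neg_apply, map_neg] at h1 ⊢ <;>
    linear_combination h1
  posH := c.posH

theorem signed_swap (c : Corner) (σ τ : ℤˣ) : (c.signed σ τ).swap = c.swap.signed τ σ := rfl

theorem signed_F₀ (c : Corner) (σ τ : ℤˣ) : (c.signed σ τ).F₀ = (σ * τ) • c.F₀ := by
  rcases Int.units_eq_one_or σ with rfl | rfl <;> rcases Int.units_eq_one_or τ with rfl | rfl <;>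
  simp [F₀, signed]

theorem signed_one (c : Corner) : c.signed 1 1 = c :=
  ext_of rfl (one_smul _ _) (one_smul _ _) (one_smul _ _) (one_smul _ _) rfl

theorem signed_adj (c : Corner) : c.signed 1 (-1) = c.adj :=
  ext_of rfl (one_smul _ _) (by simp [signed, adj]) (one_smul _ _) (by simp [signed, adj]) rfl

theorem signed_signed (c : Corner) (σ τ σ' τ' : ℤˣ) :
    (c.signed σ τ).signed σ' τ' = c.signed (σ' * σ) (τ' * τ) :=
  ext_of rfl (smul_smul _ _ _) (smul_smul _ _ _) (smul_smul _ _ _) (smul_smul _ _ _) rfl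

theorem signed_neg_a (c : Corner) : (c.signed (-1) (-1)).a = -c.a := by
  simp [a, signed]; abel

theorem signed_neg_pt (c : Corner) (w s : ℝ) : (c.signed (-1) (-1)).pt w s = c.pt (-w) (-s) := by
  ext i; simp [pt, a, b, signed]; ring

theorem signed_neg_open {c : Corner} {r : ℝ} {F : MvPolynomial (Fin 2) ℝ} (h : c.Open r F) :
    (c.signed (-1) (-1)).Open r F := by
  intro w hw
  obtain ⟨s, hs, h⟩ := h (-w) ⟨by linarith [hw.2], by linarith [hw.1]⟩
  exact ⟨-s, ⟨by linarith [hs.2], by linarith [hs.1]⟩, by rwa [signed_neg_pt, neg_neg]⟩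

/-- At each node the curve is separated either along one of the axes or along the other. -/
theorem exists_open {c : Corner} {r δ ε : ℝ} {F : MvPolynomial (Fin 2) ℝ} (hr : 0 < r)
    (hN : c.Near r δ ε F) (hF : IsNonsingularCurve F) :
    ∃ t : ℤˣ, ∀ σ : ℤˣ, (c.signed σ (σ * t)).Open r (t • F) := by
  -- `t` tells which opposite sectors contain the branches: those with equal signs for `t = 1`,
  -- those with different signs for `t = -1`. Multiplying `F` by `t` makes its limit positive in
  -- these sectors near the node.
  rcases open_or_adj_open hr hN.aa hF with h | h
  · refine ⟨1, fun σ => ?_⟩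
    rcases Int.units_eq_one_or σ with rfl | rfl
    · simpa [signed_one] using h
    · simpa using signed_neg_open h
  · refine ⟨-1, fun σ => ?_⟩
    rcases Int.units_eq_one_or σ with rfl | rfl
    · simpa [signed_adj] using h
    · have := signed_neg_open h
      rw [← signed_adj, signed_signed] at this
      simpa using this

end Corner

/-! ### Arcs along an edge -/

theorem GraphOn.reverse {F : MvPolynomial (Fin 2) ℝ} {A n t : Plane} {m M : ℝ} {y : ℝ → ℝ}
    (h : GraphOn F A n t m M (Set.Icc 0 1) y) :
    GraphOn F (A + t) n (-t) m M (Set.Icc 0 1) (fun x => y (1 - x)) := by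
  have hI {w : ℝ} (hw : w ∈ Set.Icc (0 : ℝ) 1) : 1 - w ∈ Set.Icc (0 : ℝ) 1 :=
    ⟨by linarith [hw.2], by linarith [hw.1]⟩
  have hpt (w x : ℝ) : A + t + w • (-t) + x • n = A + (1 - w) • t + x • n := by
    ext i; simp; ring
  refine ⟨?_, fun w hw => h.mem _ (hI hw), fun w hw => ?_, fun w hw => ?_,
    fun w hw x hx h1 h2 => ?_⟩
  · have := h.det
    simp only [det₂, PiLp.neg_apply] at this ⊢
    intro h; apply this; linarith
  · rw [hpt]; exact h.zero _ (hI hw)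
  · rw [hpt]; exact h.pos _ (hI hw)
  · rw [hpt] at h1 h2
    exact h.uniq _ (hI hw) x hx h1 h2

theorem GraphOn.reverse_param (A n t : Plane) (y : ℝ → ℝ) (x : ℝ) :
    GraphOn.param (A + t) n (-t) (fun x => y (1 - x)) x = GraphOn.param A n t y (1 - x) := by
  ext i; simp [GraphOn.param]; ring

/-- A point near the end of an edge lies on the arc along the edge. -/
theorem GraphOn.exists_eq_of_near {F : MvPolynomial (Fin 2) ℝ} {P p q A n t x : Plane}
    {r δ κ ν θ θ' : ℝ} {y : ℝ → ℝ} (h : GraphOn F A n t (-δ) δ (Set.Icc 0 1) y)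
    (hpos : ∀ x ∈ Set.Icc (0 : ℝ) 1, ∀ z ∈ Set.Icc (-δ) δ, 0 < ev (dirD n F) (A + x • t + z • n))
    (hA : A = P + (3 / 2 * r) • q) (hq : q = κ • t) (hp : p = n + ν • q) (hκ : 0 < κ)
    (hκr : κ * r ≤ 1) (hν : δ * (1 + |ν|) ≤ r / 4) (hθ : |θ| < δ) (hθ' : |θ'| < δ)
    (hx : x = P + θ • p + (2 * r + θ') • q) (h0 : ev F x = 0) :
    ∃ v ∈ Set.Ioo (0 : ℝ) 1, x = GraphOn.param A n t y v := by
  -- The arc ends at distance about `2 * r` along `q` and the strip starts at `3 / 2 * r`, which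
  -- leaves `r / 2`. The obliqueness `ν` of `p` against `n` contributes `θ * ν`.
  have hz : x = A + (κ * (r / 2 + θ' + θ * ν)) • t + θ • n := by
    rw [hx, hp, hA, hq]
    ext i; simp; ring
  have h1 : |θ * ν| ≤ δ * |ν| := by
    rw [abs_mul]; exact mul_le_mul_of_nonneg_right hθ.le (abs_nonneg _)
  have h2 := abs_le.1 h1
  have h3 := abs_lt.1 hθ'
  have h4 := abs_lt.1 hθ
  have hx01 : κ * (r / 2 + θ' + θ * ν) ∈ Set.Ioo (0 : ℝ) 1 := by
    constructor
    · apply mul_pos hκ; nlinarith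
    · calc κ * (r / 2 + θ' + θ * ν) < κ * r := by
            apply mul_lt_mul_of_pos_left _ hκ; nlinarith
        _ ≤ 1 := hκr
  refine ⟨_, hx01, ?_⟩
  have hθI : θ ∈ Set.Icc (-δ) δ := ⟨h4.1.le, h4.2.le⟩
  have hI : κ * (r / 2 + θ' + θ * ν) ∈ Set.Icc (0 : ℝ) 1 := ⟨hx01.1.le, hx01.2.le⟩
  have h5 := h.uniq _ hI θ hθI (by rw [← hz]; exact h0) (hpos _ hI _ hθI)
  rw [GraphOn.param, ← h5, ← hz]

/-- The arc along an edge ends on the arc at the corner. -/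
theorem Corner.IsArc.exists_eq_of_near {c : Corner} {F : MvPolynomial (Fin 2) ℝ} {A n t : Plane}
    {r δ ε ν w₁ : ℝ} {s y : ℝ → ℝ} (hc : c.IsArc r δ ε F s w₁)
    (h : GraphOn F A n t (-δ) δ (Set.Icc 0 1) y)
    (hpos : 0 < ev (dirD c.a F) (GraphOn.param A n t y 0))
    (hA : A = c.P + (3 / 2 * r) • c.q) (hp : c.p = n + ν • c.q)
    (hr : 0 < r) (hν : δ * (1 + |ν|) ≤ r / 4) :
    ∃ w ∈ Set.Ioo (-r) w₁, GraphOn.param A n t y 0 = GraphOn.param c.P c.a c.b s w := by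
  have hy := h.mem 0 ⟨le_rfl, zero_le_one⟩
  have hy' : |y 0| < δ := abs_lt.2 hy
  have h1 : |y 0 * ν| ≤ δ * |ν| := by
    rw [abs_mul]; exact mul_le_mul_of_nonneg_right hy'.le (abs_nonneg _)
  have h2 := abs_le.1 h1
  -- The corner coordinates of the start of the strip; `hν` puts `w` within `r / 8` of `-3 / 4 * r`,
  -- hence between `-r` and `-(r / 2)`.
  set w := (y 0 * (1 + ν) - 3 / 2 * r) / 2 with hw
  set x := (y 0 * (1 - ν) + 3 / 2 * r) / 2 with hx
  have hz : GraphOn.param A n t y 0 = c.P + w • c.b + x • c.a := by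
    have hn : n = c.p - ν • c.q := by rw [hp]; abel
    rw [GraphOn.param, hA, hn]
    ext i; simp [Corner.a, Corner.b, hw, hx]; ring
  have hw1 : -r < w := by rw [hw]; nlinarith [hy.1]
  have hw2 : w < -(r / 2) := by rw [hw]; nlinarith [hy.2]
  have hx1 : x ∈ Set.Icc (-(2 * r)) (2 * r) := by
    constructor <;> rw [hx] <;> nlinarith [hy.1, hy.2]
  have hwI : w ∈ Set.Icc (-r) r := ⟨hw1.le, by linarith⟩
  have h0 := h.zero 0 ⟨le_rfl, zero_le_one⟩
  rw [GraphOn.param] at hz hpos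
  rw [hz] at h0 hpos
  have h3 := hc.graph.uniq w hwI x hx1 h0 hpos
  refine ⟨w, ⟨hw1, by linarith [hc.mem.1]⟩, ?_⟩
  rw [GraphOn.param, GraphOn.param, hz, h3]

section



/-! ### Strips along an edge -/

/-- In the strip along the segment from `A` to `A + t`, of width `δ` in the direction `n`, the
limit polynomial `G` is transversally increasing and has only a straight branch. -/
structure StripLimit (G : MvPolynomial (Fin 2) ℝ) (A n t v v' : Plane) (δ : ℝ) : Prop where
  pos : ∀ x ∈ Set.Icc (0 : ℝ) 1, ∀ y ∈ Set.Icc (-δ) δ, 0 < ev (dirD n G) (A + x • t + y • n)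
  pos_v : ∀ x ∈ Set.Icc (0 : ℝ) 1, ∀ y ∈ Set.Icc (-δ) δ, 0 < ev (dirD v G) (A + x • t + y • n)
  pos_v' : ∀ x ∈ Set.Icc (0 : ℝ) 1, ∀ y ∈ Set.Icc (-δ) δ, 0 < ev (dirD v' G) (A + x • t + y • n)
  top : ∀ x ∈ Set.Icc (0 : ℝ) 1, 0 < ev G (A + x • t + δ • n)
  bot : ∀ x ∈ Set.Icc (0 : ℝ) 1, ev G (A + x • t + (-δ) • n) < 0
  straight : ∀ x ∈ Set.Icc (0 : ℝ) 1, ∀ y ∈ Set.Icc (-δ) δ, ev G (A + x • t + y • n) = 0 →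
    0 < gradSq G (A + x • t + y • n) ∧ curv G (A + x • t + y • n) = 0

/-- In the strip, `F` is close to such a limit polynomial. -/
structure StripNear (F : MvPolynomial (Fin 2) ℝ) (A n t v v' : Plane) (δ ε : ℝ) : Prop where
  pos : ∀ x ∈ Set.Icc (0 : ℝ) 1, ∀ y ∈ Set.Icc (-δ) δ, 0 < ev (dirD n F) (A + x • t + y • n)
  pos_v : ∀ x ∈ Set.Icc (0 : ℝ) 1, ∀ y ∈ Set.Icc (-δ) δ, 0 < ev (dirD v F) (A + x • t + y • n)
  pos_v' : ∀ x ∈ Set.Icc (0 : ℝ) 1, ∀ y ∈ Set.Icc (-δ) δ, 0 < ev (dirD v' F) (A + x • t + y • n)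
  top : ∀ x ∈ Set.Icc (0 : ℝ) 1, 0 < ev F (A + x • t + δ • n)
  bot : ∀ x ∈ Set.Icc (0 : ℝ) 1, ev F (A + x • t + (-δ) • n) < 0
  curv_lt : ∀ x ∈ Set.Icc (0 : ℝ) 1, ∀ y ∈ Set.Icc (-δ) δ, ev F (A + x • t + y • n) = 0 →
    |curv F (A + x • t + y • n)| < ε

theorem continuous_strip (A n t : Plane) : Continuous fun z : ℝ × ℝ => A + z.1 • t + z.2 • n := by
  fun_prop

theorem StripLimit.eventually_near {ι : Type*} {l : Filter ι} {F : ι → MvPolynomial (Fin 2) ℝ}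
    {G : MvPolynomial (Fin 2) ℝ} {A n t v v' : Plane} {δ ε : ℝ} (h : StripLimit G A n t v v' δ)
    (hF : PolyTendsto l F G) (hε : 0 < ε) : ∀ᶠ i in l, StripNear (F i) A n t v v' δ ε := by
  have hK : IsCompact ((fun z : ℝ × ℝ => A + z.1 • t + z.2 • n) ''
      (Set.Icc 0 1 ×ˢ Set.Icc (-δ) δ)) :=
    (isCompact_Icc.prod isCompact_Icc).image (continuous_strip A n t)
  have hK' (y : ℝ) : IsCompact ((fun x : ℝ => A + x • t + y • n) '' Set.Icc 0 1) :=
    isCompact_Icc.image (by fun_prop)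
  have e1 := (hF.dirD n).eventually_pos hK
    (by rintro _ ⟨⟨x, y⟩, ⟨hx, hy⟩, rfl⟩; exact h.pos x hx y hy)
  have e2 := (hF.dirD v).eventually_pos hK
    (by rintro _ ⟨⟨x, y⟩, ⟨hx, hy⟩, rfl⟩; exact h.pos_v x hx y hy)
  have e3 := (hF.dirD v').eventually_pos hK
    (by rintro _ ⟨⟨x, y⟩, ⟨hx, hy⟩, rfl⟩; exact h.pos_v' x hx y hy)
  have e4 := hF.eventually_pos (hK' δ) (by rintro _ ⟨x, hx, rfl⟩; exact h.top x hx)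
  have e5 := hF.eventually_neg (hK' (-δ)) (by rintro _ ⟨x, hx, rfl⟩; exact h.bot x hx)
  have e6 := hF.eventually_curv_lt hK
    (by rintro _ ⟨⟨x, y⟩, ⟨hx, hy⟩, rfl⟩; exact h.straight x hx y hy) hε
  filter_upwards [e1, e2, e3, e4, e5, e6] with i g1 g2 g3 g4 g5 g6
  exact ⟨fun x hx y hy => g1 _ ⟨(x, y), ⟨hx, hy⟩, rfl⟩,
    fun x hx y hy => g2 _ ⟨(x, y), ⟨hx, hy⟩, rfl⟩,
    fun x hx y hy => g3 _ ⟨(x, y), ⟨hx, hy⟩, rfl⟩, fun x hx => g4 _ ⟨x, hx, rfl⟩,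
    fun x hx => g5 _ ⟨x, hx, rfl⟩, fun x hx y hy h0 => (g6 _ ⟨(x, y), ⟨hx, hy⟩, rfl⟩ h0).2⟩

/-- Across the strip `F` increases from a negative to a positive value, so every transversal
contains exactly one zero. -/
theorem StripNear.exists_graph {F : MvPolynomial (Fin 2) ℝ} {A n t v v' : Plane} {δ ε : ℝ}
    (h : StripNear F A n t v v' δ ε) (hδ : 0 < δ) (hdet : det₂ t n ≠ 0) :
    ∃ y, GraphOn F A n t (-δ) δ (Set.Icc 0 1) y := by
  have hex : ∀ x, ∃ y, x ∈ Set.Icc (0 : ℝ) 1 → y ∈ Set.Ioo (-δ) δ ∧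
      ev F (A + x • t + y • n) = 0 ∧
        ∀ z ∈ Set.Icc (-δ) δ, ev F (A + x • t + z • n) = 0 → z = y := by
    intro x
    by_cases hx : x ∈ Set.Icc (0 : ℝ) 1
    · have hd := fun y => hasDerivAt_ev_line F (A + x • t) n y
      have hmono := strictMonoOn_of_hasDerivAt_pos hd (convex_Icc (-δ) δ) (h.pos x hx)
      have hle : -δ ≤ δ := by linarith
      obtain ⟨y, hy, hy0⟩ := intermediate_value_Ioo hle
        (fun z _ => (hd z).continuousAt.continuousWithinAt) ⟨h.bot x hx, h.top x hx⟩
      refine ⟨y, fun _ => ⟨hy, hy0, fun z hz hz0 => hmono.injOn hz ⟨hy.1.le, hy.2.le⟩ ?_⟩⟩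
      simp only at hy0 ⊢
      rw [hy0, hz0]
    · exact ⟨0, fun h => absurd h hx⟩
  choose y hy using hex
  exact ⟨y, hdet, fun x hx => (hy x hx).1, fun x hx => (hy x hx).2.1,
    fun x hx => h.pos x hx _ ⟨(hy x hx).1.1.le, (hy x hx).1.2.le⟩,
    fun x hx z hz h0 _ => (hy x hx).2.2 z hz h0⟩

theorem eventually_strip_subset {A n t : Plane} {S : Set Plane} (hS : IsOpen S)
    (h : ∀ x ∈ Set.Icc (0 : ℝ) 1, A + x • t ∈ S) :
    ∀ᶠ δ in 𝓝[>] (0 : ℝ), ∀ x ∈ Set.Icc (0 : ℝ) 1, ∀ y ∈ Set.Icc (-δ) δ,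
      A + x • t + y • n ∈ S := by
  have h1 : ∀ᶠ y in 𝓝 (0 : ℝ), ∀ x ∈ Set.Icc (0 : ℝ) 1, A + x • t + y • n ∈ S := by
    apply isCompact_Icc.eventually_forall_of_forall_eventually
    intro x hx
    have hc : Continuous fun z : ℝ × ℝ => A + z.2 • t + z.1 • n := by fun_prop
    apply hc.continuousAt.eventually_mem
    apply hS.mem_nhds
    simpa using h x hx
  obtain ⟨e, he, hb⟩ := Metric.eventually_nhds_iff.1 h1
  filter_upwards [Ioo_mem_nhdsGT he] with δ hδ x hx y hy
  refine hb ?_ x hx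
  rw [Real.dist_eq, sub_zero]
  exact (abs_le.2 hy).trans_lt hδ.2

/-- Two corners which face each other along a common edge, on the same side of it. -/
structure Edge (c c' : Corner) : Prop where
  U_eq : c'.U = c.U
  V_pos : 0 < ev c.V c'.P
  V'_pos : 0 < ev c'.V c.P
  pos : ∀ z ∈ openSegment ℝ c.P c'.P, 0 < ev (c.V * c.H) z

namespace Edge

variable {c c' : Corner} {r δ ε : ℝ}

/-- The length of the edge in units of the side of the first corner. -/
def len (c c' : Corner) : ℝ := ev c.V c'.P

/-- The ratio of the units of length of the two corners. -/
def ratio (c c' : Corner) : ℝ := ev c.V c'.P / ev c'.V c.P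

/-- The slope of the transversal side of the first corner with respect to the second one. -/
def slope (c c' : Corner) : ℝ := - ev c'.V (c'.P + c.p)

theorem exists_coord (c : Corner) (x : Plane) :
    x = c.P + ev c.U x • c.p + ev c.V x • c.q := by
  have h := frame_expand (P := c.P) (a := c.q) (b := c.p) c.det x
  conv_lhs => rw [← h]
  conv_rhs => rw [← h]
  rw [c.evU, c.evV]

theorem P_eq (h : Edge c c') : c'.P = c.P + len c c' • c.q := by
  have h1 := exists_coord c c'.P
  have h2 := c'.evU 0 0
  rw [h.U_eq] at h2
  simp only [zero_smul, add_zero] at h2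
  rw [h2, zero_smul, add_zero] at h1
  exact h1

theorem q_eq (h : Edge c c') : c'.q = -(ratio c c' • c.q) := by
  have h1 := h.P_eq
  have h2 := exists_coord c' c.P
  have h3 := c.evU 0 0
  rw [← h.U_eq] at h3
  simp only [zero_smul, add_zero] at h3
  rw [h3, zero_smul, add_zero] at h2
  have h4 := h.V'_pos.ne'
  have h5 : ev c'.V c.P • c'.q = -(len c c' • c.q) := by
    rw [h1] at h2
    have h6 : (0 : Plane) = len c c' • c.q + ev c'.V c.P • c'.q := by
      apply add_left_cancel (a := c.P)
      rw [add_zero, ← add_assoc]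
      exact h2
    rw [eq_neg_iff_add_eq_zero, h6]; abel
  rw [ratio, div_eq_inv_mul, mul_smul]
  change _ = -((ev c'.V c.P)⁻¹ • len c c' • c.q)
  rw [← smul_neg, ← h5, smul_smul, inv_mul_cancel₀ h4, one_smul]

theorem p_eq (h : Edge c c') : c'.p = c.p + slope c c' • c'.q := by
  have h1 := exists_coord c' (c'.P + c.p)
  have h2 : ev c'.U (c'.P + c.p) = 1 := by
    have h3 := c.evU 1 (len c c')
    rw [h.U_eq, h.P_eq, add_right_comm]
    simpa using h3
  rw [h2, one_smul, add_assoc] at h1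
  have h3 := add_left_cancel h1
  rw [h3, slope, neg_smul]; abel

theorem ratio_pos (h : Edge c c') : 0 < ratio c c' := div_pos h.V_pos h.V'_pos

/-- The size `r` is small with respect to the edge. -/
structure Fits (c c' : Corner) (r : ℝ) : Prop where
  pos : 0 < r
  le : 5 / 2 * r * (1 + ratio c c') ≤ len c c'

theorem eventually_fits (h : Edge c c') : ∀ᶠ r in 𝓝[>] (0 : ℝ), Fits c c' r := by
  have h1 : Continuous fun r : ℝ => 5 / 2 * r * (1 + ratio c c') := by fun_prop
  have h2 : ∀ᶠ r in 𝓝 (0 : ℝ), 5 / 2 * r * (1 + ratio c c') < len c c' := by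
    apply h1.continuousAt.eventually_lt_const
    simpa [len] using h.V_pos
  filter_upwards [nhdsWithin_le_nhds h2, self_mem_nhdsWithin] with r h3 h4
  exact ⟨h4, h3.le⟩

/-- The first point of the strip. -/
def start (c : Corner) (r : ℝ) : Plane := c.P + (3 / 2 * r) • c.q

/-- The direction of the strip. -/
def along (c c' : Corner) (r : ℝ) : Plane := start c' r - start c r

theorem along_eq (h : Edge c c') (r : ℝ) :
    along c c' r = (len c c' - 3 / 2 * r * (1 + ratio c c')) • c.q := by
  rw [along, start, start, h.q_eq, h.P_eq]
  ext i; simp; ring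

/-- `5 / 2 = 3 / 2 + 1`: after `3 / 2 * r` has been removed at each end, the strip is still at least
`r` long in the unit of either corner. Corner arcs ending at distance about `2 * r` therefore end
over the strip. -/
theorem Fits.len_pos (hf : Fits c c' r) (h : Edge c c') :
    0 < len c c' - 3 / 2 * r * (1 + ratio c c') ∧ r ≤ len c c' - 3 / 2 * r * (1 + ratio c c') ∧
      ratio c c' * r ≤ len c c' - 3 / 2 * r * (1 + ratio c c') := by
  have := hf.le
  have h1 := hf.pos
  have h2 := h.ratio_pos
  have h3 := mul_pos h1 h2
  refine ⟨?_, ?_, ?_⟩ <;> nlinarith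

theorem q_eq_along (h : Edge c c') (hf : Fits c c' r) :
    c.q = (1 / (len c c' - 3 / 2 * r * (1 + ratio c c'))) • along c c' r := by
  rw [h.along_eq, smul_smul, one_div, inv_mul_cancel₀ (hf.len_pos h).1.ne', one_smul]

theorem q'_eq_along (h : Edge c c') (hf : Fits c c' r) :
    c'.q = (ratio c c' / (len c c' - 3 / 2 * r * (1 + ratio c c'))) • (-along c c' r) := by
  rw [h.along_eq, smul_neg, smul_smul, div_mul_cancel₀ _ (hf.len_pos h).1.ne', h.q_eq]

theorem det_ne_zero (h : Edge c c') (hf : Fits c c' r) : det₂ (along c c' r) c.p ≠ 0 := by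
  have h1 := c.det
  have h2 := (hf.len_pos h).1
  rw [h.along_eq]
  have : det₂ ((len c c' - 3 / 2 * r * (1 + ratio c c')) • c.q) c.p
      = -((len c c' - 3 / 2 * r * (1 + ratio c c')) * det₂ c.p c.q) := by
    simp [det₂]; ring
  rw [this]
  exact neg_ne_zero.2 (mul_ne_zero h2.ne' h1)

theorem strip_mem (h : Edge c c') (hf : Fits c c' r) {x : ℝ} (hx : x ∈ Set.Icc (0 : ℝ) 1) :
    start c r + x • along c c' r ∈ openSegment ℝ c.P c'.P := by
  have h1 := hf.len_pos h
  have h2 := hf.pos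
  have h3 : 0 < len c c' := h.V_pos
  have h4 := hf.le
  have h5 := mul_pos h2 h.ratio_pos
  rw [openSegment_eq_image']
  refine ⟨(3 / 2 * r + x * (len c c' - 3 / 2 * r * (1 + ratio c c'))) / len c c', ⟨?_, ?_⟩, ?_⟩
  · apply div_pos _ h3
    have := mul_nonneg hx.1 h1.1.le
    linarith
  · rw [div_lt_one h3]
    have := mul_le_mul_of_nonneg_right hx.2 h1.1.le
    nlinarith
  · beta_reduce
    rw [h.along_eq, h.P_eq, start, add_sub_cancel_left, smul_smul, div_mul_cancel₀ _ h3.ne',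
      smul_smul, add_smul, add_assoc]

theorem ev_U_strip (h : Edge c c') (r x y : ℝ) :
    ev c.U (start c r + x • along c c' r + y • c.p) = y := by
  rw [h.along_eq, start]
  have := c.evU y (3 / 2 * r + x * (len c c' - 3 / 2 * r * (1 + ratio c c')))
  convert this using 2
  ext i; simp; ring

/-- On the edge `U = 0` and `V * H > 0`, so in every direction along which `U` has derivative `1`
the derivative of `F₀ = U * (V * H)` is positive. These directions include `p` and the axes of both
corners. By compactness everything persists on a thin strip. -/
theorem eventually_stripLimit (h : Edge c c') (hf : Fits c c' r) :
    ∀ᶠ δ in 𝓝[>] (0 : ℝ), StripLimit c.F₀ (start c r) c.p (along c c' r) c.a c'.a δ := by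
  have hG : c.F₀ = c.U * (c.V * c.H) := mul_assoc _ _ _
  have hseg : ∀ x ∈ Set.Icc (0 : ℝ) 1,
      0 < ev (c.V * c.H) (start c r + x • along c c' r) := fun x hx => h.pos _ (h.strip_mem hf hx)
  have hdir : ∀ v : Plane, dirD v c.U = 1 → ∀ᶠ δ in 𝓝[>] (0 : ℝ), ∀ x ∈ Set.Icc (0 : ℝ) 1,
      ∀ y ∈ Set.Icc (-δ) δ,
        0 < ev (dirD v c.F₀) (start c r + x • along c c' r + y • c.p) := by
    intro v hv
    refine eventually_strip_subset (S := {z | 0 < ev (dirD v c.F₀) z})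
      (isOpen_lt continuous_const (continuous_ev _)) fun x hx => ?_
    have h0 := h.ev_U_strip r x 0
    rw [zero_smul, add_zero] at h0
    have := hseg x hx
    change 0 < ev (dirD v c.F₀) _
    rw [hG, dirD_mul, hv, ev_add, one_mul, ev_mul c.U, h0, zero_mul, add_zero]
    exact this
  have ha : dirD c.a c.U = 1 := by rw [Corner.dirD_a, c.dpU, c.dqU, add_zero]
  have ha' : dirD c'.a c.U = 1 := by rw [Corner.dirD_a, ← h.U_eq, c'.dpU, c'.dqU, add_zero]
  filter_upwards [hdir _ c.dpU, hdir _ ha, hdir _ ha', self_mem_nhdsWithin,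
    eventually_strip_subset (n := c.p) (S := {z | 0 < ev (c.V * c.H) z})
      (isOpen_lt continuous_const (continuous_ev _)) hseg] with δ h1 h2 h3 h4 h5
  have h4 : 0 < δ := h4
  have hev (x y : ℝ) : ev c.F₀ (start c r + x • along c c' r + y • c.p)
      = y * ev (c.V * c.H) (start c r + x • along c c' r + y • c.p) := by
    rw [hG, ev_mul, h.ev_U_strip]
  refine ⟨h1, h2, h3, fun x hx => ?_, fun x hx => ?_, fun x hx y hy h0 => ?_⟩
  · rw [hev]
    exact mul_pos h4 (h5 x hx δ ⟨by linarith, le_rfl⟩)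
  · rw [hev]
    exact mul_neg_of_neg_of_pos (by linarith) (h5 x hx (-δ) ⟨le_rfl, by linarith⟩)
  · have h6 : 0 < ev (c.V * c.H) (start c r + x • along c c' r + y • c.p) := h5 x hx y hy
    rw [hev] at h0
    have hy0 := (mul_eq_zero.1 h0).resolve_right h6.ne'
    rw [hG]
    refine gradSq_pos_and_curv_eq_zero c.pderivU.1 c.pderivU.2 ?_ ?_ h6.ne'
    · have hdet := c.det
      by_contra hn
      simp only [not_or, not_not, div_eq_zero_iff, hdet, or_false, neg_eq_zero] at hn
      apply hdet; rw [det₂, hn.1, hn.2]; ring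
    · rw [h.ev_U_strip, hy0]

end Edge

/-! ### The curve along an edge -/

theorem Corner.IsArc.exists_start {c : Corner} {F : MvPolynomial (Fin 2) ℝ} {r δ ε w₁ : ℝ}
    {s : ℝ → ℝ} (h : c.IsArc r δ ε F s w₁) (hr : 0 < r) :
    ∃ θ, |θ| < δ ∧ GraphOn.param c.P c.a c.b s (-r) = c.P + θ • c.p + (2 * r + θ) • c.q := by
  have h1 := h.close (-r) ⟨le_rfl, by linarith⟩ (by rw [abs_neg, abs_of_pos hr]; linarith)
  rw [abs_neg, abs_of_pos hr] at h1
  refine ⟨s (-r) - r, h1, ?_⟩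
  ext i; simp [GraphOn.param, Corner.a, Corner.b]; ring

theorem Corner.IsArc.lt_ev_U {c : Corner} {F : MvPolynomial (Fin 2) ℝ} {r δ ε w₁ : ℝ}
    {s : ℝ → ℝ} (h : c.IsArc r δ ε F s w₁) (hr : 0 < r) (hδ : δ ≤ r / 4) :
    r < ev c.U (GraphOn.param c.P c.a c.b s r) := by
  have h1 := h.close r ⟨by linarith, le_rfl⟩ (by rw [abs_of_pos hr]; linarith)
  rw [abs_of_pos hr] at h1
  have h2 := c.pt_eq r (s r)
  rw [Corner.pt] at h2
  rw [GraphOn.param, h2, c.evU]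
  linarith [(abs_lt.1 h1).1]

theorem Corner.IsArc.param_mem_box {c : Corner} {F : MvPolynomial (Fin 2) ℝ} {r δ ε w₁ : ℝ}
    {s : ℝ → ℝ} (h : c.IsArc r δ ε F s w₁) (hr : 0 < r) {w : ℝ} (hw : w ∈ Set.Icc (-r) r) :
    GraphOn.param c.P c.a c.b s w ∈ c.box r :=
  c.pt_mem_box ⟨by linarith [hw.1], by linarith [hw.2]⟩
    ⟨(h.graph.mem w hw).1.le, (h.graph.mem w hw).2.le⟩

namespace Edge

variable {c c' : Corner} {r δ ε w₁ w₁' : ℝ} {F : MvPolynomial (Fin 2) ℝ} {s s' y : ℝ → ℝ}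

/-- The second corner is handled by running through the strip backwards, where the transversal
direction `c.p` is oblique with respect to the sides of `c'`; `slope` measures this. -/
theorem start_near (h : Edge c c') (hf : Fits c c' r)
    (hy : GraphOn F (start c r) c.p (along c c' r) (-δ) δ (Set.Icc 0 1) y)
    (hS : StripNear F (start c r) c.p (along c c' r) c.a c'.a δ ε)
    (hν : δ * (1 + |slope c c'|) ≤ r / 4) (hδ : 0 < δ) {θ θ' : ℝ} (hθ : |θ| < δ)
    (hθ' : |θ'| < δ) :
    (ev F (c.P + θ • c.p + (2 * r + θ') • c.q) = 0 → ∃ v ∈ Set.Ioo (0 : ℝ) 1,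
      c.P + θ • c.p + (2 * r + θ') • c.q = GraphOn.param (start c r) c.p (along c c' r) y v) ∧
    (ev F (c'.P + θ • c'.p + (2 * r + θ') • c'.q) = 0 → ∃ v ∈ Set.Ioo (0 : ℝ) 1,
      c'.P + θ • c'.p + (2 * r + θ') • c'.q =
        GraphOn.param (start c r) c.p (along c c' r) y v) := by
  obtain ⟨hl, hl1, hl2⟩ := hf.len_pos h
  have hr := hf.pos
  have hδ0 : δ * (1 + |(0 : ℝ)|) ≤ r / 4 := by
    have := mul_nonneg hδ.le (abs_nonneg (slope c c'))
    rw [abs_zero]; linarith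
  constructor
  · intro h0
    refine hy.exists_eq_of_near (ν := 0) hS.pos rfl (h.q_eq_along hf) (by simp) (by positivity)
      ?_ hδ0 hθ hθ' rfl h0
    rwa [one_div, inv_mul_le_iff₀ hl, mul_one]
  · intro h0
    have hy' := hy.reverse
    have hA : start c r + along c c' r = start c' r := by rw [along]; abel
    rw [hA] at hy'
    obtain ⟨v, hv, hve⟩ := hy'.exists_eq_of_near (fun x hx z hz => by
        have := hS.pos (1 - x) ⟨by linarith [hx.2], by linarith [hx.1]⟩ z hz
        convert this using 2
        rw [← hA]; ext i; simp; ring) rfl (h.q'_eq_along hf) h.p_eq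
      (div_pos h.ratio_pos hl) (by rwa [div_mul_eq_mul_div, div_le_one hl]) hν hθ hθ' rfl h0
    refine ⟨1 - v, ⟨by linarith [hv.2], by linarith [hv.1]⟩, ?_⟩
    rw [hve, ← hA, GraphOn.reverse_param]

/-- Along an edge whose end nodes are resolved on the same side, there is an extremum of the
curvature between the extrema at the ends. -/
theorem exists_mem_curvExtrema (h : Edge c c') (hf : Fits c c' r) (hδ : 0 < δ)
    (hν : δ * (1 + |slope c c'|) ≤ r / 4)
    (hS : StripNear F (start c r) c.p (along c c' r) c.a c'.a δ ε)
    (hc : c.IsArc r δ ε F s w₁) (hc' : c'.IsArc r δ ε F s' w₁') :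
    ∃ X₀ : Set Plane,
      (∀ p ∈ X₀, (∃ w ∈ Set.Ico (-r) w₁, p = GraphOn.param c.P c.a c.b s w) ∨
        (∃ w ∈ Set.Ico (-r) w₁', p = GraphOn.param c'.P c'.a c'.b s' w) ∨ |curv F p| < ε) ∧
      GraphOn.param c.P c.a c.b s w₁ ∈ closure X₀ ∧
      GraphOn.param c'.P c'.a c'.b s' w₁' ∈ closure X₀ ∧
      X₀ ⊆ realCurve F ∧ IsPreconnected X₀ ∧ (∀ p ∈ X₀, X₀ ∈ 𝓝[realCurve F] p) ∧
      IsCompact (X₀ ∪ {GraphOn.param c.P c.a c.b s w₁, GraphOn.param c'.P c'.a c'.b s' w₁'}) ∧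
      ∃ z ∈ X₀, z ∈ curvExtrema F := by
  have hr := hf.pos
  obtain ⟨y, hy⟩ := hS.exists_graph hδ (h.det_ne_zero hf)
  obtain ⟨θ, hθ, e⟩ := hc.exists_start hr
  obtain ⟨θ', hθ', e'⟩ := hc'.exists_start hr
  have hδ0 : δ * (1 + |(0 : ℝ)|) ≤ r / 4 := by
    have := mul_nonneg hδ.le (abs_nonneg (slope c c'))
    rw [abs_zero]; linarith
  have hA : start c r + along c c' r = start c' r := by rw [along]; abel
  have hrI : -r ∈ Set.Icc (-r) r := ⟨le_rfl, by linarith⟩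
  have h01 : (0 : ℝ) ∈ Set.Icc (0 : ℝ) 1 := ⟨le_rfl, zero_le_one⟩
  have h11 : (1 : ℝ) ∈ Set.Icc (0 : ℝ) 1 := ⟨zero_le_one, le_rfl⟩
  have hyI : ∀ x ∈ Set.Icc (0 : ℝ) 1, y x ∈ Set.Icc (-δ) δ := fun x hx =>
    ⟨(hy.mem x hx).1.le, (hy.mem x hx).2.le⟩
  have hcurv : ∀ x ∈ Set.Icc (0 : ℝ) 1,
      |curv F (GraphOn.param (start c r) c.p (along c c' r) y x)| < ε := fun x hx =>
    hS.curv_lt x hx _ (hyI x hx) (hy.zero x hx)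
  have hy' := hy.reverse
  rw [hA] at hy'
  obtain ⟨X₀, hX, hX1, hX2, hX3, hX4, hX5⟩ := exists_mem_curvExtrema_of_joined_arcs (ε := ε)
    (w₁ := w₁) (w₁' := w₁') hc.graph hy hc'.graph
    ⟨by linarith [hc.mem.1], by linarith [hc.mem.2]⟩
    ⟨by linarith [hc'.mem.1], by linarith [hc'.mem.2]⟩
    (by
      rw [e]
      exact (h.start_near hf hy hS hν hδ hθ hθ).1 (by rw [← e]; exact hc.graph.zero _ hrI))
    (hc.exists_eq_of_near hy (hS.pos_v 0 h01 _ (hyI 0 h01)) rfl (ν := 0) (by simp) hr hδ0)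
    (by
      rw [e']
      exact (h.start_near hf hy hS hν hδ hθ' hθ').2 (by rw [← e']; exact hc'.graph.zero _ hrI))
    (by
      have hp : GraphOn.param (start c' r) c.p (-along c c' r) (fun x => y (1 - x)) 0
          = GraphOn.param (start c r) c.p (along c c' r) y 1 := by
        rw [← hA, GraphOn.reverse_param, sub_zero]
      rw [← hp]
      exact hc'.exists_eq_of_near hy' (by rw [hp]; exact hS.pos_v' 1 h11 _ (hyI 1 h11)) rfl h.p_eq
        hr hν)
    (fun x hx => (neg_le_abs _).trans_lt (hcurv x hx)) hc.big hc'.big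
  have hcl : ∀ {d : Corner} {s : ℝ → ℝ} {w : ℝ}, d.IsArc r δ ε F s w →
      GraphOn.param d.P d.a d.b s w ∈ closure (GraphOn.param d.P d.a d.b s '' Set.Ico (-r) w) := by
    intro d s w hd
    have hw : -r < w := by linarith [hd.mem.1]
    have hsub : Set.Icc (-r) w ⊆ Set.Icc (-r) r :=
      Set.Icc_subset_Icc le_rfl (by linarith [hd.mem.2])
    have h1 : w ∈ closure (Set.Ico (-r) w) := by
      rw [closure_Ico hw.ne]; exact ⟨hw.le, le_rfl⟩
    have h2 := (hd.graph.continuousOn_param.mono hsub) w ⟨hw.le, le_rfl⟩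
    exact (h2.mono Set.Ico_subset_Icc_self).mem_closure_image h1
  refine ⟨X₀, fun p hp => ?_, ?_, ?_, hX1, hX2, hX3, hX4, hX5⟩
  · rw [hX] at hp
    rcases hp with (⟨w, hw, rfl⟩ | ⟨w, hw, rfl⟩) | ⟨w, hw, rfl⟩
    · exact Or.inl ⟨w, hw, rfl⟩
    · exact Or.inr (Or.inr (hcurv w hw))
    · exact Or.inr (Or.inl ⟨w, hw, rfl⟩)
  · rw [hX]
    exact closure_mono (fun x hx => Or.inl (Or.inl hx)) (hcl hc)
  · rw [hX]
    exact closure_mono (fun x hx => Or.inr hx) (hcl hc')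

/-- Along an edge whose end nodes are resolved on different sides, the curve crosses from one side
to the other. -/
theorem exists_crossing (h : Edge c c') (hf : Fits c c' r) (hδ : 0 < δ)
    (hν : δ * (1 + |slope c c'|) ≤ r / 4)
    (hS : StripNear F (start c r) c.p (along c c' r) c.a c'.a δ ε)
    (hc : c.IsArc r δ ε F s w₁) (hc' : (c'.signed (-1) 1).IsArc r δ ε (-F) s' w₁') :
    ∃ K ⊆ realCurve F, IsPreconnected K ∧ (∀ p ∈ K, p ∈ c.box r ∨ p ∈ (c'.signed (-1) 1).box r ∨
        ∃ x ∈ Set.Icc (0 : ℝ) 1, ∃ y ∈ Set.Icc (-δ) δ,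
          p = start c r + x • along c c' r + y • c.p) ∧
      (∃ p ∈ K, r < ev c.U p) ∧ ∃ p ∈ K, ev c.U p < -r := by
  have hr := hf.pos
  obtain ⟨y, hy⟩ := hS.exists_graph hδ (h.det_ne_zero hf)
  obtain ⟨θ, hθ, e⟩ := hc.exists_start hr
  obtain ⟨θ', hθ', e'⟩ := hc'.exists_start hr
  have hδr : δ ≤ r / 4 := by
    have := mul_nonneg hδ.le (abs_nonneg (slope c c'))
    linarith
  have hrI : -r ∈ Set.Icc (-r) r := ⟨le_rfl, by linarith⟩
  have hrI' : r ∈ Set.Icc (-r) r := ⟨by linarith, le_rfl⟩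
  have e'' : GraphOn.param (c'.signed (-1) 1).P (c'.signed (-1) 1).a (c'.signed (-1) 1).b s' (-r)
      = c'.P + (-θ') • c'.p + (2 * r + θ') • c'.q := by
    rw [e']; ext i; simp [Corner.signed]
  have hz : ∀ w ∈ Set.Icc (-r) r, ev F (GraphOn.param (c'.signed (-1) 1).P
      (c'.signed (-1) 1).a (c'.signed (-1) 1).b s' w) = 0 := fun w hw => by
    have := hc'.graph.zero w hw
    rwa [ev_neg, neg_eq_zero] at this
  obtain ⟨v, hv, hve⟩ := (h.start_near hf hy hS hν hδ hθ hθ).1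
    (by rw [← e]; exact hc.graph.zero _ hrI)
  obtain ⟨v', hv', hve'⟩ := (h.start_near hf hy hS hν hδ (θ := -θ') (by rwa [abs_neg]) hθ').2
    (by rw [← e'']; exact hz _ hrI)
  -- The connected set is a full corner arc, the graph along the edge, and a full corner arc on the
  -- other side. At its far ends, with parameter `r`, the value of `U` exceeds `r` in absolute
  -- value, with opposite signs.
  refine ⟨GraphOn.param c.P c.a c.b s '' Set.Icc (-r) r ∪
    GraphOn.param (start c r) c.p (along c c' r) y '' Set.Icc 0 1 ∪
    GraphOn.param (c'.signed (-1) 1).P (c'.signed (-1) 1).a (c'.signed (-1) 1).b s' ''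
      Set.Icc (-r) r, ?_, ?_, ?_, ?_, ?_⟩
  · rintro _ ((⟨w, hw, rfl⟩ | ⟨w, hw, rfl⟩) | ⟨w, hw, rfl⟩)
    · exact hc.graph.zero w hw
    · exact hy.zero w hw
    · exact hz w hw
  · refine IsPreconnected.union' ⟨_, Or.inr ⟨v', ⟨hv'.1.le, hv'.2.le⟩, rfl⟩,
      ⟨-r, hrI, e''.trans hve'⟩⟩ (IsPreconnected.union' ⟨_, ⟨-r, hrI, e.trans hve⟩,
      ⟨v, ⟨hv.1.le, hv.2.le⟩, rfl⟩⟩ ?_ ?_) ?_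
    · exact isPreconnected_Icc.image _ hc.graph.continuousOn_param
    · exact isPreconnected_Icc.image _ hy.continuousOn_param
    · exact isPreconnected_Icc.image _ hc'.graph.continuousOn_param
  · rintro _ ((⟨w, hw, rfl⟩ | ⟨w, hw, rfl⟩) | ⟨w, hw, rfl⟩)
    · exact Or.inl (hc.param_mem_box hr hw)
    · exact Or.inr (Or.inr ⟨w, hw, y w, ⟨(hy.mem w hw).1.le, (hy.mem w hw).2.le⟩, rfl⟩)
    · exact Or.inr (Or.inl (hc'.param_mem_box hr hw))
  · exact ⟨_, Or.inl (Or.inl ⟨r, hrI', rfl⟩), hc.lt_ev_U hr hδr⟩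
  · refine ⟨_, Or.inr ⟨r, hrI', rfl⟩, ?_⟩
    have := hc'.lt_ev_U hr hδr
    have hU : (c'.signed (-1) 1).U = -c.U := by simp [Corner.signed, h.U_eq]
    rw [hU, ev_neg] at this
    linarith

end Edge

end

section



/-! ### Corners of a generic arrangement -/

theorem ev_linePoly (l : LineEq) (p : Plane) : ev l.poly p = l.a * p 0 + l.b * p 1 + l.c := by
  simp [LineEq.poly]

theorem dirD_linePoly (l : LineEq) (v : Plane) : dirD v l.poly = C (v 0 * l.a + v 1 * l.b) := by
  simp [dirD, LineEq.poly, MvPolynomial.pderiv_X]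

theorem ev_units_smul (σ : ℤˣ) (F : MvPolynomial (Fin 2) ℝ) (p : Plane) :
    ev (σ • F) p = σ • ev F p := by
  rcases Int.units_eq_one_or σ with rfl | rfl <;> simp

/-- The sign of a real number, with the value `-1` at zero. -/
def unitSign (x : ℝ) : ℤˣ := if 0 < x then 1 else -1

theorem unitSign_smul_pos {x : ℝ} (hx : x ≠ 0) : 0 < unitSign x • x := by
  rw [unitSign]
  split_ifs with h
  · simpa using h
  · simpa using lt_of_le_of_ne (not_lt.1 h) hx

variable {d : ℕ} {L : Fin d → LineEq}

/-- The intersection point of two lines of an arrangement. -/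
def node (L : Fin d → LineEq) (j k : Fin d) : Plane :=
  !₂[((L j).b * (L k).c - (L k).b * (L j).c) / ((L j).a * (L k).b - (L k).a * (L j).b),
    ((L j).c * (L k).a - (L k).c * (L j).a) / ((L j).a * (L k).b - (L k).a * (L j).b)]

theorem node_comm (L : Fin d → LineEq) (j k : Fin d) : node L j k = node L k j := by
  have h : (L k).a * (L j).b - (L j).a * (L k).b = -((L j).a * (L k).b - (L k).a * (L j).b) := by
    ring
  ext i
  fin_cases i <;> simp only [node, h, div_neg, ← neg_div] <;> simp

theorem det_lines_ne_zero (hL : IsGenericArrangement L) {j k : Fin d} (h : j ≠ k) :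
    (L j).a * (L k).b - (L k).a * (L j).b ≠ 0 := sub_ne_zero.2 (hL.not_parallel j k h)

theorem ev_node_left (hL : IsGenericArrangement L) {j k : Fin d} (h : j ≠ k) :
    ev (L j).poly (node L j k) = 0 := by
  have := det_lines_ne_zero hL h
  rw [ev_linePoly, node]
  simp only [Matrix.cons_val_zero, Matrix.cons_val_one]
  generalize hD : (L j).a * (L k).b - (L k).a * (L j).b = D at this ⊢
  field_simp
  linear_combination -(L j).c * hD

theorem ev_node_right (hL : IsGenericArrangement L) {j k : Fin d} (h : j ≠ k) :
    ev (L k).poly (node L j k) = 0 := by rw [node_comm]; exact ev_node_left hL h.symm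

theorem eq_node (hL : IsGenericArrangement L) {j k : Fin d} (h : j ≠ k) {p : Plane}
    (h1 : ev (L j).poly p = 0) (h2 : ev (L k).poly p = 0) : p = node L j k := by
  have := det_lines_ne_zero hL h
  rw [ev_linePoly] at h1 h2
  ext i
  fin_cases i <;> simp only [node] <;>
    simp <;> rw [eq_div_iff this]
  · linear_combination (L k).b * h1 - (L j).b * h2
  · linear_combination (L j).a * h2 - (L k).a * h1

theorem ev_node_ne_zero (hL : IsGenericArrangement L) {j k i : Fin d} (h : j ≠ k) (hij : i ≠ j)
    (hik : i ≠ k) : ev (L i).poly (node L j k) ≠ 0 := by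
  intro h0
  have := hL.not_concurrent j k i h hik.symm hij.symm
  have hm : node L j k ∈ (L j).line ∩ (L k).line ∩ (L i).line :=
    ⟨⟨ev_node_left hL h, ev_node_right hL h⟩, h0⟩
  rw [this] at hm
  exact hm

/-- As no three lines are concurrent, a node determines the two lines through it. -/
theorem node_eq_node (hL : IsGenericArrangement L) {j k j' k' : Fin d} (h : j ≠ k) (h' : j' ≠ k')
    (he : node L j k = node L j' k') : (j' = j ∧ k' = k) ∨ (j' = k ∧ k' = j) := by
  have h1 : j' = j ∨ j' = k := by
    by_contra hn
    rw [not_or] at hn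
    exact ev_node_ne_zero hL h hn.1 hn.2 (he ▸ ev_node_left hL h')
  have h2 : k' = j ∨ k' = k := by
    by_contra hn
    rw [not_or] at hn
    exact ev_node_ne_zero hL h hn.1 hn.2 (he ▸ ev_node_right hL h')
  rcases h1 with rfl | rfl <;> rcases h2 with rfl | rfl <;> simp_all

/-- The product of the linear polynomials of the lines which do not pass through a node. -/
def otherPoly (L : Fin d → LineEq) (j k : Fin d) : MvPolynomial (Fin 2) ℝ :=
  ∏ i ∈ (Finset.univ.erase j).erase k, (L i).poly

theorem otherPoly_comm (L : Fin d → LineEq) (j k : Fin d) : otherPoly L j k = otherPoly L k j := by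
  rw [otherPoly, otherPoly, Finset.erase_right_comm]

theorem arrangementPoly_eq (L : Fin d → LineEq) {j k : Fin d} (h : j ≠ k) :
    arrangementPoly L = (L j).poly * (L k).poly * otherPoly L j k := by
  rw [arrangementPoly, otherPoly, mul_assoc,
    Finset.mul_prod_erase _ (fun i => (L i).poly) (Finset.mem_erase.2 ⟨h.symm, Finset.mem_univ _⟩),
    Finset.mul_prod_erase _ (fun i => (L i).poly) (Finset.mem_univ _)]

theorem ev_otherPoly_ne_zero {j k : Fin d} {p : Plane}
    (h : ∀ i, i ≠ j → i ≠ k → ev (L i).poly p ≠ 0) : ev (otherPoly L j k) p ≠ 0 := by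
  rw [otherPoly, ev_prod, Finset.prod_ne_zero_iff]
  intro i hi
  simp only [Finset.mem_erase, Finset.mem_univ, and_true] at hi
  exact h i hi.2 hi.1

/-- The sign at a node of the product of the other linear polynomials. -/
def nodeSign (L : Fin d → LineEq) (j k : Fin d) : ℤˣ := unitSign (ev (otherPoly L j k) (node L j k))

theorem nodeSign_comm (L : Fin d → LineEq) (j k : Fin d) : nodeSign L j k = nodeSign L k j := by
  rw [nodeSign, nodeSign, otherPoly_comm, node_comm]

/-- The corner at a node at which the two linear polynomials are positive. -/
def nodeCorner (hL : IsGenericArrangement L) {j k : Fin d} (h : j ≠ k) : Corner where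
  P := node L j k
  p := !₂[(L k).b / ((L j).a * (L k).b - (L k).a * (L j).b),
    -(L k).a / ((L j).a * (L k).b - (L k).a * (L j).b)]
  q := !₂[-(L j).b / ((L j).a * (L k).b - (L k).a * (L j).b),
    (L j).a / ((L j).a * (L k).b - (L k).a * (L j).b)]
  U := (L j).poly
  V := (L k).poly
  H := nodeSign L j k • otherPoly L j k
  det := by
    have := det_lines_ne_zero hL h
    have e : ∀ x y z w D : ℝ, D ≠ 0 → x * w - y * z = D →
        det₂ !₂[w / D, -y / D] !₂[-z / D, x / D] = 1 / D := by
      intro x y z w D hD hxy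
      simp only [det₂, Matrix.cons_val_zero, Matrix.cons_val_one]
      field_simp
      linear_combination hxy
    rw [e _ _ _ _ _ this rfl]
    exact one_div_ne_zero this
  evU u v := by
    have := det_lines_ne_zero hL h
    have h0 := ev_node_left hL h
    rw [ev_linePoly] at h0 ⊢
    simp only [PiLp.add_apply, PiLp.smul_apply, smul_eq_mul, Matrix.cons_val_zero,
      Matrix.cons_val_one]
    have e1 : (L j).a * (u * ((L k).b / ((L j).a * (L k).b - (L k).a * (L j).b)))
        + (L j).b * (u * (-(L k).a / ((L j).a * (L k).b - (L k).a * (L j).b))) = u := by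
      field_simp
      ring
    linear_combination h0 + e1
  evV u v := by
    have := det_lines_ne_zero hL h
    have h0 := ev_node_right hL h
    rw [ev_linePoly] at h0 ⊢
    simp only [PiLp.add_apply, PiLp.smul_apply, smul_eq_mul, Matrix.cons_val_zero,
      Matrix.cons_val_one]
    have e1 : (L k).a * (v * (-(L j).b / ((L j).a * (L k).b - (L k).a * (L j).b)))
        + (L k).b * (v * ((L j).a / ((L j).a * (L k).b - (L k).a * (L j).b))) = v := by
      field_simp
      ring
    linear_combination h0 + e1
  dpU := by
    have := det_lines_ne_zero hL h
    rw [dirD_linePoly, ← map_one C]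
    congr 1
    simp only [Matrix.cons_val_zero, Matrix.cons_val_one]
    generalize hD : (L j).a * (L k).b - (L k).a * (L j).b = D at this ⊢
    field_simp
    linear_combination hD
  dqU := by
    have := det_lines_ne_zero hL h
    rw [dirD_linePoly, ← map_zero C]
    congr 1
    simp only [Matrix.cons_val_zero, Matrix.cons_val_one]
    field_simp
    ring
  dpV := by
    have := det_lines_ne_zero hL h
    rw [dirD_linePoly, ← map_zero C]
    congr 1
    simp only [Matrix.cons_val_zero, Matrix.cons_val_one]
    field_simp
    ring
  dqV := by
    have := det_lines_ne_zero hL h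
    rw [dirD_linePoly, ← map_one C]
    congr 1
    simp only [Matrix.cons_val_zero, Matrix.cons_val_one]
    generalize hD : (L j).a * (L k).b - (L k).a * (L j).b = D at this ⊢
    field_simp
    linear_combination hD
  posH := by
    rw [ev_units_smul]
    exact unitSign_smul_pos (ev_otherPoly_ne_zero fun i hj hk => ev_node_ne_zero hL h hj hk)

theorem nodeCorner_swap (hL : IsGenericArrangement L) {j k : Fin d} (h : j ≠ k) :
    (nodeCorner hL h).swap = nodeCorner hL h.symm := by
  have hD : (L k).a * (L j).b - (L j).a * (L k).b = -((L j).a * (L k).b - (L k).a * (L j).b) := by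
    ring
  refine Corner.ext_of (node_comm L j k) ?_ ?_ rfl rfl ?_
  · simp only [Corner.swap, nodeCorner, hD, div_neg, neg_div, neg_neg]
  · simp only [Corner.swap, nodeCorner, hD, div_neg, neg_div, neg_neg]
  · simp only [Corner.swap, nodeCorner, nodeSign_comm L j k, otherPoly_comm L j k]

theorem nodeCorner_F₀ (hL : IsGenericArrangement L) {j k : Fin d} (h : j ≠ k) :
    (nodeCorner hL h).F₀ = nodeSign L j k • arrangementPoly L := by
  rw [arrangementPoly_eq L h, Corner.F₀]
  simp only [nodeCorner]
  rcases Int.units_eq_one_or (nodeSign L j k) with h | h <;> simp [h]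

theorem signed_nodeCorner_F₀ (hL : IsGenericArrangement L) {j k : Fin d} (h : j ≠ k) (σ τ : ℤˣ) :
    ((nodeCorner hL h).signed σ τ).F₀ = (σ * τ * nodeSign L j k) • arrangementPoly L := by
  rw [Corner.signed_F₀, nodeCorner_F₀, smul_smul]

/-! ### Edges of a generic arrangement -/

/-- The line `ℓ` has an edge between its intersection points with the lines `m` and `m'`. -/
structure IsEdge (L : Fin d → LineEq) (ℓ m m' : Fin d) : Prop where
  ne : ℓ ≠ m
  ne' : ℓ ≠ m'
  mm : m ≠ m'
  empty : ∀ i, i ≠ ℓ → ∀ z ∈ openSegment ℝ (node L ℓ m) (node L ℓ m'), ev (L i).poly z ≠ 0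

/-- The side of a line on which a node lies. -/
def sideSign (L : Fin d → LineEq) (ℓ m m' : Fin d) : ℤˣ := unitSign (ev (L m).poly (node L ℓ m'))

theorem IsEdge.symm {ℓ m m' : Fin d} (h : IsEdge L ℓ m m') : IsEdge L ℓ m' m :=
  ⟨h.ne', h.ne, h.mm.symm, by rw [openSegment_symm]; exact h.empty⟩

theorem pos_of_ne_zero_of_isPreconnected {S : Set Plane} (hS : IsPreconnected S) {f : Plane → ℝ}
    (hf : Continuous f) (h : ∀ x ∈ S, f x ≠ 0) {x₀ : Plane} (hx₀ : x₀ ∈ S) (h0 : 0 < f x₀) :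
    ∀ x ∈ S, 0 < f x := by
  intro x hx
  by_contra hn
  obtain ⟨z, hz, hz0⟩ := hS.intermediate_value hx hx₀ hf.continuousOn ⟨not_lt.1 hn, h0.le⟩
  exact h z hz hz0

/-- Adding `P` to the open segment keeps it connected; `f` may vanish at `Q`. -/
theorem pos_on_openSegment {P Q : Plane} {f : Plane → ℝ} (hf : Continuous f)
    (h : ∀ x ∈ openSegment ℝ P Q, f x ≠ 0) (h0 : 0 < f P) : ∀ x ∈ openSegment ℝ P Q, 0 < f x := by
  have hpre : IsPreconnected (insert P (openSegment ℝ P Q)) := by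
    refine (convex_openSegment P Q).isPreconnected.subset_closure (Set.subset_insert _ _) ?_
    rw [closure_openSegment]
    exact Set.insert_subset (left_mem_segment ℝ P Q) (openSegment_subset_segment ℝ P Q)
  intro x hx
  refine pos_of_ne_zero_of_isPreconnected hpre hf ?_ (Set.mem_insert _ _) h0 x (Or.inr hx)
  rintro y (rfl | hy)
  · exact h0.ne'
  · exact h y hy

theorem units_smul_ne_zero {x : ℝ} (σ : ℤˣ) (hx : x ≠ 0) : σ • x ≠ 0 := by
  rcases Int.units_eq_one_or σ with rfl | rfl <;> simpa using hx

/-- The corner at the end of an edge, on a given side of it. -/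
def endCorner (hL : IsGenericArrangement L) {ℓ m m' : Fin d} (h : IsEdge L ℓ m m') (σ : ℤˣ) :
    Corner := (nodeCorner hL h.ne).signed σ (sideSign L ℓ m m')

theorem endCorner_P (hL : IsGenericArrangement L) {ℓ m m' : Fin d} (h : IsEdge L ℓ m m') (σ : ℤˣ) :
    (endCorner hL h σ).P = node L ℓ m := rfl

theorem endCorner_U (hL : IsGenericArrangement L) {ℓ m m' : Fin d} (h : IsEdge L ℓ m m') (σ : ℤˣ) :
    (endCorner hL h σ).U = σ • (L ℓ).poly := rfl

namespace IsEdge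

variable {ℓ m m' : Fin d}

theorem V_pos (hL : IsGenericArrangement L) (h : IsEdge L ℓ m m') (σ : ℤˣ) :
    0 < ev (endCorner hL h σ).V (node L ℓ m') := by
  change 0 < ev (sideSign L ℓ m m' • (L m).poly) _
  rw [ev_units_smul]
  exact unitSign_smul_pos (ev_node_ne_zero hL h.ne' h.ne.symm h.mm)

/-- `V` vanishes at the first node, so its sign is read off at the second one. `H` may vanish at the
second node, so its sign is read off at the first. -/
theorem pos (hL : IsGenericArrangement L) (h : IsEdge L ℓ m m') (σ : ℤˣ) :
    ∀ z ∈ openSegment ℝ (node L ℓ m) (node L ℓ m'),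
      0 < ev ((endCorner hL h σ).V * (endCorner hL h σ).H) z := by
  intro z hz
  rw [ev_mul]
  apply mul_pos
  · rw [openSegment_symm] at hz
    refine pos_on_openSegment (continuous_ev _) (fun x hx => ?_) (h.V_pos hL σ) z hz
    change ev (sideSign L ℓ m m' • (L m).poly) x ≠ 0
    rw [ev_units_smul]
    rw [openSegment_symm] at hx
    exact units_smul_ne_zero _ (h.empty m h.ne.symm x hx)
  · refine pos_on_openSegment (continuous_ev _) (fun x hx => ?_) (endCorner hL h σ).posH z hz
    change ev (nodeSign L ℓ m • otherPoly L ℓ m) x ≠ 0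
    rw [ev_units_smul]
    exact units_smul_ne_zero _ (ev_otherPoly_ne_zero fun i hi _ => h.empty i hi x hx)

theorem U_mul (hL : IsGenericArrangement L) (h : IsEdge L ℓ m m') (σ : ℤˣ) :
    (σ • (L ℓ).poly) * ((endCorner hL h σ).V * (endCorner hL h σ).H)
      = (σ * sideSign L ℓ m m' * nodeSign L ℓ m) • arrangementPoly L := by
  rw [← signed_nodeCorner_F₀ hL h.ne, Corner.F₀, mul_assoc]
  rfl

theorem linePoly_ne_zero (l : LineEq) : l.poly ≠ 0 := by
  intro h0
  have h (p : Plane) : ev l.poly p = 0 := by rw [h0, ev_zero]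
  have h1 := h !₂[0, 0]
  have h2 := h !₂[1, 0]
  have h3 := h !₂[0, 1]
  simp [ev_linePoly] at h1 h2 h3
  rcases l.ne with hn | hn
  · apply hn; linarith
  · apply hn; linarith

/-- Both products are the sign on the edge of the product of all linear polynomials other than that
of `ℓ`, read off from its two ends. -/
theorem sign_eq (hL : IsGenericArrangement L) (h : IsEdge L ℓ m m') :
    sideSign L ℓ m m' * nodeSign L ℓ m = sideSign L ℓ m' m * nodeSign L ℓ m' := by
  by_contra hne
  have hs : sideSign L ℓ m' m * nodeSign L ℓ m' = - (sideSign L ℓ m m' * nodeSign L ℓ m) := by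
    rcases Int.units_eq_one_or (sideSign L ℓ m m' * nodeSign L ℓ m) with h1 | h1 <;>
    rcases Int.units_eq_one_or (sideSign L ℓ m' m * nodeSign L ℓ m') with h2 | h2 <;>
    simp_all
  have h1 := h.U_mul hL 1
  have h2 := h.symm.U_mul hL 1
  rw [mul_assoc 1, hs, one_mul, Units.neg_smul] at h2
  rw [mul_assoc 1, one_mul] at h1
  rw [← h1, one_smul, ← mul_neg] at h2
  have h3 := mul_left_cancel₀ (linePoly_ne_zero (L ℓ)) h2
  obtain ⟨z, hz⟩ : (openSegment ℝ (node L ℓ m) (node L ℓ m')).Nonempty :=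
    ⟨_, 1 / 2, 1 / 2, by norm_num, by norm_num, by norm_num, rfl⟩
  have h4 := h.pos hL 1 z hz
  have h5 := h.symm.pos hL 1 z (by rwa [openSegment_symm])
  rw [h3, ev_neg] at h5
  linarith

theorem edge (hL : IsGenericArrangement L) (h : IsEdge L ℓ m m') (σ : ℤˣ) :
    Edge (endCorner hL h σ) (endCorner hL h.symm σ) where
  U_eq := by rw [endCorner_U, endCorner_U]
  V_pos := by rw [endCorner_P]; exact h.V_pos hL σ
  V'_pos := by rw [endCorner_P]; exact h.symm.V_pos hL σ
  pos := by rw [endCorner_P, endCorner_P]; exact h.pos hL σ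

theorem node_ne (hL : IsGenericArrangement L) (h : IsEdge L ℓ m m') :
    node L ℓ m ≠ node L ℓ m' := by
  intro he
  rcases node_eq_node hL h.ne h.ne' he with h1 | h1
  · exact h.mm h1.2.symm
  · exact h.ne h1.1

end IsEdge

end

section



/-! ### Counting extrema -/

/-- Within `Γ` the set `Y` is open, and away from `B` it is also closed; a connected set which
avoids `B` and meets `Y` cannot leave it. -/
theorem subset_of_isPreconnected {X Y B Γ : Set Plane} (hX : IsPreconnected X) (hXΓ : X ⊆ Γ)
    (hY : ∀ p ∈ Y, Y ∈ 𝓝[Γ] p) (hYB : IsClosed (Y ∪ B)) (hXB : Disjoint X B)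
    (hne : (X ∩ Y).Nonempty) : X ⊆ Y := by
  have h1 : ∀ p ∈ Y, ∃ O : Set Plane, IsOpen O ∧ p ∈ O ∧ O ∩ Γ ⊆ Y := fun p hp =>
    mem_nhdsWithin.1 (hY p hp)
  choose! O hO hpO hOY using h1
  have hu : IsOpen (⋃ p ∈ Y, O p) := isOpen_biUnion hO
  have huY : ∀ x ∈ X, x ∈ ⋃ p ∈ Y, O p → x ∈ Y := by
    intro x hx hxu
    obtain ⟨p, hp, hxp⟩ := Set.mem_iUnion₂.1 hxu
    exact hOY p hp ⟨hxp, hXΓ hx⟩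
  have hcov : X ⊆ (⋃ p ∈ Y, O p) ∪ (Y ∪ B)ᶜ := by
    intro x hx
    by_cases hxY : x ∈ Y
    · exact Or.inl (Set.mem_iUnion₂.2 ⟨x, hxY, hpO x hxY⟩)
    · exact Or.inr fun h => h.elim hxY fun hB => Set.disjoint_left.1 hXB hx hB
  have hemp : X ∩ ((⋃ p ∈ Y, O p) ∩ (Y ∪ B)ᶜ) = ∅ :=
    Set.eq_empty_iff_forall_notMem.2 fun x ⟨hx, hxu, hxv⟩ => hxv (Or.inl (huY x hx hxu))
  rcases isPreconnected_iff_subset_of_disjoint.1 hX _ _ hu hYB.isOpen_compl hcov hemp with h | h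
  · exact fun x hx => huY x hx (h hx)
  · obtain ⟨x, hx, hxY⟩ := hne
    exact absurd (Or.inl hxY) (h hx)

/-- In the application `S` is the set of maxima at the nodes, `T` all extrema, `X e` the open arc
along an edge and `B e` its two ends. Choose an extremum on each `X e`; it is not in `S`. If two of
them coincide, each arc is contained in the other with its ends, so `B e ⊆ B e'` and the edges
agree. -/
theorem encard_add_encard_le {β : Type*} {E : Set β} {S T Γ : Set Plane} (X B : β → Set Plane)
    (hΓ : ∀ e ∈ E, X e ⊆ Γ) (hpre : ∀ e ∈ E, IsPreconnected (X e))
    (hopen : ∀ e ∈ E, ∀ p ∈ X e, X e ∈ 𝓝[Γ] p) (hcl : ∀ e ∈ E, IsClosed (X e ∪ B e))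
    (hBS : ∀ e ∈ E, B e ⊆ S) (hBcl : ∀ e ∈ E, B e ⊆ closure (X e))
    (hXS : ∀ e ∈ E, Disjoint (X e) S) (hXT : ∀ e ∈ E, ∃ z ∈ X e, z ∈ T)
    (hinj : ∀ e ∈ E, ∀ e' ∈ E, B e ⊆ B e' → e = e') (hST : S ⊆ T) :
    S.encard + E.encard ≤ T.encard := by
  choose! z hz hzT using hXT
  have hzinj : Set.InjOn z E := by
    intro e he e' he' hzz
    apply hinj e he e' he'
    have h1 : X e ⊆ X e' := subset_of_isPreconnected (hpre e he) (hΓ e he) (hopen e' he')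
      (hcl e' he') ((hXS e he).mono_right (hBS e' he')) ⟨z e, hz e he, hzz ▸ hz e' he'⟩
    intro b hb
    have h2 : b ∈ X e' ∪ B e' :=
      closure_minimal (h1.trans Set.subset_union_left) (hcl e' he') (hBcl e he hb)
    exact h2.resolve_left fun h3 => Set.disjoint_left.1 (hXS e' he') h3 (hBS e he hb)
  rw [← hzinj.encard_image, ← Set.encard_union_eq]
  · apply Set.encard_le_encard
    apply Set.union_subset hST
    rintro _ ⟨e, he, rfl⟩
    exact hzT e he
  · refine Set.disjoint_left.2 ?_
    rintro _ hS ⟨e, he, rfl⟩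
    exact Set.disjoint_left.1 (hXS e he) (hz e he) hS

/-! ### The branches at the nodes -/

theorem abs_curv_units_smul (σ : ℤˣ) (F : MvPolynomial (Fin 2) ℝ) (p : Plane) :
    |curv (σ • F) p| = |curv F p| := by
  rcases Int.units_eq_one_or σ with rfl | rfl <;> simp [curv_neg]

theorem Corner.signed_box (c : Corner) (σ τ : ℤˣ) (r : ℝ) : (c.signed σ τ).box r = c.box r := by
  have hopp (c : Corner) : (c.signed (-1) (-1)).box r = c.box r := by
    ext x
    simp only [box, Set.mem_image, Set.mem_prod, Prod.exists, signed_neg_pt, Set.mem_Icc]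
    constructor
    · rintro ⟨w, s, h, rfl⟩
      exact ⟨-w, -s, ⟨⟨by linarith, by linarith⟩, by linarith, by linarith⟩, rfl⟩
    · rintro ⟨w, s, h, rfl⟩
      exact ⟨-w, -s, ⟨⟨by linarith, by linarith⟩, by linarith, by linarith⟩, by simp⟩
  rcases Int.units_eq_one_or σ with rfl | rfl <;> rcases Int.units_eq_one_or τ with rfl | rfl
  · rw [signed_one]
  · rw [signed_adj, adj_box]
  · have := hopp c.adj
    rw [← signed_adj, signed_signed, signed_adj, adj_box] at this
    simpa using this
  · exact hopp c

variable {d : ℕ} {L : Fin d → LineEq} {r δ ε : ℝ} {F : MvPolynomial (Fin 2) ℝ}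

/-- The polynomial `F` is close to the product of the linear polynomials at all nodes. -/
def NearNodes (hL : IsGenericArrangement L) (r δ ε : ℝ) (F : MvPolynomial (Fin 2) ℝ) : Prop :=
  ∀ (j k : Fin d) (h : j ≠ k) (σ τ : ℤˣ),
    ((nodeCorner hL h).signed σ τ).Near r δ ε ((σ * τ * nodeSign L j k) • F)

/-- A choice of the resolutions of the nodes, and of points of maximal curvature on their two
branches: `M j k σ` lies on the branch on the side `σ` of the line `j`. -/
structure Branches (hL : IsGenericArrangement L) (r δ ε : ℝ) (F : MvPolynomial (Fin 2) ℝ)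
    (T : Fin d → Fin d → ℤˣ) (M : Fin d → Fin d → ℤˣ → Plane) : Prop where
  comm : ∀ j k, j ≠ k → ∀ σ, M k j (σ * T j k) = M j k σ
  arc : ∀ (j k : Fin d) (h : j ≠ k) (σ : ℤˣ), ∃ s w₁,
    ((nodeCorner hL h).signed σ (σ * T j k)).IsArc r δ ε ((T j k * nodeSign L j k) • F) s w₁ ∧
      M j k σ = GraphOn.param ((nodeCorner hL h).signed σ (σ * T j k)).P
        ((nodeCorner hL h).signed σ (σ * T j k)).a ((nodeCorner hL h).signed σ (σ * T j k)).b s w₁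

theorem isNonsingularCurve_units_smul (σ : ℤˣ) (hF : IsNonsingularCurve F) :
    IsNonsingularCurve (σ • F) := by
  intro p hp
  rw [realCurve_units_smul] at hp
  obtain ⟨j, hj⟩ := hF p hp
  refine ⟨j, ?_⟩
  rcases Int.units_eq_one_or σ with rfl | rfl <;> simpa using hj

/-- Independent choices for `(j, k)` and `(k, j)` need not be compatible. The choices for `j < k`
are kept and the others are obtained by exchanging the sides of the corner; this makes `comm` hold.
-/
theorem exists_branches (hL : IsGenericArrangement L) (hr : 0 < r) (hδ : 0 < δ) (hδr : δ ≤ r / 4)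
    (hε : ∀ (j k : Fin d) (h : j ≠ k) (σ τ : ℤˣ),
      ε < ((nodeCorner hL h).signed σ τ).curvBound r)
    (hN : NearNodes hL r δ ε F) (hF : IsNonsingularCurve F) :
    ∃ T M, Branches hL r δ ε F T M := by
  have h1 : ∀ (j k : Fin d), ∃ t : ℤˣ, ∀ (h : j ≠ k) (σ : ℤˣ),
      ((nodeCorner hL h).signed σ (σ * t)).Open r ((t * nodeSign L j k) • F) := by
    intro j k
    by_cases h : j = k
    · exact ⟨1, fun h' => absurd h h'⟩
    · have h2 := hN j k h 1 1
      rw [Corner.signed_one, mul_one, one_mul] at h2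
      obtain ⟨t, ht⟩ := Corner.exists_open hr h2 (isNonsingularCurve_units_smul _ hF)
      exact ⟨t, fun _ σ => by rw [← smul_smul]; exact ht σ⟩
  choose t ht using h1
  have h2 : ∀ (j k : Fin d) (σ : ℤˣ), ∃ x : Plane, ∀ h : j ≠ k, ∃ s w₁,
      ((nodeCorner hL h).signed σ (σ * t j k)).IsArc r δ ε ((t j k * nodeSign L j k) • F) s w₁ ∧
      x = GraphOn.param ((nodeCorner hL h).signed σ (σ * t j k)).P
        ((nodeCorner hL h).signed σ (σ * t j k)).a
        ((nodeCorner hL h).signed σ (σ * t j k)).b s w₁ := by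
    intro j k σ
    by_cases h : j = k
    · exact ⟨0, fun h' => absurd h h'⟩
    · have h3 := hN j k h σ (σ * t j k)
      rw [← mul_assoc, Int.units_mul_self, one_mul] at h3
      obtain ⟨s, w₁, h4⟩ := Corner.exists_isArc hr hδ hδr (hε j k h _ _) h3 (ht j k h σ)
      exact ⟨GraphOn.param ((nodeCorner hL h).signed σ (σ * t j k)).P
        ((nodeCorner hL h).signed σ (σ * t j k)).a ((nodeCorner hL h).signed σ (σ * t j k)).b s w₁,
        fun _ => ⟨s, w₁, h4, rfl⟩⟩
  choose M hM using h2
  refine ⟨fun j k => if j < k then t j k else t k j,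
    fun j k σ => if j < k then M j k σ else M k j (σ * t k j), ?_, ?_⟩
  · intro j k h σ
    rcases lt_or_gt_of_ne h with h' | h'
    · simp [h', h'.not_gt, mul_assoc, Int.units_mul_self]
    · simp [h', h'.not_gt]
  · intro j k h σ
    rcases lt_or_gt_of_ne h with h' | h'
    · simp only [h', if_true]; exact hM j k σ h
    · simp only [h'.not_gt, if_false]
      obtain ⟨s, w₁, h3, h4⟩ := hM k j (σ * t k j) h.symm
      rw [mul_assoc, Int.units_mul_self, mul_one] at h3 h4
      have e : ((nodeCorner hL h.symm).signed (σ * t k j) σ).swap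
          = (nodeCorner hL h).signed σ (σ * t k j) := by
        rw [Corner.signed_swap, nodeCorner_swap]
      have h5 := h3.swap
      rw [e, nodeSign_comm] at h5
      refine ⟨_, _, h5, h4.trans ?_⟩
      rw [← e, Corner.IsArc.swap_param]

namespace Branches

variable {hL : IsGenericArrangement L} {T : Fin d → Fin d → ℤˣ} {M : Fin d → Fin d → ℤˣ → Plane}

theorem mem_box (h : Branches hL r δ ε F T M) (hr : 0 < r) {j k : Fin d} (hjk : j ≠ k) (σ : ℤˣ) :
    M j k σ ∈ (nodeCorner hL hjk).box r := by
  obtain ⟨s, w₁, h1, h2⟩ := h.arc j k hjk σ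
  rw [h2, ← Corner.signed_box _ σ (σ * T j k)]
  exact h1.param_mem_box hr ⟨by linarith [h1.mem.1], by linarith [h1.mem.2]⟩

theorem mem_curvExtrema (h : Branches hL r δ ε F T M) (hr : 0 < r) {j k : Fin d} (hjk : j ≠ k)
    (σ : ℤˣ) : M j k σ ∈ curvExtrema F := by
  obtain ⟨s, w₁, h1, h2⟩ := h.arc j k hjk σ
  have := h1.mem_curvExtrema hr
  rwa [curvExtrema_units_smul, ← h2] at this

theorem lt_abs_curv (h : Branches hL r δ ε F T M) {j k : Fin d} (hjk : j ≠ k)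
    (σ : ℤˣ) : ε < |curv F (M j k σ)| := by
  obtain ⟨s, w₁, h1, h2⟩ := h.arc j k hjk σ
  have := h1.big.trans_le (neg_le_abs _)
  rwa [abs_curv_units_smul, ← h2] at this

/-- The branches on the two sides of a line are disjoint. -/
theorem ne_opposite (h : Branches hL r δ ε F T M) {j k : Fin d} (hjk : j ≠ k) {σ : ℤˣ}
    {s : ℝ → ℝ} {w₁ w : ℝ}
    (hs : ((nodeCorner hL hjk).signed σ (σ * T j k)).IsArc r δ ε ((T j k * nodeSign L j k) • F)
      s w₁) (hw : w ∈ Set.Icc (-r) r) :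
    GraphOn.param ((nodeCorner hL hjk).signed σ (σ * T j k)).P
      ((nodeCorner hL hjk).signed σ (σ * T j k)).a
      ((nodeCorner hL hjk).signed σ (σ * T j k)).b s w ≠ M j k (-σ) := by
  intro he
  -- On opposite branches the same polynomial increases along opposite directions `a` and `-a`.
  obtain ⟨s', w', h1, h2⟩ := h.arc j k hjk (-σ)
  have hI : w' ∈ Set.Icc (-r) r := by
    have := h1.mem
    have hr : 0 < r := by linarith [this.1, this.2]
    exact ⟨by linarith [this.1], by linarith [this.2]⟩
  have e : (nodeCorner hL hjk).signed (-σ) (-σ * T j k)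
      = ((nodeCorner hL hjk).signed σ (σ * T j k)).signed (-1) (-1) := by
    rw [Corner.signed_signed]; simp
  have h3 := h1.graph.pos w' hI
  have h4 := hs.graph.pos w hw
  rw [GraphOn.param] at h2 he
  rw [← h2, e, Corner.signed_neg_a, ev_dirD_neg] at h3
  rw [he] at h4
  linarith

theorem node_eq (h : Branches hL r δ ε F T M) (hr : 0 < r)
    (hdisj : ∀ (j k j' k' : Fin d) (h : j ≠ k) (h' : j' ≠ k'), node L j k ≠ node L j' k' →
      Disjoint ((nodeCorner hL h).box r) ((nodeCorner hL h').box r)) {j k j' k' : Fin d}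
    (hjk : j ≠ k) (hjk' : j' ≠ k') {σ σ' : ℤˣ} (he : M j k σ = M j' k' σ') :
    node L j k = node L j' k' := by
  by_contra hn
  exact Set.disjoint_left.1 (hdisj j k j' k' hjk hjk' hn) (h.mem_box hr hjk σ)
    (he ▸ h.mem_box hr hjk' σ')

theorem ne_neg (h : Branches hL r δ ε F T M) {j k : Fin d} (hjk : j ≠ k) (σ : ℤˣ) :
    M j k σ ≠ M j k (-σ) := by
  obtain ⟨s, w₁, h1, h2⟩ := h.arc j k hjk σ
  have := h1.mem
  have hr : 0 < r := by linarith [this.1, this.2]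
  rw [h2]
  exact h.ne_opposite hjk h1 ⟨by linarith [this.1], by linarith [this.2]⟩

/-- The ordered pair `(j, k)` stands for the side `1` at its node if `j < k` and for the side `-1`
if `j > k`. -/
theorem le_encard (h : Branches hL r δ ε F T M) (hr : 0 < r)
    (hdisj : ∀ (j k j' k' : Fin d) (h : j ≠ k) (h' : j' ≠ k'), node L j k ≠ node L j' k' →
      Disjoint ((nodeCorner hL h).box r) ((nodeCorner hL h').box r)) :
    ((d * (d - 1) : ℕ) : ℕ∞) ≤ {x | ∃ j k σ, j ≠ k ∧ x = M j k σ}.encard := by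
  have hcard : ((Finset.univ : Finset (Fin d)).offDiag : Set (Fin d × Fin d)).encard
      = ((d * (d - 1) : ℕ) : ℕ∞) := by
    rw [Set.encard_coe_eq_coe_finsetCard, Finset.offDiag_card, Finset.card_univ, Fintype.card_fin,
      Nat.mul_sub, mul_one]
  have hinj : Set.InjOn (fun x : Fin d × Fin d => if x.1 < x.2 then M x.1 x.2 1 else M x.2 x.1 (-1))
      ((Finset.univ : Finset (Fin d)).offDiag : Set (Fin d × Fin d)) := by
    rintro ⟨j, k⟩ hjk ⟨j', k'⟩ hjk' he
    simp only [Finset.coe_offDiag, Finset.coe_univ, Set.mem_offDiag, Set.mem_univ, true_and]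
      at hjk hjk' he
    rcases lt_or_gt_of_ne hjk with h1 | h1 <;> rcases lt_or_gt_of_ne hjk' with h2 | h2 <;>
      simp only [h1, h2, h1.not_gt, h2.not_gt, if_true, if_false] at he
    · rcases node_eq_node hL hjk hjk' (h.node_eq hr hdisj hjk hjk' he) with h3 | h3
      · rw [h3.1, h3.2]
      · rw [h3.1, h3.2] at h2; exact absurd h1 h2.not_gt
    · rcases node_eq_node hL hjk hjk'.symm (h.node_eq hr hdisj hjk hjk'.symm he) with h3 | h3
      · rw [h3.1, h3.2] at he
        exact absurd he (h.ne_neg hjk 1)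
      · rw [h3.1, h3.2] at h2; exact absurd h1 h2.not_gt
    · rcases node_eq_node hL hjk.symm hjk' (h.node_eq hr hdisj hjk.symm hjk' he) with h3 | h3
      · rw [h3.1, h3.2] at he
        have := h.ne_neg hjk.symm (-1)
        rw [neg_neg] at this
        exact absurd he this
      · rw [h3.1, h3.2] at h2; exact absurd h1 h2.not_gt
    · rcases node_eq_node hL hjk.symm hjk'.symm (h.node_eq hr hdisj hjk.symm hjk'.symm he)
        with h3 | h3
      · rw [h3.1, h3.2]
      · rw [h3.1, h3.2] at h2; exact absurd h1 h2.not_gt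
  rw [← hcard, ← hinj.encard_image]
  apply Set.encard_le_encard
  rintro _ ⟨⟨j, k⟩, hjk, rfl⟩
  simp only [Finset.coe_offDiag, Finset.coe_univ, Set.mem_offDiag, Set.mem_univ, true_and] at hjk
  beta_reduce
  split_ifs
  · exact ⟨j, k, 1, hjk, rfl⟩
  · exact ⟨k, j, -1, hjk.symm, rfl⟩

end Branches

end

section



variable {d : ℕ} {L : Fin d → LineEq} {r δ ε : ℝ} {F : MvPolynomial (Fin 2) ℝ}

/-! ### The extremum along a respected edge -/

/-- The curve is close to the arrangement along an edge, and does not cross it within `U`. -/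
structure Respected (hL : IsGenericArrangement L) (r δ ε : ℝ) (F : MvPolynomial (Fin 2) ℝ)
    (U : Set Plane) {ℓ m m' : Fin d} (h : IsEdge L ℓ m m') : Prop where
  fits : ∀ σ, Edge.Fits (endCorner hL h σ) (endCorner hL h.symm σ) r
  slope : ∀ σ, δ * (1 + |Edge.slope (endCorner hL h σ) (endCorner hL h.symm σ)|) ≤ r / 4
  strip : ∀ σ, StripNear ((σ * sideSign L ℓ m m' * nodeSign L ℓ m) • F)
    (Edge.start (endCorner hL h σ) r) (endCorner hL h σ).p
    (Edge.along (endCorner hL h σ) (endCorner hL h.symm σ) r) (endCorner hL h σ).a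
    (endCorner hL h.symm σ).a δ ε
  box : (nodeCorner hL h.ne).box r ⊆ U
  box' : (nodeCorner hL h.ne').box r ⊆ U
  strip_subset : ∀ σ, ∀ x ∈ Set.Icc (0 : ℝ) 1, ∀ y ∈ Set.Icc (-δ) δ,
    Edge.start (endCorner hL h σ) r +
      x • Edge.along (endCorner hL h σ) (endCorner hL h.symm σ) r + y • (endCorner hL h σ).p ∈ U
  not_cross : ∀ K ⊆ realCurve F ∩ U, IsPreconnected K → ∀ p ∈ K, ∀ p' ∈ K,
    r < ev (L ℓ).poly p → ev (L ℓ).poly p' < -r → False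

namespace Branches

variable {hL : IsGenericArrangement L} {T : Fin d → Fin d → ℤˣ} {M : Fin d → Fin d → ℤˣ → Plane}

/-- The end nodes of a respected edge are resolved on the same side of it. -/
theorem side_eq (hB : Branches hL r δ ε F T M) (hδ : 0 < δ) {U : Set Plane}
    {ℓ m m' : Fin d} {h : IsEdge L ℓ m m'} (hR : Respected hL r δ ε F U h) :
    sideSign L ℓ m' m * T ℓ m' = sideSign L ℓ m m' * T ℓ m := by
  by_contra hne
  -- `σ` is the side of `ℓ` whose branch at the first node runs along the edge: its side of `m` is
  -- `σ * T ℓ m = sideSign L ℓ m m'`. Likewise `σ'` at the second node.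
  obtain ⟨σ, hσ⟩ : ∃ σ, σ = sideSign L ℓ m m' * T ℓ m := ⟨_, rfl⟩
  obtain ⟨σ', hσ'⟩ : ∃ σ, σ = sideSign L ℓ m' m * T ℓ m' := ⟨_, rfl⟩
  rw [← hσ, ← hσ'] at hne
  have hneg : σ' = -σ := Int.units_ne_iff_eq_neg.1 hne
  have hτ : σ * T ℓ m = sideSign L ℓ m m' := by
    rw [hσ, mul_assoc, Int.units_mul_self, mul_one]
  have hτ' : σ' * T ℓ m' = sideSign L ℓ m' m := by
    rw [hσ', mul_assoc, Int.units_mul_self, mul_one]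
  obtain ⟨s, w₁, h1, -⟩ := hB.arc ℓ m h.ne σ
  obtain ⟨s', w₁', h1', -⟩ := hB.arc ℓ m' h.ne' σ'
  rw [hτ] at h1
  rw [hτ'] at h1'
  have e1 : T ℓ m * nodeSign L ℓ m = σ * sideSign L ℓ m m' * nodeSign L ℓ m := by
    rw [hσ, mul_comm (sideSign L ℓ m m'), mul_assoc (T ℓ m), Int.units_mul_self, mul_one]
  have e2 : T ℓ m' * nodeSign L ℓ m' = -(σ * sideSign L ℓ m m' * nodeSign L ℓ m) := by
    have e3 : T ℓ m' * nodeSign L ℓ m' = σ' * (sideSign L ℓ m' m * nodeSign L ℓ m') := by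
      rw [hσ', ← mul_assoc, mul_comm (sideSign L ℓ m' m), mul_assoc (T ℓ m'), Int.units_mul_self,
        mul_one]
    rw [e3, ← h.sign_eq hL, hneg, neg_mul, mul_assoc]
  have e4 : (nodeCorner hL h.ne').signed σ' (sideSign L ℓ m' m)
      = (endCorner hL h.symm σ).signed (-1) 1 := by
    rw [endCorner, Corner.signed_signed, hneg]; simp
  rw [e1] at h1
  rw [e2, e4, Units.neg_smul] at h1'
  -- With `σ' = -σ`, the two branches and the arc along the edge form a connected set crossing the
  -- line inside `U`.
  obtain ⟨K, hK, hKc, hKU, ⟨p, hp, hpr⟩, p', hp', hpr'⟩ :=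
    (h.edge hL σ).exists_crossing (hR.fits σ) hδ (hR.slope σ) (hR.strip σ) h1 h1'
  rw [realCurve_units_smul] at hK
  have hKU' : K ⊆ realCurve F ∩ U := by
    intro x hx
    refine ⟨hK hx, ?_⟩
    rcases hKU x hx with h2 | h2 | ⟨t, ht, y, hy, h2⟩
    · rw [endCorner, Corner.signed_box] at h2
      exact hR.box h2
    · rw [endCorner, Corner.signed_box, Corner.signed_box] at h2
      exact hR.box' h2
    · rw [h2]; exact hR.strip_subset σ t ht y hy
  rw [endCorner_U, ev_units_smul] at hpr hpr'
  rcases Int.units_eq_one_or σ with h2 | h2 <;> rw [h2] at hpr hpr'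
  · rw [one_smul] at hpr hpr'
    exact hR.not_cross K hKU' hKc p hp p' hp' hpr hpr'
  · rw [Units.neg_smul, one_smul] at hpr hpr'
    exact hR.not_cross K hKU' hKc p' hp' p hp (by linarith) (by linarith)

/-- Since the sides agree, both end branches belong to the same signed polynomial and
`Edge.exists_mem_curvExtrema` applies. Its arc avoids all chosen maxima: on the strip the curvature
is below `ε`, and the corner parts are treated by `key`. -/
theorem exists_between (hB : Branches hL r δ ε F T M) (hδ : 0 < δ)
    (hdisj : ∀ (j k j' k' : Fin d) (h : j ≠ k) (h' : j' ≠ k'), node L j k ≠ node L j' k' →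
      Disjoint ((nodeCorner hL h).box r) ((nodeCorner hL h').box r)) {U : Set Plane}
    {ℓ m m' : Fin d} {h : IsEdge L ℓ m m'} (hR : Respected hL r δ ε F U h) :
    ∃ (σ : ℤˣ) (X : Set Plane), X ⊆ realCurve F ∧ IsPreconnected X ∧
      (∀ p ∈ X, X ∈ 𝓝[realCurve F] p) ∧ IsClosed (X ∪ {M ℓ m σ, M ℓ m' σ}) ∧
      {M ℓ m σ, M ℓ m' σ} ⊆ closure X ∧ Disjoint X {x | ∃ j k σ, j ≠ k ∧ x = M j k σ} ∧
      ∃ z ∈ X, z ∈ curvExtrema F := by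
  have hr := (hR.fits 1).pos
  obtain ⟨σ, hσ⟩ : ∃ σ, σ = sideSign L ℓ m m' * T ℓ m := ⟨_, rfl⟩
  have hσ' := hσ
  rw [← hB.side_eq hδ hR] at hσ'
  have hτ : σ * T ℓ m = sideSign L ℓ m m' := by
    rw [hσ, mul_assoc, Int.units_mul_self, mul_one]
  have hτ' : σ * T ℓ m' = sideSign L ℓ m' m := by
    rw [hσ', mul_assoc, Int.units_mul_self, mul_one]
  have e1 : T ℓ m * nodeSign L ℓ m = σ * sideSign L ℓ m m' * nodeSign L ℓ m := by
    rw [hσ, mul_comm (sideSign L ℓ m m'), mul_assoc (T ℓ m), Int.units_mul_self, mul_one]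
  have e2 : T ℓ m' * nodeSign L ℓ m' = σ * sideSign L ℓ m m' * nodeSign L ℓ m := by
    have e3 : T ℓ m' * nodeSign L ℓ m' = σ * (sideSign L ℓ m' m * nodeSign L ℓ m') := by
      rw [hσ', ← mul_assoc, mul_comm (sideSign L ℓ m' m), mul_assoc (T ℓ m'), Int.units_mul_self,
        mul_one]
    rw [e3, ← h.sign_eq hL, mul_assoc]
  obtain ⟨s, w₁, h1, h2⟩ := hB.arc ℓ m h.ne σ
  obtain ⟨s', w₁', h1', h2'⟩ := hB.arc ℓ m' h.ne' σ
  -- Maxima at other nodes lie in disjoint boxes, the one on the opposite branch is excluded by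
  -- `ne_opposite`, and the one on the same branch has the parameter `w₁`, which is not in `Set.Ico
  -- (-r) w₁`.
  have key : ∀ {m : Fin d} (hm : ℓ ≠ m) {s : ℝ → ℝ} {w₁ : ℝ},
      ((nodeCorner hL hm).signed σ (σ * T ℓ m)).IsArc r δ ε ((T ℓ m * nodeSign L ℓ m) • F) s w₁ →
      M ℓ m σ = GraphOn.param ((nodeCorner hL hm).signed σ (σ * T ℓ m)).P
        ((nodeCorner hL hm).signed σ (σ * T ℓ m)).a
        ((nodeCorner hL hm).signed σ (σ * T ℓ m)).b s w₁ →
      ∀ w ∈ Set.Ico (-r) w₁, ∀ j k, j ≠ k → ∀ σ',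
        GraphOn.param ((nodeCorner hL hm).signed σ (σ * T ℓ m)).P
        ((nodeCorner hL hm).signed σ (σ * T ℓ m)).a
        ((nodeCorner hL hm).signed σ (σ * T ℓ m)).b s w ≠ M j k σ' := by
    intro m hm s w₁ ha hM w hw j k hjk σ' he
    have hwI : w ∈ Set.Icc (-r) r := ⟨hw.1, by linarith [hw.2, ha.mem.2]⟩
    have hbox := ha.param_mem_box hr hwI
    rw [Corner.signed_box, he] at hbox
    have hnode : node L ℓ m = node L j k := by
      by_contra hn
      exact Set.disjoint_left.1 (hdisj ℓ m j k hm hjk hn) hbox (hB.mem_box hr hjk σ')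
    obtain ⟨σ'', hσ''⟩ : ∃ σ'', M j k σ' = M ℓ m σ'' := by
      rcases node_eq_node hL hm hjk hnode with h3 | h3
      · exact ⟨σ', by rw [h3.1, h3.2]⟩
      · rw [h3.1, h3.2]
        exact ⟨_, (hB.comm m ℓ hm.symm σ').symm⟩
    rw [hσ''] at he
    rcases eq_or_ne σ'' σ with h3 | h3
    · rw [h3, hM] at he
      exact hw.2.ne ((ha.graph.coordB_param w).symm.trans
        ((congrArg _ he).trans (ha.graph.coordB_param w₁)))
    · rw [Int.units_ne_iff_eq_neg.1 h3] at he
      exact hB.ne_opposite hm ha hwI he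
  have k1 := key h.ne h1 h2
  have k2 := key h.ne' h1' h2'
  rw [hτ] at h1 h2 k1
  rw [hτ'] at h1' h2' k2
  rw [e1] at h1
  rw [e2] at h1'
  obtain ⟨X, hX, hc1, hc2, hXF, hpre, hopen, hcpt, hz⟩ :=
    (h.edge hL σ).exists_mem_curvExtrema (hR.fits σ) hδ (hR.slope σ) (hR.strip σ) h1 h1'
  rw [realCurve_units_smul] at hXF hopen
  rw [curvExtrema_units_smul] at hz
  change M ℓ m σ = GraphOn.param (endCorner hL h σ).P (endCorner hL h σ).a (endCorner hL h σ).b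
    s w₁ at h2
  change M ℓ m' σ = GraphOn.param (endCorner hL h.symm σ).P (endCorner hL h.symm σ).a
    (endCorner hL h.symm σ).b s' w₁' at h2'
  rw [← h2, ← h2'] at hcpt
  rw [← h2] at hc1
  rw [← h2'] at hc2
  refine ⟨σ, X, hXF, hpre, hopen, hcpt.isClosed, ?_, ?_, hz⟩
  · rintro x (rfl | hx)
    · exact hc1
    · rw [Set.mem_singleton_iff.1 hx]; exact hc2
  · refine Set.disjoint_left.2 ?_
    rintro p hp ⟨j, k, σ', hjk, rfl⟩
    rcases hX _ hp with ⟨w, hw, hw2⟩ | ⟨w, hw, hw2⟩ | hp2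
    · exact k1 w hw j k hjk σ' hw2.symm
    · exact k2 w hw j k hjk σ' hw2.symm
    · rw [abs_curv_units_smul] at hp2
      linarith [hB.lt_abs_curv hjk σ']

/-- The number of extrema of the curvature is at least the number of branches at the nodes plus the
number of respected edges. -/
theorem card_le (hB : Branches hL r δ ε F T M) (hr : 0 < r) (hδ : 0 < δ)
    (hdisj : ∀ (j k j' k' : Fin d) (h : j ≠ k) (h' : j' ≠ k'), node L j k ≠ node L j' k' →
      Disjoint ((nodeCorner hL h).box r) ((nodeCorner hL h').box r)) {E : Set (Set Plane)}
    (hE : ∀ e ∈ E, ∃ (ℓ m m' : Fin d) (h : IsEdge L ℓ m m') (U : Set Plane),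
      e = openSegment ℝ (node L ℓ m) (node L ℓ m') ∧ Respected hL r δ ε F U h) :
    ((d * (d - 1) : ℕ) : ℕ∞) + E.encard ≤ (curvExtrema F).encard := by
  have hex : ∀ e ∈ E, ∃ X B : Set Plane, X ⊆ realCurve F ∧ IsPreconnected X ∧
      (∀ p ∈ X, X ∈ 𝓝[realCurve F] p) ∧ IsClosed (X ∪ B) ∧ B ⊆ closure X ∧
      Disjoint X {x | ∃ j k σ, j ≠ k ∧ x = M j k σ} ∧ (∃ z ∈ X, z ∈ curvExtrema F) ∧
      ∃ (ℓ m m' : Fin d) (σ : ℤˣ), IsEdge L ℓ m m' ∧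
        e = openSegment ℝ (node L ℓ m) (node L ℓ m') ∧ B = {M ℓ m σ, M ℓ m' σ} := by
    intro e hee
    obtain ⟨ℓ, m, m', h, U, he, hR⟩ := hE e hee
    obtain ⟨σ, X, h1, h2, h3, h4, h5, h6, h7⟩ := hB.exists_between hδ hdisj hR
    exact ⟨X, _, h1, h2, h3, h4, h5, h6, h7, ℓ, m, m', σ, h, he, rfl⟩
  choose! X B h1 h2 h3 h4 h5 h6 h7 h8 using hex
  refine (add_le_add_left (hB.le_encard hr hdisj) _).trans
    (encard_add_encard_le X B h1 h2 h3 h4 ?_ h5 h6 h7 ?_ ?_)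
  · intro e hee x hx
    obtain ⟨ℓ, m, m', σ, h, -, hBe⟩ := h8 e hee
    rw [hBe] at hx
    rcases hx with rfl | hx
    · exact ⟨_, _, _, h.ne, rfl⟩
    · rw [Set.mem_singleton_iff.1 hx]
      exact ⟨_, _, _, h.ne', rfl⟩
  · intro e hee e' hee' hsub
    obtain ⟨ℓ, m, m', σ, h, he, hBe⟩ := h8 e hee
    obtain ⟨ℓ₁, m₁, m₁', σ₁, h', he', hBe'⟩ := h8 e' hee'
    rw [hBe, hBe'] at hsub
    have g1 : node L ℓ m = node L ℓ₁ m₁ ∨ node L ℓ m = node L ℓ₁ m₁' := by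
      rcases hsub (Or.inl rfl) with g | g
      · exact Or.inl (hB.node_eq hr hdisj h.ne h'.ne g)
      · exact Or.inr (hB.node_eq hr hdisj h.ne h'.ne' g)
    have g2 : node L ℓ m' = node L ℓ₁ m₁ ∨ node L ℓ m' = node L ℓ₁ m₁' := by
      rcases hsub (Or.inr rfl) with g | g
      · exact Or.inl (hB.node_eq hr hdisj h.ne' h'.ne g)
      · exact Or.inr (hB.node_eq hr hdisj h.ne' h'.ne' g)
    have g3 := h.node_ne hL
    rw [he, he']
    rcases g1 with g1 | g1 <;> rcases g2 with g2 | g2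
    · exact absurd (g1.trans g2.symm) g3
    · rw [g1, g2]
    · rw [g1, g2, openSegment_symm]
    · exact absurd (g1.trans g2.symm) g3
  · rintro _ ⟨j, k, σ', hjk, rfl⟩
    exact hB.mem_curvExtrema hr hjk σ'

end Branches

/-! ### Small deformations -/

theorem linePoly_lipschitz (l : LineEq) (p q : Plane) :
    |ev l.poly p - ev l.poly q| ≤ (|l.a| + |l.b|) * dist p q := by
  have h0 (i : Fin 2) : |p i - q i| ≤ dist p q := by
    have := PiLp.norm_apply_le (p - q) i
    rwa [← dist_eq_norm] at this
  have e : ev l.poly p - ev l.poly q = l.a * (p 0 - q 0) + l.b * (p 1 - q 1) := by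
    rw [ev_linePoly, ev_linePoly]; ring
  calc |ev l.poly p - ev l.poly q| ≤ |l.a * (p 0 - q 0)| + |l.b * (p 1 - q 1)| := by
        rw [e]; exact abs_add_le _ _
    _ ≤ |l.a| * dist p q + |l.b| * dist p q := by
        rw [abs_mul, abs_mul]
        exact add_le_add (mul_le_mul_of_nonneg_left (h0 0) (abs_nonneg _))
          (mul_le_mul_of_nonneg_left (h0 1) (abs_nonneg _))
    _ = _ := by ring

/-- A part of a curve which is close to the boundary of a single component of the complement of an
arrangement does not cross the lines. -/
theorem not_cross_of_hausdorffEDist_lt {Γ U K : Set Plane} {ℓ : Fin d} {r ρ : ℝ}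
    (hρ : (|(L ℓ).a| + |(L ℓ).b|) * ρ ≤ r)
    (h : ∀ p ∈ Γ ∩ U, ∃ q ∈ U \ arrangementSet L,
      Metric.hausdorffEDist (connectedComponentIn (Γ ∩ U) p)
        (frontier (connectedComponentIn (U \ arrangementSet L) q) ∩ U) < ENNReal.ofReal ρ)
    (hK : K ⊆ Γ ∩ U) (hKc : IsPreconnected K) {p p' : Plane} (hp : p ∈ K) (hp' : p' ∈ K)
    (h1 : r < ev (L ℓ).poly p) (h2 : ev (L ℓ).poly p' < -r) : False := by
  obtain ⟨q, -, hq⟩ := h p (hK hp)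
  have hsub := hKc.subset_connectedComponentIn hp hK
  -- `hρ` turns `ρ`-closeness into an error of at most `r` in the linear polynomial. On the
  -- component its sign is constant, so its closure cannot be near points with values above `r` and
  -- below `-r`.
  have hnear : ∀ x ∈ K, ∃ y ∈ closure (connectedComponentIn (U \ arrangementSet L) q),
      |ev (L ℓ).poly x - ev (L ℓ).poly y| ≤ r := by
    intro x hx
    obtain ⟨y, hy, hxy⟩ := Metric.exists_edist_lt_of_hausdorffEDist_lt (hsub hx) hq
    refine ⟨y, frontier_subset_closure hy.1, (linePoly_lipschitz _ x y).trans (le_trans ?_ hρ)⟩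
    apply mul_le_mul_of_nonneg_left _ (by positivity)
    rw [edist_dist] at hxy
    exact (ENNReal.ofReal_lt_ofReal_iff_of_nonneg dist_nonneg).1 hxy |>.le
  have hD : ∀ x ∈ connectedComponentIn (U \ arrangementSet L) q, ev (L ℓ).poly x ≠ 0 := by
    intro x hx h0
    exact (connectedComponentIn_subset _ _ hx).2 (Set.mem_iUnion.2 ⟨ℓ, h0⟩)
  have hpre : IsPreconnected (connectedComponentIn (U \ arrangementSet L) q) :=
    isPreconnected_connectedComponentIn
  obtain ⟨y, hy, hxy⟩ := hnear p hp
  obtain ⟨y', hy', hxy'⟩ := hnear p' hp'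
  have g1 : 0 < ev (L ℓ).poly y := by linarith [(abs_le.1 hxy).2]
  have g2 : ev (L ℓ).poly y' < 0 := by linarith [(abs_le.1 hxy').1]
  obtain ⟨x, hx, hxD⟩ := mem_closure_iff.1 hy {x | 0 < ev (L ℓ).poly x}
    (isOpen_lt continuous_const (continuous_ev _)) g1
  have hpos := pos_of_ne_zero_of_isPreconnected hpre (continuous_ev _) hD hxD hx
  obtain ⟨x', hx', hxD'⟩ := mem_closure_iff.1 hy' {x | ev (L ℓ).poly x < 0}
    (isOpen_lt (continuous_ev _) continuous_const) g2
  have h3 := hpos x' hxD'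
  have hx' : ev (L ℓ).poly x' < 0 := hx'
  linarith

theorem polyTendsto_of_isSmallDeformation {ι : Type*} {l : Filter ι}
    {F : ι → MvPolynomial (Fin 2) ℝ} (h : IsSmallDeformation L l F) :
    PolyTendsto l F (arrangementPoly L) := .of_coeff h.degree_le h.tendsto

theorem eventually_nearNodes (hL : IsGenericArrangement L) {ι : Type*} {l : Filter ι}
    {F : ι → MvPolynomial (Fin 2) ℝ} (hF : PolyTendsto l F (arrangementPoly L))
    (hr : ∀ (j k : Fin d) (h : j ≠ k) (σ τ : ℤˣ), ((nodeCorner hL h).signed σ τ).Good r)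
    (hδ : 0 < δ) (hδr : δ ≤ r / 4) (hε : 0 < ε) : ∀ᶠ i in l, NearNodes hL r δ ε (F i) := by
  simp only [NearNodes, eventually_all]
  intro j k h σ τ
  refine Corner.eventually_near ?_ (hr j k h σ τ) hδ hδr hε
  rw [signed_nodeCorner_F₀]
  exact hF.units_smul _

theorem eventually_disjoint_box (hL : IsGenericArrangement L) : ∀ᶠ r in 𝓝[>] (0 : ℝ),
    ∀ (j k j' k' : Fin d) (h : j ≠ k) (h' : j' ≠ k'), node L j k ≠ node L j' k' →
      Disjoint ((nodeCorner hL h).box r) ((nodeCorner hL h').box r) := by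
  simp only [eventually_all]
  intro j k j' k' h h' hne
  obtain ⟨A, B, hA, hB, hPA, hPB, hd⟩ := t2_separation hne
  filter_upwards [(nodeCorner hL h).eventually_box_subset (hA.mem_nhds hPA),
    (nodeCorner hL h').eventually_box_subset (hB.mem_nhds hPB)] with r h1 h2
  exact hd.mono h1 h2

theorem thickening_mem_nhds_of_closure {e : Set Plane} {η : ℝ} (hη : 0 < η) {p : Plane}
    (hp : p ∈ closure e) : Metric.thickening η e ∈ 𝓝 p :=
  Metric.isOpen_thickening.mem_nhds (Metric.closure_subset_thickening hη e hp)

theorem node_mem_closure (ℓ m m' : Fin d) :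
    node L ℓ m ∈ closure (openSegment ℝ (node L ℓ m) (node L ℓ m')) := by
  rw [closure_openSegment]; exact left_mem_segment ℝ _ _

/-- The constants `η`, `r`, `δ`, `ε`, `ρ` are chosen in this order, each small in terms of the
earlier ones, and the index `i` last. There are finitely many lines, hence finitely many nodes,
edges and signs, so every choice is uniform. -/
theorem eventually_encard_le (hL : IsGenericArrangement L) {ι : Type*} {l : Filter ι}
    {F : ι → MvPolynomial (Fin 2) ℝ} (hF : IsSmallDeformation L l F) {E : Set (Set Plane)}
    (hE : ∀ e ∈ E, (∃ (ℓ m m' : Fin d), IsEdge L ℓ m m' ∧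
      e = openSegment ℝ (node L ℓ m) (node L ℓ m')) ∧
        RespectsEdge L l (fun i => realCurve (F i)) e) :
    ∀ᶠ i in l, ((d * (d - 1) : ℕ) : ℕ∞) + E.encard ≤ (curvExtrema (F i)).encard := by
  have hpoly := polyTendsto_of_isSmallDeformation hF
  -- the neighbourhoods of the edges
  have hη : ∀ᶠ η in 𝓝[>] (0 : ℝ), 0 < η ∧ ∀ (ℓ m m' : Fin d),
      openSegment ℝ (node L ℓ m) (node L ℓ m') ∈ E → ∀ ρ : ℝ, 0 < ρ → ∀ᶠ i in l,
        ∀ p ∈ realCurve (F i) ∩ Metric.thickening η (openSegment ℝ (node L ℓ m) (node L ℓ m')),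
        ∃ q ∈ Metric.thickening η (openSegment ℝ (node L ℓ m) (node L ℓ m')) \ arrangementSet L,
          Metric.hausdorffEDist (connectedComponentIn (realCurve (F i) ∩
            Metric.thickening η (openSegment ℝ (node L ℓ m) (node L ℓ m'))) p)
          (frontier (connectedComponentIn
            (Metric.thickening η (openSegment ℝ (node L ℓ m) (node L ℓ m')) \ arrangementSet L) q) ∩
            Metric.thickening η (openSegment ℝ (node L ℓ m) (node L ℓ m'))) < ENNReal.ofReal ρ := by
    refine eventually_and.2 ⟨self_mem_nhdsWithin, ?_⟩
    simp only [eventually_all]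
    intro ℓ m m' he
    exact (hE _ he).2
  obtain ⟨η, hη0, hη⟩ := hη.exists
  set U : Fin d → Fin d → Fin d → Set Plane := fun ℓ m m' =>
    Metric.thickening η (openSegment ℝ (node L ℓ m) (node L ℓ m')) with hU
  -- the size of the boxes
  have hr : ∀ᶠ r in 𝓝[>] (0 : ℝ), 0 < r ∧
      (∀ (j k : Fin d) (h : j ≠ k) (σ τ : ℤˣ), ((nodeCorner hL h).signed σ τ).Good r) ∧
      (∀ (ℓ m m' : Fin d) (h : IsEdge L ℓ m m'),
        (∀ σ, Edge.Fits (endCorner hL h σ) (endCorner hL h.symm σ) r) ∧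
        (nodeCorner hL h.ne).box r ⊆ U ℓ m m' ∧ (nodeCorner hL h.ne').box r ⊆ U ℓ m m') := by
    refine eventually_and.2 ⟨self_mem_nhdsWithin, eventually_and.2 ⟨?_, ?_⟩⟩
    · simp only [eventually_all]
      exact fun j k h σ τ => Corner.eventually_good _
    · simp only [eventually_all, eventually_and]
      refine fun ℓ m m' h => ⟨fun σ => (h.edge hL σ).eventually_fits,
        Corner.eventually_box_subset _
          (thickening_mem_nhds_of_closure hη0 (node_mem_closure ℓ m m')),
        Corner.eventually_box_subset _ (thickening_mem_nhds_of_closure hη0 ?_)⟩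
      rw [openSegment_symm]
      exact node_mem_closure ℓ m' m
  obtain ⟨r, ⟨hr0, hgood, hfit⟩, hdisj⟩ := (hr.and (eventually_disjoint_box hL)).exists
  -- the width of the strips
  have hδ : ∀ᶠ δ in 𝓝[>] (0 : ℝ), 0 < δ ∧ δ ≤ r / 4 ∧
      ∀ (ℓ m m' : Fin d) (h : IsEdge L ℓ m m') (σ : ℤˣ),
        δ * (1 + |Edge.slope (endCorner hL h σ) (endCorner hL h.symm σ)|) ≤ r / 4 ∧
        StripLimit (endCorner hL h σ).F₀ (Edge.start (endCorner hL h σ) r) (endCorner hL h σ).p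
          (Edge.along (endCorner hL h σ) (endCorner hL h.symm σ) r) (endCorner hL h σ).a
          (endCorner hL h.symm σ).a δ ∧
        ∀ x ∈ Set.Icc (0 : ℝ) 1, ∀ y ∈ Set.Icc (-δ) δ, Edge.start (endCorner hL h σ) r +
          x • Edge.along (endCorner hL h σ) (endCorner hL h.symm σ) r +
            y • (endCorner hL h σ).p ∈ U ℓ m m' := by
    have hsmall : ∀ k : ℝ, ∀ᶠ δ in 𝓝[>] (0 : ℝ), δ * k ≤ r / 4 := by
      intro k
      have h1 : Continuous fun δ : ℝ => δ * k := by fun_prop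
      have h2 : ∀ᶠ δ in 𝓝 (0 : ℝ), δ * k < r / 4 := by
        apply h1.continuousAt.eventually_lt_const
        simpa using hr0
      exact nhdsWithin_le_nhds (h2.mono fun _ h => h.le)
    refine eventually_and.2 ⟨self_mem_nhdsWithin, eventually_and.2 ⟨?_, ?_⟩⟩
    · simpa using hsmall 1
    · simp only [eventually_all]
      intro ℓ m m' h σ
      refine eventually_and.2 ⟨hsmall _, eventually_and.2 ⟨?_, ?_⟩⟩
      · exact (h.edge hL σ).eventually_stripLimit ((hfit ℓ m m' h).1 σ)
      · refine eventually_strip_subset Metric.isOpen_thickening fun x hx => ?_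
        exact Metric.self_subset_thickening hη0 _
          ((h.edge hL σ).strip_mem ((hfit ℓ m m' h).1 σ) hx)
  obtain ⟨δ, hδ0, hδr, hstrip⟩ := hδ.exists
  have hε : ∀ᶠ ε in 𝓝[>] (0 : ℝ), 0 < ε ∧ ∀ (j k : Fin d) (h : j ≠ k) (σ τ : ℤˣ),
      ε < ((nodeCorner hL h).signed σ τ).curvBound r := by
    refine eventually_and.2 ⟨self_mem_nhdsWithin, ?_⟩
    simp only [eventually_all]
    intro j k h σ τ
    exact nhdsWithin_le_nhds (Iio_mem_nhds (Corner.curvBound_pos _ hr0))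
  obtain ⟨ε, hε0, hεc⟩ := hε.exists
  have hρ : ∀ᶠ ρ in 𝓝[>] (0 : ℝ), 0 < ρ ∧ ∀ ℓ, (|(L ℓ).a| + |(L ℓ).b|) * ρ ≤ r := by
    refine eventually_and.2 ⟨self_mem_nhdsWithin, ?_⟩
    simp only [eventually_all]
    intro ℓ
    have h1 : Continuous fun ρ : ℝ => (|(L ℓ).a| + |(L ℓ).b|) * ρ := by fun_prop
    have h2 : ∀ᶠ ρ in 𝓝 (0 : ℝ), (|(L ℓ).a| + |(L ℓ).b|) * ρ < r := by
      apply h1.continuousAt.eventually_lt_const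
      simpa using hr0
    exact nhdsWithin_le_nhds (h2.mono fun _ h => h.le)
  obtain ⟨ρ, hρ0, hρr⟩ := hρ.exists
  have hres : ∀ᶠ i in l, ∀ (ℓ m m' : Fin d),
      openSegment ℝ (node L ℓ m) (node L ℓ m') ∈ E →
        ∀ p ∈ realCurve (F i) ∩ U ℓ m m', ∃ q ∈ U ℓ m m' \ arrangementSet L,
          Metric.hausdorffEDist (connectedComponentIn (realCurve (F i) ∩ U ℓ m m') p)
          (frontier (connectedComponentIn (U ℓ m m' \ arrangementSet L) q) ∩ U ℓ m m')
            < ENNReal.ofReal ρ := by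
    simp only [eventually_all]
    intro ℓ m m' he
    exact hη ℓ m m' he ρ hρ0
  have hstripF : ∀ᶠ i in l, ∀ (ℓ m m' : Fin d) (h : IsEdge L ℓ m m') (σ : ℤˣ),
      StripNear ((σ * sideSign L ℓ m m' * nodeSign L ℓ m) • F i)
        (Edge.start (endCorner hL h σ) r) (endCorner hL h σ).p
        (Edge.along (endCorner hL h σ) (endCorner hL h.symm σ) r) (endCorner hL h σ).a
        (endCorner hL h.symm σ).a δ ε := by
    simp only [eventually_all]
    intro ℓ m m' h σ
    refine (hstrip ℓ m m' h σ).2.1.eventually_near ?_ hε0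
    rw [endCorner, signed_nodeCorner_F₀]
    exact hpoly.units_smul _
  filter_upwards [hres, hstripF, hF.nonsingular,
    eventually_nearNodes hL hpoly hgood hδ0 hδr hε0] with i g1 g2 g3 g4
  obtain ⟨T, M, hB⟩ := exists_branches hL hr0 hδ0 hδr hεc g4 g3
  refine hB.card_le hr0 hδ0 hdisj fun e he => ?_
  obtain ⟨⟨ℓ, m, m', h, rfl⟩, -⟩ := hE e he
  refine ⟨ℓ, m, m', h, U ℓ m m', rfl, (hfit ℓ m m' h).1, fun σ => (hstrip ℓ m m' h σ).1,
    g2 ℓ m m' h, (hfit ℓ m m' h).2.1, (hfit ℓ m m' h).2.2,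
    fun σ => (hstrip ℓ m m' h σ).2.2, ?_⟩
  intro K hK hKc p hp p' hp' h1 h2
  exact not_cross_of_hausdorffEDist_lt (hρr ℓ) (g1 ℓ m m' he) hK hKc hp hp' h1 h2

end

section



variable {d : ℕ} {L : Fin d → LineEq}

/-! ### Bounded edges -/

theorem ev_linePoly_combo (l : LineEq) {P Q : Plane} {α β : ℝ} (h : α + β = 1) :
    ev l.poly (α • P + β • Q) = α * ev l.poly P + β * ev l.poly Q := by
  rw [ev_linePoly, ev_linePoly, ev_linePoly]
  simp
  linear_combination -l.c * h

/-- The coordinate along a line. -/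
def lineCoord (l : LineEq) (z : Plane) : ℝ := l.a * z 1 - l.b * z 0

theorem lineCoord_combo (l : LineEq) (P Q : Plane) (α β : ℝ) :
    lineCoord l (α • P + β • Q) = α * lineCoord l P + β * lineCoord l Q := by
  simp [lineCoord]; ring

theorem sq_add_sq_pos (l : LineEq) : 0 < l.a ^ 2 + l.b ^ 2 := by
  rcases l.ne with h | h
  · have := sq_nonneg l.b; positivity
  · have := sq_nonneg l.a; positivity

theorem eq_of_lineCoord {l : LineEq} {z z' : Plane} (h1 : ev l.poly z = ev l.poly z')
    (h2 : lineCoord l z = lineCoord l z') : z = z' := by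
  have h := (sq_add_sq_pos l).ne'
  rw [ev_linePoly, ev_linePoly] at h1
  rw [lineCoord, lineCoord] at h2
  ext i
  fin_cases i
  · apply mul_left_cancel₀ h
    simp only [Fin.zero_eta]
    linear_combination l.a * h1 - l.b * h2
  · apply mul_left_cancel₀ h
    simp only [Fin.mk_one]
    linear_combination l.b * h1 + l.a * h2

theorem ev_eq_zero_of_mem_openSegment (hL : IsGenericArrangement L) {ℓ m m' : Fin d} (h : ℓ ≠ m)
    (h' : ℓ ≠ m') {z : Plane} (hz : z ∈ openSegment ℝ (node L ℓ m) (node L ℓ m')) :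
    ev (L ℓ).poly z = 0 := by
  obtain ⟨α, β, -, -, hs, rfl⟩ := hz
  rw [ev_linePoly_combo _ hs, ev_node_left hL h, ev_node_left hL h']; ring

theorem lineCoord_mem_Ioo {l : LineEq} {P Q z : Plane} (h : lineCoord l P < lineCoord l Q)
    (hz : z ∈ openSegment ℝ P Q) : lineCoord l z ∈ Set.Ioo (lineCoord l P) (lineCoord l Q) := by
  obtain ⟨α, β, hα, hβ, hs, rfl⟩ := hz
  rw [lineCoord_combo]
  have hα' : α = 1 - β := by linarith
  subst hα'
  constructor <;> nlinarith

theorem isEdge_of_consecutive (hL : IsGenericArrangement L) {ℓ m m' : Fin d} (h : ℓ ≠ m)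
    (h' : ℓ ≠ m') (hlt : lineCoord (L ℓ) (node L ℓ m) < lineCoord (L ℓ) (node L ℓ m'))
    (hcons : ∀ i, ℓ ≠ i → lineCoord (L ℓ) (node L ℓ i) ∉
      Set.Ioo (lineCoord (L ℓ) (node L ℓ m)) (lineCoord (L ℓ) (node L ℓ m'))) :
    IsEdge L ℓ m m' := by
  refine ⟨h, h', ?_, fun i hi z hz h0 => ?_⟩
  · rintro rfl; exact lt_irrefl _ hlt
  · have h1 := ev_eq_zero_of_mem_openSegment hL h h' hz
    have h2 := eq_node hL hi.symm h1 h0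
    exact hcons i hi.symm (h2 ▸ lineCoord_mem_Ioo hlt hz)

/-- One equation and two strict inequalities: in this form the edge is visibly open in its line. -/
theorem mem_openSegment_iff (hL : IsGenericArrangement L) {ℓ m m' : Fin d} (h : IsEdge L ℓ m m')
    {z : Plane} : z ∈ openSegment ℝ (node L ℓ m) (node L ℓ m') ↔ ev (L ℓ).poly z = 0 ∧
      0 < sideSign L ℓ m m' • ev (L m).poly z ∧ 0 < sideSign L ℓ m' m • ev (L m').poly z := by
  have hV := h.V_pos hL 1
  have hV' := h.symm.V_pos hL 1
  change 0 < ev (sideSign L ℓ m m' • (L m).poly) _ at hV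
  change 0 < ev (sideSign L ℓ m' m • (L m').poly) _ at hV'
  rw [ev_units_smul] at hV hV'
  have hz1 := ev_node_right hL h.ne
  have hz2 := ev_node_right hL h.ne'
  have hsm : ∀ (σ : ℤˣ) (x y : ℝ), σ • (x * y) = x * σ • y := by
    intro σ x y
    rcases Int.units_eq_one_or σ with rfl | rfl <;> simp
  constructor
  · intro hz
    refine ⟨ev_eq_zero_of_mem_openSegment hL h.ne h.ne' hz, ?_⟩
    obtain ⟨α, β, hα, hβ, hs, rfl⟩ := hz
    rw [ev_linePoly_combo _ hs, ev_linePoly_combo _ hs, hz1, hz2, mul_zero, mul_zero, zero_add,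
      add_zero, hsm, hsm]
    exact ⟨mul_pos hβ hV, mul_pos hα hV'⟩
  · rintro ⟨h0, h1, h2⟩
    have hE := h.edge hL 1
    have e1 := Edge.exists_coord (endCorner hL h 1) z
    have e2 := hE.P_eq
    rw [endCorner_U, one_smul, h0, zero_smul, add_zero, endCorner_P] at e1
    rw [endCorner_P, endCorner_P] at e2
    have hlen : 0 < Edge.len (endCorner hL h 1) (endCorner hL h.symm 1) := hE.V_pos
    obtain ⟨v, hv⟩ : ∃ v, v = ev (endCorner hL h 1).V z := ⟨_, rfl⟩
    obtain ⟨g, hg⟩ : ∃ g, g = Edge.len (endCorner hL h 1) (endCorner hL h.symm 1) := ⟨_, rfl⟩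
    have hv0 : 0 < v := by
      rw [hv]
      change 0 < ev (sideSign L ℓ m m' • (L m).poly) z
      rwa [ev_units_smul]
    rw [← hv] at e1
    rw [← hg] at e2 hlen
    have e3 : z = (1 - v / g) • node L ℓ m + (v / g) • node L ℓ m' := by
      rw [e2, e1]
      ext i; simp; field_simp; ring
    rw [e3, ev_linePoly_combo _ (by ring), hz2, mul_zero, add_zero, hsm] at h2
    have h3 : 0 < 1 - v / g := pos_of_mul_pos_left h2 hV'.le
    rw [e3]
    exact ⟨_, _, h3, div_pos hv0 hlen, by ring, rfl⟩

/-- The edge is connected, open in the arrangement, and closed once its two end nodes are added.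
Those nodes have been removed, so the component cannot grow beyond it. -/
theorem isConnectedComponent_openSegment (hL : IsGenericArrangement L) {ℓ m m' : Fin d}
    (h : IsEdge L ℓ m m') {p : Plane} (hp : p ∈ openSegment ℝ (node L ℓ m) (node L ℓ m')) :
    p ∈ arrangementSet L \ arrangementNodes L ∧
      connectedComponentIn (arrangementSet L \ arrangementNodes L) p
        = openSegment ℝ (node L ℓ m) (node L ℓ m') := by
  have hsub : openSegment ℝ (node L ℓ m) (node L ℓ m')
      ⊆ arrangementSet L \ arrangementNodes L := by
    intro z hz
    have h0 := ev_eq_zero_of_mem_openSegment hL h.ne h.ne' hz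
    refine ⟨Set.mem_iUnion.2 ⟨ℓ, h0⟩, ?_⟩
    rintro ⟨i, j, hij, hi, hj⟩
    rcases eq_or_ne i ℓ with rfl | hne
    · exact h.empty j hij.symm z hz hj
    · exact h.empty i hne z hz hi
  refine ⟨hsub hp, Set.Subset.antisymm ?_ ?_⟩
  · refine subset_of_isPreconnected (B := {node L ℓ m, node L ℓ m'})
      isPreconnected_connectedComponentIn (connectedComponentIn_subset _ _) ?_ ?_ ?_
      ⟨p, mem_connectedComponentIn (hsub hp), hp⟩
    · intro z hz
      have hz' := (mem_openSegment_iff hL h).1 hz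
      have hcont : ∀ (σ : ℤˣ) (i : Fin d), Continuous fun z => σ • ev (L i).poly z := by
        intro σ i
        rcases Int.units_eq_one_or σ with rfl | rfl
        · simpa using continuous_ev _
        · simp only [Units.neg_smul, one_smul]
          exact (continuous_ev (L i).poly).neg
      have g1 : ∀ᶠ y in 𝓝 z, ∀ i, i ≠ ℓ → ev (L i).poly y ≠ 0 := by
        simp only [eventually_all]
        intro i hi
        exact (continuous_ev _).continuousAt.eventually_ne (h.empty i hi z hz)
      filter_upwards [nhdsWithin_le_nhds g1,
        nhdsWithin_le_nhds ((hcont _ m).continuousAt.eventually_const_lt hz'.2.1),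
        nhdsWithin_le_nhds ((hcont _ m').continuousAt.eventually_const_lt hz'.2.2),
        self_mem_nhdsWithin] with y g2 g3 g4 g5
      refine (mem_openSegment_iff hL h).2 ⟨?_, g3, g4⟩
      obtain ⟨i, hi⟩ := Set.mem_iUnion.1 g5.1
      by_contra hn
      have : i ≠ ℓ := by rintro rfl; exact hn hi
      exact g2 i this hi
    · have : openSegment ℝ (node L ℓ m) (node L ℓ m') ∪ {node L ℓ m, node L ℓ m'}
          = segment ℝ (node L ℓ m) (node L ℓ m') := by
        rw [← insert_endpoints_openSegment, Set.union_comm, Set.insert_union,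
          Set.singleton_union]
      rw [this, ← closure_openSegment]
      exact isClosed_closure
    · refine Set.disjoint_left.2 ?_
      rintro z hz (rfl | hz2)
      · exact (connectedComponentIn_subset _ _ hz).2
          ⟨ℓ, m, h.ne, ev_node_left hL h.ne, ev_node_right hL h.ne⟩
      · rw [Set.mem_singleton_iff.1 hz2] at hz
        exact (connectedComponentIn_subset _ _ hz).2
          ⟨ℓ, m', h.ne', ev_node_left hL h.ne', ev_node_right hL h.ne'⟩
  · exact (convex_openSegment _ _).isPreconnected.subset_connectedComponentIn hp hsub

theorem IsEdge.mem_boundedEdges (hL : IsGenericArrangement L) {ℓ m m' : Fin d}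
    (h : IsEdge L ℓ m m') : openSegment ℝ (node L ℓ m) (node L ℓ m') ∈ boundedEdges L := by
  obtain ⟨p, hp⟩ : (openSegment ℝ (node L ℓ m) (node L ℓ m')).Nonempty :=
    ⟨_, 1 / 2, 1 / 2, by norm_num, by norm_num, by norm_num, rfl⟩
  have h1 := isConnectedComponent_openSegment hL h hp
  refine ⟨?_, p, h1.1, h1.2.symm⟩
  have : IsCompact (segment ℝ (node L ℓ m) (node L ℓ m')) := by
    rw [segment_eq_image]
    exact isCompact_Icc.image (by fun_prop)
  exact this.isBounded.subset (openSegment_subset_segment ℝ _ _)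

/-- Otherwise the ray from `p` along `ℓ` in the direction given by `σ` contains no node, so it lies
in `e`, which is bounded. -/
theorem exists_node_gt (hL : IsGenericArrangement L) {e : Set Plane}
    (hb : Bornology.IsBounded e) {p : Plane} (hp : p ∈ arrangementSet L \ arrangementNodes L)
    (he : e = connectedComponentIn (arrangementSet L \ arrangementNodes L) p) {ℓ : Fin d}
    (hℓ : ev (L ℓ).poly p = 0) {σ : ℝ} (hσ : σ ≠ 0) : ∃ i, ℓ ≠ i ∧
      σ * lineCoord (L ℓ) p < σ * lineCoord (L ℓ) (node L ℓ i) := by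
  by_contra hn
  push Not at hn
  obtain ⟨u, hu⟩ : ∃ u : Plane, u = σ • !₂[-(L ℓ).b, (L ℓ).a] := ⟨_, rfl⟩
  have hD := sq_add_sq_pos (L ℓ)
  have hev (x : ℝ) : ev (L ℓ).poly (p + x • u) = 0 := by
    rw [ev_linePoly] at hℓ ⊢
    rw [hu]
    simp
    linear_combination hℓ
  have hco (x : ℝ) : lineCoord (L ℓ) (p + x • u)
      = lineCoord (L ℓ) p + x * (σ * ((L ℓ).a ^ 2 + (L ℓ).b ^ 2)) := by
    rw [lineCoord, lineCoord, hu]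
    simp
    ring
  have hray : (fun x : ℝ => p + x • u) '' Set.Ici 0 ⊆ arrangementSet L \ arrangementNodes L := by
    rintro _ ⟨x, hx, rfl⟩
    have hx : 0 ≤ x := hx
    refine ⟨Set.mem_iUnion.2 ⟨ℓ, hev x⟩, ?_⟩
    rintro ⟨i, j, hij, hi, hj⟩
    obtain ⟨k, hk, hk0⟩ : ∃ k, ℓ ≠ k ∧ ev (L k).poly (p + x • u) = 0 := by
      rcases eq_or_ne ℓ i with rfl | hne
      · exact ⟨j, hij, hj⟩
      · exact ⟨i, hne, hi⟩
    have h1 := eq_node hL hk (hev x) hk0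
    have h2 := hn k hk
    rw [← h1, hco] at h2
    have h3 : 0 < σ ^ 2 * ((L ℓ).a ^ 2 + (L ℓ).b ^ 2) := by positivity
    have h4 : x = 0 := by nlinarith
    rw [h4, zero_smul, add_zero] at hk0
    exact hp.2 ⟨ℓ, k, hk, hℓ, hk0⟩
  have hsub : (fun x : ℝ => p + x • u) '' Set.Ici 0 ⊆ e := by
    rw [he]
    refine IsPreconnected.subset_connectedComponentIn ?_ ⟨0, Set.self_mem_Ici, by simp⟩ hray
    exact isPreconnected_Ici.image _ (by fun_prop)
  obtain ⟨R, hR⟩ := (hb.subset hsub).exists_norm_le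
  have hu0 : 0 < ‖u‖ := by
    rw [norm_pos_iff, hu]
    intro h0
    have e0 := congrArg (fun v : Plane => v 0) h0
    have e1 := congrArg (fun v : Plane => v 1) h0
    simp [hσ] at e0 e1
    rw [e0, e1] at hD
    simp at hD
  have h1 := hR (p + ((|R| + ‖p‖ + 1) / ‖u‖) • u)
    ⟨_, Set.mem_Ici.2 (by positivity), rfl⟩
  have h2 := norm_sub_norm_le (((|R| + ‖p‖ + 1) / ‖u‖) • u) (-p)
  rw [sub_neg_eq_add, add_comm _ p, norm_neg, norm_smul, Real.norm_of_nonneg (by positivity),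
    div_mul_cancel₀ _ hu0.ne'] at h2
  linarith [le_abs_self R]

/-- The edge ends at the nodes nearest to `p` on its line, one on each side. -/
theorem exists_isEdge_of_mem_boundedEdges (hL : IsGenericArrangement L) {e : Set Plane}
    (he : e ∈ boundedEdges L) : ∃ ℓ m m' : Fin d, IsEdge L ℓ m m' ∧
      e = openSegment ℝ (node L ℓ m) (node L ℓ m') := by
  obtain ⟨hb, p, hp, hep⟩ := he
  obtain ⟨ℓ, hℓ⟩ := Set.mem_iUnion.1 hp.1
  have hℓ : ev (L ℓ).poly p = 0 := hℓ
  obtain ⟨i, hi, hi2⟩ := exists_node_gt hL hb hp hep hℓ (σ := 1) one_ne_zero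
  obtain ⟨j, hj, hj2⟩ := exists_node_gt hL hb hp hep hℓ (σ := -1) (by norm_num)
  rw [one_mul, one_mul] at hi2
  obtain ⟨m', hm', hmin⟩ := (Finset.univ.filter fun i =>
    ℓ ≠ i ∧ lineCoord (L ℓ) p < lineCoord (L ℓ) (node L ℓ i)).exists_min_image
      (fun i => lineCoord (L ℓ) (node L ℓ i)) ⟨i, by simp [hi, hi2]⟩
  obtain ⟨m, hm, hmax⟩ := (Finset.univ.filter fun i =>
    ℓ ≠ i ∧ lineCoord (L ℓ) (node L ℓ i) < lineCoord (L ℓ) p).exists_max_image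
      (fun i => lineCoord (L ℓ) (node L ℓ i)) ⟨j, by simp [hj]; linarith⟩
  simp only [Finset.mem_filter, Finset.mem_univ, true_and] at hm hm' hmin hmax
  have hlt := hm.2.trans hm'.2
  have hE : IsEdge L ℓ m m' := by
    refine isEdge_of_consecutive hL hm.1 hm'.1 hlt fun k hk hkI => ?_
    rcases lt_trichotomy (lineCoord (L ℓ) p) (lineCoord (L ℓ) (node L ℓ k)) with h1 | h1 | h1
    · exact (hmin k ⟨hk, h1⟩).not_gt hkI.2
    · have h2 := eq_of_lineCoord (hℓ.trans (ev_node_left hL hk).symm) h1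
      exact hp.2 ⟨ℓ, k, hk, hℓ, by rw [h2]; exact ev_node_right hL hk⟩
    · exact (hmax k ⟨hk, h1⟩).not_gt hkI.1
  refine ⟨ℓ, m, m', hE, ?_⟩
  have hpe : p ∈ openSegment ℝ (node L ℓ m) (node L ℓ m') := by
    have h1 : 0 < lineCoord (L ℓ) (node L ℓ m') - lineCoord (L ℓ) (node L ℓ m) := by linarith
    refine ⟨(lineCoord (L ℓ) (node L ℓ m') - lineCoord (L ℓ) p) /
      (lineCoord (L ℓ) (node L ℓ m') - lineCoord (L ℓ) (node L ℓ m)),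
      (lineCoord (L ℓ) p - lineCoord (L ℓ) (node L ℓ m)) /
      (lineCoord (L ℓ) (node L ℓ m') - lineCoord (L ℓ) (node L ℓ m)),
      div_pos (by linarith) h1, div_pos (by linarith) h1, by field_simp; ring, ?_⟩
    apply eq_of_lineCoord (l := L ℓ)
    · rw [ev_linePoly_combo _ (by field_simp; ring), ev_node_left hL hm.1, ev_node_left hL hm'.1,
        hℓ]
      ring
    · rw [lineCoord_combo]
      field_simp
      ring
  rw [hep, (isConnectedComponent_openSegment hL hE hpe).2]

/-! ### Counting the bounded edges. -/

/-- The pairs of a line and of a node on it which is not the last one. -/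
def notLast (L : Fin d → LineEq) (ℓ : Fin d) : Finset (Fin d) :=
  Finset.univ.filter fun m => ℓ ≠ m ∧ ∃ m', ℓ ≠ m' ∧
    lineCoord (L ℓ) (node L ℓ m) < lineCoord (L ℓ) (node L ℓ m')

theorem lineCoord_node_injective (hL : IsGenericArrangement L) {ℓ m m' : Fin d} (h : ℓ ≠ m)
    (h' : ℓ ≠ m') (he : lineCoord (L ℓ) (node L ℓ m) = lineCoord (L ℓ) (node L ℓ m')) : m = m' := by
  have h1 := eq_of_lineCoord ((ev_node_left hL h).trans (ev_node_left hL h').symm) he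
  rcases node_eq_node hL h h' h1 with h2 | h2
  · exact h2.2.symm
  · exact absurd h2.1 h

/-- There are `d - 1` nodes on the line, and at most one of them has no successor. -/
theorem le_card_notLast (hL : IsGenericArrangement L) (ℓ : Fin d) :
    d - 2 ≤ (notLast L ℓ).card := by
  have h1 : ((Finset.univ.erase ℓ) \ notLast L ℓ).card ≤ 1 := by
    refine Finset.card_le_one.2 fun i hi j hj => ?_
    simp only [notLast, Finset.mem_sdiff, Finset.mem_erase, Finset.mem_univ, and_true,
      Finset.mem_filter, true_and, not_and, not_exists, not_lt] at hi hj
    exact lineCoord_node_injective hL hi.1.symm hj.1.symm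
      (le_antisymm (hj.2 hj.1.symm i hi.1.symm) (hi.2 hi.1.symm j hj.1.symm))
  have h2 : (Finset.univ.erase ℓ).card = d - 1 := by
    rw [Finset.card_erase_of_mem (Finset.mem_univ _), Finset.card_univ, Fintype.card_fin]
  have h3 := Finset.card_le_card_sdiff_add_card (s := Finset.univ.erase ℓ) (t := notLast L ℓ)
  omega

theorem exists_isEdge_of_mem_notLast (hL : IsGenericArrangement L) {ℓ m : Fin d}
    (h : m ∈ notLast L ℓ) : ∃ m', IsEdge L ℓ m m' ∧
      lineCoord (L ℓ) (node L ℓ m) < lineCoord (L ℓ) (node L ℓ m') := by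
  simp only [notLast, Finset.mem_filter, Finset.mem_univ, true_and] at h
  obtain ⟨hm, i, hi, hi2⟩ := h
  obtain ⟨m', hm', hmin⟩ := (Finset.univ.filter fun i =>
    ℓ ≠ i ∧ lineCoord (L ℓ) (node L ℓ m) < lineCoord (L ℓ) (node L ℓ i)).exists_min_image
      (fun i => lineCoord (L ℓ) (node L ℓ i)) ⟨i, by simp [hi, hi2]⟩
  simp only [Finset.mem_filter, Finset.mem_univ, true_and] at hm' hmin
  exact ⟨m', isEdge_of_consecutive hL hm hm'.1 hm'.2 fun k hk hkI =>
    (hmin k ⟨hk, hkI.1⟩).not_gt hkI.2, hm'.2⟩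

/-- An arrangement of `d` lines in general position has at least `d * (d - 2)` bounded edges. -/
theorem le_encard_boundedEdges (hL : IsGenericArrangement L) :
    ((d * (d - 2) : ℕ) : ℕ∞) ≤ (boundedEdges L).encard := by
  have hex : ∀ x : (_ : Fin d) × Fin d, ∃ e : Set Plane, x.2 ∈ notLast L x.1 → ∃ m',
      IsEdge L x.1 x.2 m' ∧ lineCoord (L x.1) (node L x.1 x.2) < lineCoord (L x.1) (node L x.1 m') ∧
        e = openSegment ℝ (node L x.1 x.2) (node L x.1 m') := by
    intro x
    by_cases h : x.2 ∈ notLast L x.1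
    · obtain ⟨m', h1, h2⟩ := exists_isEdge_of_mem_notLast hL h
      exact ⟨_, fun _ => ⟨m', h1, h2, rfl⟩⟩
    · exact ⟨∅, fun h' => absurd h' h⟩
  choose e he using hex
  -- An edge determines its line, the only one vanishing on it, and its lower end, so it is counted
  -- once.
  have hinj : Set.InjOn e (Finset.univ.sigma (notLast L) : Set ((_ : Fin d) × Fin d)) := by
    rintro ⟨ℓ, m⟩ hx ⟨ℓ₁, m₁⟩ hx₁ hee
    simp only [Finset.mem_coe, Finset.mem_sigma, Finset.mem_univ, true_and] at hx hx₁
    obtain ⟨m', h1, h2, h3⟩ := he ⟨ℓ, m⟩ hx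
    obtain ⟨m₁', h1', h2', h3'⟩ := he ⟨ℓ₁, m₁⟩ hx₁
    rw [hee, h3'] at h3
    dsimp only at h1 h2 h3 h1' h2' h3'
    obtain ⟨z, hz⟩ : (openSegment ℝ (node L ℓ₁ m₁) (node L ℓ₁ m₁')).Nonempty :=
      ⟨_, 1 / 2, 1 / 2, by norm_num, by norm_num, by norm_num, rfl⟩
    have hℓ : ℓ₁ = ℓ := by
      by_contra hne
      exact h1.empty ℓ₁ hne z (h3 ▸ hz) (ev_eq_zero_of_mem_openSegment hL h1'.ne h1'.ne' hz)
    subst hℓ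
    have hcl := congrArg closure h3
    rw [closure_openSegment, closure_openSegment] at hcl
    have hle : ∀ {P Q P' Q' : Plane}, lineCoord (L ℓ₁) P < lineCoord (L ℓ₁) Q →
        segment ℝ P Q = segment ℝ P' Q' → lineCoord (L ℓ₁) P ≤ lineCoord (L ℓ₁) P' := by
      intro P Q P' Q' hPQ hs
      have hP' : P' ∈ segment ℝ P Q := hs ▸ left_mem_segment ℝ P' Q'
      obtain ⟨α, β, hα, hβ, hs, rfl⟩ := hP'
      rw [lineCoord_combo]
      have hα' : α = 1 - β := by linarith
      subst hα'
      nlinarith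
    rw [lineCoord_node_injective hL h1.ne h1'.ne
      (le_antisymm (hle h2 hcl.symm) (hle h2' hcl))]
  have hcard : ((d * (d - 2) : ℕ) : ℕ∞)
      ≤ (Finset.univ.sigma (notLast L) : Set ((_ : Fin d) × Fin d)).encard := by
    rw [Set.encard_coe_eq_coe_finsetCard, Finset.card_sigma, Nat.cast_le]
    have := Finset.card_nsmul_le_sum Finset.univ (fun ℓ => (notLast L ℓ).card) (d - 2)
      fun ℓ _ => le_card_notLast hL ℓ
    simpa using this
  refine hcard.trans ?_
  rw [← hinj.encard_image]
  apply Set.encard_le_encard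
  rintro _ ⟨x, hx, rfl⟩
  simp only [Finset.mem_coe, Finset.mem_sigma, Finset.mem_univ, true_and] at hx
  obtain ⟨m', h1, -, h3⟩ := he x hx
  rw [h3]
  exact h1.mem_boundedEdges hL

end

section



variable {d : ℕ} {L : Fin d → LineEq}

/-! ### Level curves of a product of linear polynomials in a sector -/

theorem ev_arrangementPoly (L : Fin d → LineEq) (x : Plane) :
    ev (arrangementPoly L) x = ∏ k, ev (L k).poly x := ev_prod _ _ _

/-- A small convex neighbourhood `U` of a compact part `K` of the line `ℓ` of an arrangement. -/
structure Stadium (L : Fin d → LineEq) (U K : Set Plane) (ℓ : Fin d) : Prop where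
  isOpen : IsOpen U
  convex : Convex ℝ U
  bounded : Bornology.IsBounded U
  subset : K ⊆ U
  compact : IsCompact K
  zero : ∀ b ∈ K, ev (L ℓ).poly b = 0
  near : ∀ z ∈ U, ∃ b ∈ K, ∀ k, ev (L k).poly b = 0 ∨
    |ev (L k).poly z - ev (L k).poly b| < |ev (L k).poly b| / (2 * d)

/-- The part of `U` where all the linear polynomials are positive. -/
def sector (L : Fin d → LineEq) (U : Set Plane) : Set Plane := {x ∈ U | ∀ k, 0 < ev (L k).poly x}

/-- The part of a level curve in the sector. -/
def level (L : Fin d → LineEq) (U : Set Plane) (ε : ℝ) : Set Plane :=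
  {x ∈ sector L U | ev (arrangementPoly L) x = ε}

theorem convex_sector {U : Set Plane} (hU : Convex ℝ U) : Convex ℝ (sector L U) := by
  intro x hx y hy α β hα hβ hs
  refine ⟨hU hx.1 hy.1 hα hβ hs, fun k => ?_⟩
  rw [ev_linePoly_combo _ hs]
  have h1 := hx.2 k
  have h2 := hy.2 k
  rcases hα.eq_or_lt with rfl | hα'
  · rw [zero_add] at hs; rw [hs]; linarith
  · have := mul_pos hα' h1
    have := mul_nonneg hβ h2.le
    linarith

theorem isOpen_sector {U : Set Plane} (hU : IsOpen U) : IsOpen (sector L U) := by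
  have : sector L U = U ∩ ⋂ k, {x | 0 < ev (L k).poly x} := by
    ext x; simp [sector]
  rw [this]
  exact hU.inter (isOpen_iInter_of_finite fun k => isOpen_lt continuous_const (continuous_ev _))

theorem sector_pos {U : Set Plane} {x : Plane} (hx : x ∈ sector L U) :
    0 < ev (arrangementPoly L) x := by
  rw [ev_arrangementPoly]
  exact Finset.prod_pos fun k _ => hx.2 k

/-- Logarithmic concavity of the product along a segment. -/
theorem lt_ev_combo {U : Set Plane} {x O : Plane} {ε t : ℝ} (hx : x ∈ sector L U)
    (hO : O ∈ sector L U) (hε : 0 < ε) (h1 : ε ≤ ev (arrangementPoly L) x)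
    (h2 : ε < ev (arrangementPoly L) O) (ht : 0 < t) (ht1 : t ≤ 1) :
    ε < ev (arrangementPoly L) ((1 - t) • x + t • O) := by
  have hs : 1 - t + t = 1 := by ring
  have h3 : ev (arrangementPoly L) x ^ (1 - t) * ev (arrangementPoly L) O ^ t
      ≤ ev (arrangementPoly L) ((1 - t) • x + t • O) := by
    rw [ev_arrangementPoly, ev_arrangementPoly, ev_arrangementPoly,
      ← Real.finsetProd_rpow _ _ fun k _ => (hx.2 k).le,
      ← Real.finsetProd_rpow _ _ fun k _ => (hO.2 k).le, ← Finset.prod_mul_distrib]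
    refine Finset.prod_le_prod (fun k _ => ?_) fun k _ => ?_
    · exact mul_nonneg (Real.rpow_nonneg (hx.2 k).le _) (Real.rpow_nonneg (hO.2 k).le _)
    · rw [ev_linePoly_combo _ hs]
      exact Real.geom_mean_le_arith_mean2_weighted (by linarith) ht.le (hx.2 k).le (hO.2 k).le hs
  calc ε = ε ^ (1 - t) * ε ^ t := by rw [← Real.rpow_add hε, hs, Real.rpow_one]
    _ < ev (arrangementPoly L) x ^ (1 - t) * ev (arrangementPoly L) O ^ t := by
        apply mul_lt_mul' (Real.rpow_le_rpow hε.le h1 (by linarith))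
          (Real.rpow_lt_rpow hε.le h2 ht) (Real.rpow_nonneg hε.le _)
        exact Real.rpow_pos_of_pos (hε.trans_le h1) _
    _ ≤ _ := h3

/-- The concavity estimate restarted from parameter `s`: once the level `ε` is reached on the way to
`O`, the product stays above it. -/
theorem lt_ev_combo_of_lt {U : Set Plane} (hU : Convex ℝ U) {x O : Plane} {ε s t : ℝ}
    (hx : x ∈ sector L U) (hO : O ∈ sector L U) (hε : 0 < ε) (hs : 0 ≤ s)
    (h1 : ε ≤ ev (arrangementPoly L) ((1 - s) • x + s • O))
    (h2 : ε < ev (arrangementPoly L) O) (hst : s < t) (ht1 : t ≤ 1) :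
    ε < ev (arrangementPoly L) ((1 - t) • x + t • O) := by
  have hs1 : 0 < 1 - s := by linarith
  have hxs : (1 - s) • x + s • O ∈ sector L U :=
    convex_sector hU hx hO (by linarith) hs (by ring)
  have := lt_ev_combo (t := (t - s) / (1 - s)) hxs hO hε h1 h2 (div_pos (by linarith) hs1)
    (by rw [div_le_one hs1]; linarith)
  convert this using 2
  ext i
  simp
  field_simp
  ring

/-- The level curve is connected if the sublevel set is. -/
theorem isPreconnected_level {U : Set Plane} (hU : Convex ℝ U) (hUo : IsOpen U) {O : Plane}
    {ε : ℝ} (hO : O ∈ sector L U) (hε : 0 < ε) (h2 : ε < ev (arrangementPoly L) O)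
    (hZ : IsPreconnected {z ∈ sector L U | ev (arrangementPoly L) z < ε}) :
    IsPreconnected (level L U ε) := by
  set g := ev (arrangementPoly L) with hg
  have hgc : Continuous g := continuous_ev _
  set Z := {z ∈ sector L U | g z < ε} with hZdef
  have hpath (z : Plane) : Continuous fun t : ℝ => (1 - t) • z + t • O := by fun_prop
  -- Each segment from a point `z` of the sublevel set to `O` crosses the level exactly once, at
  -- parameter `τ z`. The crossing point depends continuously on `z`, so the level curve is a
  -- continuous image of the sublevel set.
  have hex : ∀ z ∈ Z, ∃ t ∈ Set.Ioo (0 : ℝ) 1, g ((1 - t) • z + t • O) = ε := by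
    intro z hz
    have h3 : ε ∈ Set.Ioo (g ((1 - (0 : ℝ)) • z + (0 : ℝ) • O))
        (g ((1 - (1 : ℝ)) • z + (1 : ℝ) • O)) := by
      simp only [sub_zero, one_smul, zero_smul, add_zero, sub_self, zero_add]
      exact ⟨hz.2, h2⟩
    obtain ⟨t, ht, h⟩ := intermediate_value_Ioo zero_le_one
      (hgc.comp (hpath z)).continuousOn h3
    exact ⟨t, ht, h⟩
  choose! τ hτ hτε using hex
  have huniq : ∀ z ∈ Z, ∀ t, 0 ≤ t → t ≤ 1 → g ((1 - t) • z + t • O) = ε → t = τ z := by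
    intro z hz t ht ht1 h3
    rcases lt_trichotomy t (τ z) with h | h | h
    · have := lt_ev_combo_of_lt hU hz.1 hO hε ht h3.ge h2 h (hτ z hz).2.le
      exact absurd (hτε z hz) this.ne'
    · exact h
    · have := lt_ev_combo_of_lt hU hz.1 hO hε (hτ z hz).1.le (hτε z hz).ge h2 h ht1
      exact absurd h3 this.ne'
  have hτc : ContinuousOn τ Z := by
    intro z₀ hz₀
    have h0 := hτ z₀ hz₀
    rw [ContinuousWithinAt, tendsto_order]
    have hc (t : ℝ) : Continuous fun z : Plane => g ((1 - t) • z + t • O) := by fun_prop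
    constructor
    · intro t₁ ht₁
      have h3 : max t₁ 0 < τ z₀ := max_lt ht₁ h0.1
      have h4 : g ((1 - max t₁ 0) • z₀ + max t₁ 0 • O) < ε := by
        by_contra hn
        have := lt_ev_combo_of_lt hU hz₀.1 hO hε (le_max_right _ _) (not_lt.1 hn) h2 h3 h0.2.le
        exact absurd (hτε z₀ hz₀) this.ne'
      filter_upwards [nhdsWithin_le_nhds ((hc _).continuousAt.eventually_lt_const h4),
        self_mem_nhdsWithin] with z hz hzZ
      apply (le_max_left t₁ 0).trans_lt
      by_contra hn
      rcases (not_lt.1 hn).eq_or_lt with h5 | h5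
      · rw [← h5, hτε z hzZ] at hz; exact lt_irrefl _ hz
      · have := lt_ev_combo_of_lt hU hzZ.1 hO hε (hτ z hzZ).1.le (hτε z hzZ).ge h2 h5
          (h3.le.trans h0.2.le)
        exact absurd hz this.not_gt
    · intro t₂ ht₂
      have h3 : τ z₀ < min t₂ 1 := lt_min ht₂ h0.2
      have h4 : ε < g ((1 - min t₂ 1) • z₀ + min t₂ 1 • O) :=
        lt_ev_combo_of_lt hU hz₀.1 hO hε h0.1.le (hτε z₀ hz₀).ge h2 h3 (min_le_right _ _)
      filter_upwards [nhdsWithin_le_nhds ((hc _).continuousAt.eventually_const_lt h4),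
        self_mem_nhdsWithin] with z hz hzZ
      refine lt_of_lt_of_le ?_ (min_le_left t₂ 1)
      by_contra hn
      rcases (not_lt.1 hn).eq_or_lt with h5 | h5
      · rw [h5, hτε z hzZ] at hz; exact lt_irrefl _ hz
      · have := lt_ev_combo_of_lt hU hzZ.1 hO hε (h0.1.le.trans h3.le) hz.le h2 h5
          (hτ z hzZ).2.le
        exact absurd (hτε z hzZ) this.ne'
  -- Surjectivity: a point of the level curve, pushed slightly away from `O`, stays in the open
  -- sector and falls below the level.
  have himg : level L U ε = (fun z => (1 - τ z) • z + τ z • O) '' Z := by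
    apply Set.Subset.antisymm
    · intro y hy
      have h3 : ∀ᶠ s : ℝ in 𝓝 0, (1 + s) • y - s • O ∈ sector L U := by
        have hc : Continuous fun s : ℝ => (1 + s) • y - s • O := by fun_prop
        apply hc.continuousAt.eventually_mem
        apply (isOpen_sector hUo).mem_nhds
        simpa using hy.1
      obtain ⟨s, hs, hs0⟩ := ((eventually_nhdsWithin_of_eventually_nhds (s := Set.Ioi 0) h3).and
        self_mem_nhdsWithin).exists
      have hs0 : 0 < s := hs0
      have hyz : y = (1 - s / (1 + s)) • ((1 + s) • y - s • O) + (s / (1 + s)) • O := by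
        ext i; simp; field_simp; ring
      have hd1 : s / (1 + s) ≤ 1 := by rw [div_le_one (by linarith)]; linarith
      have hzZ : (1 + s) • y - s • O ∈ Z := by
        refine ⟨hs, ?_⟩
        by_contra hn
        have := lt_ev_combo hs hO hε (not_lt.1 hn) h2 (t := s / (1 + s)) (by positivity) hd1
        rw [← hyz] at this
        exact absurd hy.2 this.ne'
      refine ⟨_, hzZ, ?_⟩
      have h4 := huniq _ hzZ (s / (1 + s)) (by positivity) hd1 (by rw [← hyz]; exact hy.2)
      beta_reduce
      rw [← h4, ← hyz]
    · rintro _ ⟨z, hz, rfl⟩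
      exact ⟨convex_sector hU hz.1 hO (by linarith [(hτ z hz).2]) (hτ z hz).1.le (by ring),
        hτε z hz⟩
  rw [himg]
  apply hZ.image
  have hid : ContinuousOn (fun z : Plane => z) Z := continuousOn_id
  exact ((continuousOn_const.sub hτc).smul hid).add (hτc.smul continuousOn_const)

namespace Stadium

variable {U K : Set Plane} {ℓ : Fin d}

theorem exists_bound (h : Stadium L U K ℓ) : ∃ B, 1 ≤ B ∧ ∀ x ∈ U, ∀ k, ev (L k).poly x ≤ B := by
  have h1 : ∀ k, ∃ B, ∀ x ∈ U, ev (L k).poly x ≤ B := by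
    intro k
    obtain ⟨B, hB⟩ := h.bounded.isCompact_closure.exists_bound_of_continuousOn
      (continuous_ev (L k).poly).continuousOn
    exact ⟨B, fun x hx => (le_abs_self _).trans (hB x (subset_closure hx))⟩
  choose B hB using h1
  refine ⟨1 + ∑ k, |B k|, ?_, fun x hx k => ?_⟩
  · have : 0 ≤ ∑ k, |B k| := Finset.sum_nonneg fun k _ => abs_nonneg _
    linarith
  · have := Finset.single_le_sum (f := fun k => |B k|) (fun k _ => abs_nonneg _)
      (Finset.mem_univ k)
    have h2 := hB k x hx
    have h3 := le_abs_self (B k)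
    linarith

/-- The product decreases along suitable segments towards `K`. -/
theorem exists_segment (h : Stadium L U K ℓ) {z : Plane} (hz : z ∈ sector L U) :
    ∃ b ∈ K, ∀ t ∈ Set.Ioc (0 : ℝ) 1, (1 - t) • b + t • z ∈ sector L U ∧
      ev (arrangementPoly L) ((1 - t) • b + t • z) ≤ ev (arrangementPoly L) z ∧
      ev (L ℓ).poly ((1 - t) • b + t • z) = t * ev (L ℓ).poly z := by
  obtain ⟨b, hb, hk⟩ := h.near z hz.1
  have hd : 0 < (d : ℝ) := Nat.cast_pos.2 (Fin.pos ℓ)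
  have hd1 : (1 : ℝ) ≤ d := Nat.one_le_cast.2 (Fin.pos ℓ)
  refine ⟨b, hb, fun t ht => ?_⟩
  have hs : 1 - t + t = 1 := by ring
  have hzero : ∀ k, ev (L k).poly b = 0 →
      ev (L k).poly ((1 - t) • b + t • z) = t * ev (L k).poly z := by
    intro k h0
    rw [ev_linePoly_combo _ hs, h0, mul_zero, zero_add]
  -- A factor not vanishing at `b` is positive there, and moving from `z` to `b` increases it by at
  -- most the fraction `1 / d`; the constant `2 * d` in `Stadium.near` is made for this.
  have hsign : ∀ k, ev (L k).poly b ≠ 0 → 0 < ev (L k).poly b ∧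
      ev (L k).poly b - ev (L k).poly z ≤ ev (L k).poly z / d := by
    intro k h0
    have h1 := (hk k).resolve_left h0
    have h2 := abs_lt.1 h1
    have h3 : |ev (L k).poly b| / (2 * d) ≤ |ev (L k).poly b| / 2 := by
      apply div_le_div_of_nonneg_left (abs_nonneg _) (by norm_num) (by linarith)
    have h4 := hz.2 k
    have h5 : 0 < ev (L k).poly b := by
      by_contra hn
      rw [abs_of_nonpos (not_lt.1 hn)] at h2 h3
      linarith [h2.2, not_lt.1 hn]
    refine ⟨h5, ?_⟩
    rw [abs_of_pos h5] at h2 h3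
    have h6 : ev (L k).poly b / (2 * d) ≤ ev (L k).poly z / d := by
      rw [div_le_div_iff₀ (by positivity) hd]
      nlinarith [h2.1]
    linarith [h2.1]
  have hmem : (1 - t) • b + t • z ∈ sector L U := by
    refine ⟨h.convex (h.subset hb) hz.1 (by linarith [ht.2]) ht.1.le hs, fun k => ?_⟩
    by_cases h0 : ev (L k).poly b = 0
    · rw [hzero k h0]; exact mul_pos ht.1 (hz.2 k)
    · rw [ev_linePoly_combo _ hs]
      have h1 := mul_pos ht.1 (hz.2 k)
      have h2 := mul_nonneg (sub_nonneg.2 ht.2) (hsign k h0).1.le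
      linarith
  refine ⟨hmem, ?_, hzero ℓ (h.zero b hb)⟩
  have ht1 : 0 ≤ 1 - t := by linarith [ht.2]
  -- Every factor grows by at most `exp ((1 - t) / d)`, and the factor of `ℓ` is multiplied by `t ≤
  -- exp (-(1 - t))`. Over all `d` factors the exponentials cancel.
  have hfac : ∀ k, ev (L k).poly ((1 - t) • b + t • z)
      ≤ (Real.exp ((1 - t) / d) * if k = ℓ then Real.exp (-(1 - t)) else 1)
        * ev (L k).poly z := by
    intro k
    have h4 := hz.2 k
    have h6 : 1 + (1 - t) / d ≤ Real.exp ((1 - t) / d) := by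
      linarith [Real.add_one_le_exp ((1 - t) / d)]
    have h5 : (1 : ℝ) ≤ Real.exp ((1 - t) / d) := Real.one_le_exp (by positivity)
    split_ifs with hkℓ
    · subst hkℓ
      rw [hzero k (h.zero b hb)]
      apply mul_le_mul_of_nonneg_right _ h4.le
      have h7 : t ≤ Real.exp (-(1 - t)) := by linarith [Real.add_one_le_exp (-(1 - t))]
      calc t = 1 * t := (one_mul t).symm
        _ ≤ _ := mul_le_mul h5 h7 ht.1.le (by linarith)
    · rw [mul_one]
      by_cases h0 : ev (L k).poly b = 0
      · rw [hzero k h0]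
        apply mul_le_mul_of_nonneg_right _ h4.le
        linarith [ht.2]
      · rw [ev_linePoly_combo _ hs]
        have h7 := mul_le_mul_of_nonneg_left (hsign k h0).2 ht1
        have h8 := mul_le_mul_of_nonneg_right h6 h4.le
        have h9 : (1 + (1 - t) / d) * ev (L k).poly z
            = ev (L k).poly z + (1 - t) * (ev (L k).poly z / d) := by ring
        linarith
  rw [ev_arrangementPoly, ev_arrangementPoly]
  calc ∏ k, ev (L k).poly ((1 - t) • b + t • z)
      ≤ ∏ k, (Real.exp ((1 - t) / d) * if k = ℓ then Real.exp (-(1 - t)) else 1)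
        * ev (L k).poly z := Finset.prod_le_prod (fun k _ => (hmem.2 k).le) fun k _ => hfac k
    _ = ∏ k, ev (L k).poly z := by
        rw [Finset.prod_mul_distrib, Finset.prod_mul_distrib, Finset.prod_const,
          Finset.prod_ite_eq' Finset.univ ℓ, if_pos (Finset.mem_univ _), Finset.card_univ,
          Fintype.card_fin, ← Real.exp_nat_mul, mul_div_cancel₀ _ hd.ne', ← Real.exp_add,
          add_neg_cancel, Real.exp_zero, one_mul]

/-- The segments of `exists_segment` join every point of the sublevel set, without leaving it, to
the convex part `N` of the sector close to the line `ℓ`. There the other `d - 1` factors are at most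
`B`, so the product is below `ε`. -/
theorem isPreconnected_sublevel (h : Stadium L U K ℓ) {ε : ℝ} (hε : 0 < ε) :
    IsPreconnected {z ∈ sector L U | ev (arrangementPoly L) z < ε} := by
  obtain ⟨B, hB1, hB⟩ := h.exists_bound
  have hBp : 0 < B ^ (d - 1) := by positivity
  set N : Set Plane := {z ∈ sector L U | ev (L ℓ).poly z < ε / B ^ (d - 1)} with hN
  have hNc : Convex ℝ N := by
    intro x hx y hy α β hα hβ hs
    refine ⟨convex_sector h.convex hx.1 hy.1 hα hβ hs, ?_⟩
    rw [ev_linePoly_combo _ hs]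
    have hα' : α = 1 - β := by linarith
    subst hα'
    have h1 := hx.2
    have h2 := hy.2
    rcases hβ.eq_or_lt with rfl | hβ'
    · linarith
    · have := mul_le_mul_of_nonneg_left h1.le hα
      have := mul_lt_mul_of_pos_left h2 hβ'
      linarith
  have hNZ : N ⊆ {z ∈ sector L U | ev (arrangementPoly L) z < ε} := by
    intro z hz
    refine ⟨hz.1, ?_⟩
    rw [ev_arrangementPoly, ← Finset.mul_prod_erase _ _ (Finset.mem_univ ℓ)]
    have h1 : ∏ k ∈ Finset.univ.erase ℓ, ev (L k).poly z ≤ B ^ (d - 1) := by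
      refine (Finset.prod_le_prod (fun k _ => (hz.1.2 k).le) fun k _ => hB z hz.1.1 k).trans ?_
      rw [Finset.prod_const, Finset.card_erase_of_mem (Finset.mem_univ _), Finset.card_univ,
        Fintype.card_fin]
    calc ev (L ℓ).poly z * ∏ k ∈ Finset.univ.erase ℓ, ev (L k).poly z
        ≤ ev (L ℓ).poly z * B ^ (d - 1) := mul_le_mul_of_nonneg_left h1 (hz.1.2 ℓ).le
      _ < ε := (lt_div_iff₀ hBp).1 hz.2
  have hseg : ∀ z ∈ {z ∈ sector L U | ev (arrangementPoly L) z < ε},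
      ∃ S ⊆ {z ∈ sector L U | ev (arrangementPoly L) z < ε}, IsPreconnected S ∧ z ∈ S ∧
        (S ∩ N).Nonempty := by
    intro z hz
    obtain ⟨b, hb, hbt⟩ := h.exists_segment hz.1
    refine ⟨(fun t : ℝ => (1 - t) • b + t • z) '' Set.Ioc 0 1, ?_, ?_, ⟨1, by simp, by simp⟩, ?_⟩
    · rintro _ ⟨t, ht, rfl⟩
      exact ⟨(hbt t ht).1, (hbt t ht).2.1.trans_lt hz.2⟩
    · exact isPreconnected_Ioc.image _ (by fun_prop)
    · have h1 : Continuous fun t : ℝ => t * ev (L ℓ).poly z := by fun_prop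
      have h2 : ∀ᶠ t in 𝓝 (0 : ℝ), t * ev (L ℓ).poly z < ε / B ^ (d - 1) := by
        apply h1.continuousAt.eventually_lt_const
        simp only [zero_mul]; positivity
      obtain ⟨t, ht, ht1⟩ := ((eventually_nhdsWithin_of_eventually_nhds (s := Set.Ioi 0) h2).and
        (Ioc_mem_nhdsGT zero_lt_one)).exists
      refine ⟨_, ⟨t, ht1, rfl⟩, (hbt t ht1).1, ?_⟩
      rw [(hbt t ht1).2.2]
      exact ht
  rcases Set.eq_empty_or_nonempty {z ∈ sector L U | ev (arrangementPoly L) z < ε} with h0 | ⟨z₀, h0⟩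
  · rw [h0]; exact isPreconnected_empty
  · obtain ⟨S₀, -, -, -, x, hx⟩ := hseg z₀ h0
    refine isPreconnected_of_forall x fun z hz => ?_
    obtain ⟨S, hS, hSc, hzS, hne⟩ := hseg z hz
    exact ⟨S ∪ N, Set.union_subset hS hNZ, Or.inr hx.2, Or.inl hzS,
      hSc.union' hne hNc.isPreconnected⟩

end Stadium

end

section



variable {d : ℕ} {L : Fin d → LineEq}

/-! ### Hausdorff convergence of the level curves to the boundary of a sector. -/

theorem _root_.IsPreconnected.exists_mem_frontier {α : Type*} [TopologicalSpace α] {s t : Set α}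
    (hs : IsPreconnected s) {x y : α} (hxs : x ∈ s) (hx : x ∈ t) (hys : y ∈ s) (hy : y ∉ t) :
    ∃ b ∈ s, b ∈ frontier t := by
  by_contra! h
  have hcl : ∀ z ∈ s, z ∈ closure t → z ∈ interior t := fun z hz hc => by
    by_contra hi
    exact h z hz ⟨hc, hi⟩
  obtain ⟨z, -, hz, hz'⟩ := hs (interior t) (closure t)ᶜ isOpen_interior
    isClosed_closure.isOpen_compl (fun z hz => or_iff_not_imp_right.2 fun hc =>
      hcl z hz (not_not.1 hc)) ⟨x, hxs, hcl x hxs (subset_closure hx)⟩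
    ⟨y, hys, fun hc => hy (interior_subset (hcl y hys hc))⟩
  exact hz' (interior_subset.trans subset_closure hz)

namespace Stadium

variable {U K : Set Plane} {ℓ : Fin d}

theorem exists_dist_le (h : Stadium L U K ℓ) : ∃ M, 0 < M ∧ ∀ x ∈ U, ∀ y ∈ U, dist x y ≤ M := by
  obtain ⟨M, hM⟩ := Metric.isBounded_iff.1 h.bounded
  exact ⟨max M 1, by positivity, fun x hx y hy => (hM hx hy).trans (le_max_left _ _)⟩

theorem dist_combo (x y : Plane) {t : ℝ} (ht : 0 ≤ t) :
    dist x ((1 - t) • x + t • y) = t * dist x y := by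
  rw [dist_eq_norm, dist_eq_norm]
  have : x - ((1 - t) • x + t • y) = t • (x - y) := by
    ext i; simp; ring
  rw [this, norm_smul, Real.norm_of_nonneg ht]

theorem frontier_sector (h : Stadium L U K ℓ) {b : Plane} (hb : b ∈ frontier (sector L U) ∩ U) :
    (∀ k, 0 ≤ ev (L k).poly b) ∧ ev (arrangementPoly L) b = 0 := by
  have h1 : ∀ k, 0 ≤ ev (L k).poly b := fun k => by
    have hc : IsClosed {x | 0 ≤ ev (L k).poly x} := isClosed_le continuous_const (continuous_ev _)
    exact closure_minimal (fun x hx => (hx.2 k).le) hc (frontier_subset_closure hb.1)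
  refine ⟨h1, ?_⟩
  have h2 : b ∉ sector L U := by
    have := hb.1
    rw [(isOpen_sector h.isOpen).frontier_eq] at this
    exact this.2
  have h3 : ∃ k, ev (L k).poly b = 0 := by
    by_contra hn
    push Not at hn
    exact h2 ⟨hb.2, fun k => lt_of_le_of_ne (h1 k) (hn k).symm⟩
  obtain ⟨k, hk⟩ := h3
  rw [ev_arrangementPoly]
  exact Finset.prod_eq_zero (Finset.mem_univ k) hk

/-- Every boundary point of the sector is close to the level curves of small level. -/
theorem eventually_frontier_near (h : Stadium L U K ℓ) {O : Plane} (hO : O ∈ sector L U) {ρ : ℝ}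
    (hρ : 0 < ρ) : ∀ᶠ ε in 𝓝[>] (0 : ℝ), ∀ b ∈ frontier (sector L U) ∩ U,
      ∃ y ∈ level L U ε, dist b y ≤ ρ := by
  obtain ⟨M, hM0, hM⟩ := h.exists_dist_le
  have hgO := sector_pos hO
  set t₁ := min 1 (ρ / M) with ht₁
  have ht0 : 0 < t₁ := lt_min one_pos (by positivity)
  filter_upwards [Ioo_mem_nhdsGT (show 0 < t₁ ^ d * ev (arrangementPoly L) O by positivity)]
    with ε hε b hb
  obtain ⟨h1, h2⟩ := h.frontier_sector hb
  -- At parameter `t` on the way from `b` to `O` every factor is at least `t` times its value at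
  -- `O`. The level is thus reached before `t₁`, within distance `ρ` of `b`.
  have hmem : ∀ t, 0 < t → t ≤ 1 → (1 - t) • b + t • O ∈ sector L U ∧
      t ^ d * ev (arrangementPoly L) O ≤ ev (arrangementPoly L) ((1 - t) • b + t • O) := by
    intro t ht htle
    have hs : 1 - t + t = 1 := by ring
    have hk : ∀ k, t * ev (L k).poly O ≤ ev (L k).poly ((1 - t) • b + t • O) := by
      intro k
      rw [ev_linePoly_combo _ hs]
      have := mul_nonneg (sub_nonneg.2 htle) (h1 k)
      linarith
    refine ⟨⟨h.convex hb.2 hO.1 (by linarith) ht.le hs, fun k =>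
      (mul_pos ht (hO.2 k)).trans_le (hk k)⟩, ?_⟩
    rw [ev_arrangementPoly, ev_arrangementPoly]
    calc t ^ d * ∏ k, ev (L k).poly O = ∏ k, t * ev (L k).poly O := by
          rw [Finset.prod_mul_distrib, Finset.prod_const, Finset.card_univ, Fintype.card_fin]
      _ ≤ _ := Finset.prod_le_prod (fun k _ => (mul_pos ht (hO.2 k)).le) fun k _ => hk k
  have hc : Continuous fun t : ℝ => ev (arrangementPoly L) ((1 - t) • b + t • O) :=
    (continuous_ev _).comp (by fun_prop)
  obtain ⟨t, ht, hte⟩ := intermediate_value_Ioo ht0.le hc.continuousOn (show ε ∈ Set.Ioo _ _ from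
    ⟨by simpa [h2] using hε.1, hε.2.trans_le (hmem t₁ ht0 (min_le_left _ _)).2⟩)
  have ht1 : t ≤ 1 := ht.2.le.trans (min_le_left _ _)
  refine ⟨_, ⟨(hmem t ht.1 ht1).1, hte⟩, ?_⟩
  rw [dist_combo _ _ ht.1.le]
  calc t * dist b O ≤ ρ / M * M :=
        mul_le_mul (ht.2.le.trans (min_le_right _ _)) (hM b hb.2 O hO.1) dist_nonneg (by positivity)
    _ = ρ := div_mul_cancel₀ _ hM0.ne'

theorem exists_frontier_of_notMem (h : Stadium L U K ℓ) {x y : Plane} (hx : x ∈ sector L U)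
    (hyU : y ∈ U) (hy : y ∉ sector L U) :
    ∃ b ∈ frontier (sector L U) ∩ U, dist x b ≤ dist x y := by
  obtain ⟨b, hb, hbf⟩ := (convex_segment x y).isPreconnected.exists_mem_frontier
    (left_mem_segment ℝ x y) hx (right_mem_segment ℝ x y) hy
  refine ⟨b, ⟨hbf, h.convex.segment_subset hx.1 hyU hb⟩, ?_⟩
  obtain ⟨α, β, hα, hβ, hs, rfl⟩ := hb
  have hα' : α = 1 - β := by linarith
  subst hα'
  rw [dist_combo _ _ hβ]
  have := dist_nonneg (x := x) (y := y)
  nlinarith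

/-- Where one of the linear polynomials is small, the boundary of the sector is near. -/
theorem eventually_frontier_of_lt (h : Stadium L U K ℓ) {ρ : ℝ} (hρ : 0 < ρ) (k : Fin d) :
    ∀ᶠ τ in 𝓝[>] (0 : ℝ), ∀ x ∈ sector L U, ev (L k).poly x < τ →
      ∃ b ∈ frontier (sector L U) ∩ U, dist x b ≤ ρ := by
  obtain ⟨M, hM0, hM⟩ := h.exists_dist_le
  -- If the factor is negative somewhere in `U`, the segment towards such a point leaves the sector
  -- quickly. Otherwise its line misses the open set `U`, the factor is bounded below on the sector,
  -- and the claim is void for small `τ`.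
  by_cases hz : ∃ z ∈ U, ev (L k).poly z < 0
  · obtain ⟨z, hzU, hz0⟩ := hz
    have hpos : 0 < -ev (L k).poly z * ρ / M := by
      have : 0 < -ev (L k).poly z := by linarith
      positivity
    filter_upwards [Ioo_mem_nhdsGT hpos] with τ hτ x hx hxτ
    have hx0 := hx.2 k
    set α := ev (L k).poly x with hα
    set β := ev (L k).poly z with hβ
    have hab : 0 < α - β := by linarith
    have hs : 1 - α / (α - β) + α / (α - β) = 1 := by ring
    have ht0 : 0 ≤ α / (α - β) := (div_pos hx0 hab).le
    have ht1 : α / (α - β) ≤ 1 := by rw [div_le_one hab]; linarith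
    have hy0 : ev (L k).poly ((1 - α / (α - β)) • x + (α / (α - β)) • z) = 0 := by
      rw [ev_linePoly_combo _ hs, ← hα, ← hβ]
      field_simp
      ring
    obtain ⟨b, hb, hd⟩ := h.exists_frontier_of_notMem hx
      (h.convex hx.1 hzU (by linarith) ht0 hs) (fun hm => (hm.2 k).ne' hy0)
    refine ⟨b, hb, hd.trans ?_⟩
    rw [dist_combo _ _ ht0]
    have h1 : α / (α - β) ≤ ρ / M := by
      rw [div_le_div_iff₀ hab hM0]
      have h2 := hxτ.trans hτ.2
      rw [lt_div_iff₀ hM0] at h2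
      nlinarith
    calc α / (α - β) * dist x z ≤ ρ / M * M :=
          mul_le_mul h1 (hM x hx.1 z hzU) dist_nonneg (by positivity)
      _ = ρ := div_mul_cancel₀ _ hM0.ne'
  · push Not at hz
    -- the line does not meet `U`
    have hne : ∀ z ∈ K, ev (L k).poly z ≠ 0 := by
      intro z hzK h0
      have hcont : Continuous fun t : ℝ => z + t • !₂[-(L k).a, -(L k).b] := by fun_prop
      have h1 : ∀ᶠ t : ℝ in 𝓝 0, z + t • !₂[-(L k).a, -(L k).b] ∈ U := by
        apply hcont.continuousAt.eventually_mem
        apply h.isOpen.mem_nhds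
        simpa using h.subset hzK
      obtain ⟨t, ht, ht0⟩ := ((eventually_nhdsWithin_of_eventually_nhds (s := Set.Ioi 0) h1).and
        self_mem_nhdsWithin).exists
      have ht0 : 0 < t := ht0
      have h2 := hz _ ht
      have h3 := sq_add_sq_pos (L k)
      have h4 : ev (L k).poly (z + t • !₂[-(L k).a, -(L k).b])
          = ev (L k).poly z - t * ((L k).a ^ 2 + (L k).b ^ 2) := by
        rw [ev_linePoly, ev_linePoly]; simp; ring
      rw [h4, h0] at h2
      have := mul_pos ht0 h3
      linarith
    rcases K.eq_empty_or_nonempty with hK | hK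
    · filter_upwards with τ x hx
      obtain ⟨b, hb, -⟩ := h.near x hx.1
      rw [hK] at hb
      exact absurd hb (Set.notMem_empty _)
    obtain ⟨b₀, hb₀, hmin⟩ := h.compact.exists_isMinOn hK
      (continuous_ev (L k).poly).abs.continuousOn
    have hpos : 0 < |ev (L k).poly b₀| / 2 := by
      have := abs_pos.2 (hne b₀ hb₀)
      positivity
    filter_upwards [Ioo_mem_nhdsGT hpos] with τ hτ x hx hxτ
    exfalso
    obtain ⟨b, hb, hk⟩ := h.near x hx.1
    have h1 := (hk k).resolve_left (hne b hb)
    have h2 : |ev (L k).poly b₀| ≤ |ev (L k).poly b| := hmin hb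
    have hd1 : (1 : ℝ) ≤ d := Nat.one_le_cast.2 (Fin.pos ℓ)
    have h3 : |ev (L k).poly b| / (2 * d) ≤ |ev (L k).poly b| / 2 :=
      div_le_div_of_nonneg_left (abs_nonneg _) (by norm_num) (by linarith)
    have h4 : |ev (L k).poly b| - |ev (L k).poly x| ≤ |ev (L k).poly x - ev (L k).poly b| := by
      rw [abs_sub_comm]; exact abs_sub_abs_le_abs_sub _ _
    rw [abs_of_pos (hx.2 k)] at h4
    linarith [hτ.2]

/-- The level curves of small level are close to the boundary of the sector. -/
theorem eventually_level_near (h : Stadium L U K ℓ) {ρ : ℝ} (hρ : 0 < ρ) :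
    ∀ᶠ ε in 𝓝[>] (0 : ℝ), ∀ x ∈ level L U ε,
      ∃ b ∈ frontier (sector L U) ∩ U, dist x b ≤ ρ := by
  have h1 : ∀ᶠ τ in 𝓝[>] (0 : ℝ), ∀ k, ∀ x ∈ sector L U, ev (L k).poly x < τ →
      ∃ b ∈ frontier (sector L U) ∩ U, dist x b ≤ ρ := by
    rw [eventually_all]
    exact h.eventually_frontier_of_lt hρ
  obtain ⟨τ, hτ, hτ0⟩ := (h1.and self_mem_nhdsWithin).exists
  have hτ0 : 0 < τ := hτ0
  filter_upwards [Ioo_mem_nhdsGT (show 0 < τ ^ d by positivity)] with ε hε x hx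
  have h2 : ∃ k, ev (L k).poly x < τ := by
    by_contra hn
    push Not at hn
    have h3 : τ ^ d ≤ ev (arrangementPoly L) x := by
      rw [ev_arrangementPoly]
      calc τ ^ d = ∏ _k : Fin d, τ := by rw [Finset.prod_const, Finset.card_univ, Fintype.card_fin]
        _ ≤ _ := Finset.prod_le_prod (fun _ _ => hτ0.le) fun k _ => hn k
    rw [hx.2] at h3
    exact h3.not_gt hε.2
  obtain ⟨k, hk⟩ := h2
  exact hτ k x hx.1 hk

theorem eventually_level (h : Stadium L U K ℓ) (hne : (sector L U).Nonempty) {ρ : ℝ}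
    (hρ : 0 < ρ) : ∀ᶠ ε in 𝓝[>] (0 : ℝ), IsPreconnected (level L U ε) ∧
      Metric.hausdorffEDist (level L U ε) (frontier (sector L U) ∩ U) < ENNReal.ofReal ρ := by
  obtain ⟨O, hO⟩ := hne
  filter_upwards [h.eventually_frontier_near hO (half_pos hρ),
    h.eventually_level_near (half_pos hρ), Ioo_mem_nhdsGT (sector_pos hO)] with ε h1 h2 h3
  refine ⟨isPreconnected_level h.convex h.isOpen hO h3.1 h3.2 (h.isPreconnected_sublevel h3.1), ?_⟩
  refine (Metric.hausdorffEDist_le_of_mem_edist (r := ENNReal.ofReal (ρ / 2)) ?_ ?_).trans_lt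
    ((ENNReal.ofReal_lt_ofReal_iff hρ).2 (half_lt_self hρ))
  · intro x hx
    obtain ⟨b, hb, hd⟩ := h2 x hx
    exact ⟨b, hb, by rw [edist_dist]; exact ENNReal.ofReal_le_ofReal hd⟩
  · intro b hb
    obtain ⟨y, hy, hd⟩ := h1 b hb
    exact ⟨y, hy, by rw [edist_dist]; exact ENNReal.ofReal_le_ofReal hd⟩

end Stadium

/-! ### All sectors -/

/-- The same line, with the sign of its equation changed. -/
def signedLine (l : LineEq) (σ : ℤˣ) : LineEq where
  a := σ • l.a
  b := σ • l.b
  c := σ • l.c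
  ne := l.ne.imp (units_smul_ne_zero σ) (units_smul_ne_zero σ)

theorem ev_signedLine (l : LineEq) (σ : ℤˣ) (x : Plane) :
    ev (signedLine l σ).poly x = σ • ev l.poly x := by
  rw [ev_linePoly, ev_linePoly, signedLine]
  rcases Int.units_eq_one_or σ with rfl | rfl <;> simp

theorem abs_units_smul (σ : ℤˣ) (x : ℝ) : |σ • x| = |x| := by
  rcases Int.units_eq_one_or σ with rfl | rfl <;> simp

theorem units_smul_sub (σ : ℤˣ) (x y : ℝ) : σ • x - σ • y = σ • (x - y) := (smul_sub _ _ _).symm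

theorem abs_ev_arrangementPoly_signed (L : Fin d → LineEq) (σ : Fin d → ℤˣ) (x : Plane) :
    |ev (arrangementPoly fun k => signedLine (L k) (σ k)) x| = |ev (arrangementPoly L) x| := by
  rw [ev_arrangementPoly, ev_arrangementPoly, Finset.abs_prod, Finset.abs_prod]
  exact Finset.prod_congr rfl fun k _ => by rw [ev_signedLine, abs_units_smul]

theorem Stadium.signed {U K : Set Plane} {ℓ : Fin d} (h : Stadium L U K ℓ) (σ : Fin d → ℤˣ) :
    Stadium (fun k => signedLine (L k) (σ k)) U K ℓ where
  isOpen := h.isOpen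
  convex := h.convex
  bounded := h.bounded
  subset := h.subset
  compact := h.compact
  zero b hb := by rw [ev_signedLine, h.zero b hb, smul_zero]
  near z hz := by
    obtain ⟨b, hb, hk⟩ := h.near z hz
    refine ⟨b, hb, fun k => (hk k).imp (fun h0 => ?_) fun h0 => ?_⟩
    · rw [ev_signedLine, h0, smul_zero]
    · rwa [ev_signedLine, ev_signedLine, units_smul_sub, abs_units_smul, abs_units_smul]

theorem connectedComponentIn_eq_of_isPreconnected {S T : Set Plane} {p : Plane}
    (hT : IsPreconnected T) (hTS : T ⊆ S) (hp : p ∈ T) (h : connectedComponentIn S p ⊆ T) :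
    connectedComponentIn S p = T :=
  h.antisymm (hT.subset_connectedComponentIn hp hTS)

/-- On a connected set which does not meet the lines, the linear polynomials have constant sign. -/
theorem mem_sector_of_isPreconnected {U S : Set Plane} {p : Plane} {σ : Fin d → ℤˣ}
    (hS : IsPreconnected S) (hSU : S ⊆ U) (hne : ∀ x ∈ S, ∀ k, ev (L k).poly x ≠ 0) (hp : p ∈ S)
    (hσ : ∀ k, 0 < σ k • ev (L k).poly p) :
    S ⊆ sector (fun k => signedLine (L k) (σ k)) U := by
  intro x hx
  refine ⟨hSU hx, fun k => ?_⟩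
  refine pos_of_ne_zero_of_isPreconnected hS (continuous_ev (signedLine (L k) (σ k)).poly)
    (fun y hy => ?_) hp ?_ x hx
  · rw [ev_signedLine]; exact units_smul_ne_zero _ (hne y hy k)
  · rw [ev_signedLine]; exact hσ k

/-- The level curves of the product of the linear polynomials respect the arrangement in a small
neighbourhood of an edge. -/
theorem Stadium.eventually_respects {U K : Set Plane} {ℓ : Fin d} (h : Stadium L U K ℓ) {ρ : ℝ}
    (hρ : 0 < ρ) : ∀ᶠ ε in 𝓝[≠] (0 : ℝ),
      ∀ p ∈ realCurve (arrangementPoly L - C ε) ∩ U, ∃ q ∈ U \ arrangementSet L,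
        Metric.hausdorffEDist (connectedComponentIn (realCurve (arrangementPoly L - C ε) ∩ U) p)
          (frontier (connectedComponentIn (U \ arrangementSet L) q) ∩ U) < ENNReal.ofReal ρ := by
  -- A change of signs of the equations turns each of the finitely many chambers into the positive
  -- sector and either sign of `ε` into `|ε|`.
  have h1 : ∀ᶠ ε in 𝓝[>] (0 : ℝ), ∀ σ : Fin d → ℤˣ,
      (sector (fun k => signedLine (L k) (σ k)) U).Nonempty →
      IsPreconnected (level (fun k => signedLine (L k) (σ k)) U ε) ∧
      Metric.hausdorffEDist (level (fun k => signedLine (L k) (σ k)) U ε)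
        (frontier (sector (fun k => signedLine (L k) (σ k)) U) ∩ U) < ENNReal.ofReal ρ := by
    simp only [eventually_all]
    intro σ hne
    exact (h.signed σ).eventually_level hne hρ
  filter_upwards [tendsto_abs_nhdsNE_zero.eventually h1, self_mem_nhdsWithin] with ε h2 hε p hp
  have hε : ε ≠ 0 := hε
  have hcurve : ∀ x, x ∈ realCurve (arrangementPoly L - C ε) ↔ ev (arrangementPoly L) x = ε := by
    intro x
    rw [mem_realCurve, ev_sub, ev_C, sub_eq_zero]
  have hne : ∀ x, ev (arrangementPoly L) x = ε → ∀ k, ev (L k).poly x ≠ 0 := by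
    intro x hx k h0
    apply hε
    rw [← hx, ev_arrangementPoly]
    exact Finset.prod_eq_zero (Finset.mem_univ k) h0
  have hp0 := (hcurve p).1 hp.1
  obtain ⟨σ, hσ⟩ : ∃ σ : Fin d → ℤˣ, ∀ k, 0 < σ k • ev (L k).poly p :=
    ⟨fun k => unitSign (ev (L k).poly p), fun k => unitSign_smul_pos (hne p hp0 k)⟩
  have hpD : p ∈ sector (fun k => signedLine (L k) (σ k)) U :=
    ⟨hp.2, fun k => by rw [ev_signedLine]; exact hσ k⟩
  have hA : ∀ x, x ∉ arrangementSet L ↔ ∀ k, ev (L k).poly x ≠ 0 := by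
    intro x
    simp only [arrangementSet, Set.mem_iUnion, not_exists]
    rfl
  have hDA : sector (fun k => signedLine (L k) (σ k)) U ⊆ U \ arrangementSet L := by
    intro x hx
    refine ⟨hx.1, (hA x).2 fun k h0 => ?_⟩
    have := hx.2 k
    rw [ev_signedLine, h0, smul_zero] at this
    exact lt_irrefl _ this
  -- The component of the complement containing `p` is the convex sector with the signs of `p`.
  have hD : connectedComponentIn (U \ arrangementSet L) p
      = sector (fun k => signedLine (L k) (σ k)) U := by
    refine connectedComponentIn_eq_of_isPreconnected (convex_sector h.convex).isPreconnected
      hDA hpD ?_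
    have hs := connectedComponentIn_subset (U \ arrangementSet L) p
    exact mem_sector_of_isPreconnected isPreconnected_connectedComponentIn
      (fun x hx => (hs hx).1) (fun x hx => (hA x).1 (hs hx).2)
      (mem_connectedComponentIn (hDA hpD)) hσ
  obtain ⟨hpre, hH⟩ := h2 σ ⟨p, hpD⟩
  have hsgn : ∀ x ∈ sector (fun k => signedLine (L k) (σ k)) U,
      (ev (arrangementPoly fun k => signedLine (L k) (σ k)) x = |ε| ↔
        ev (arrangementPoly L) x = ε) := by
    have hrel : ∀ x, ev (arrangementPoly fun k => signedLine (L k) (σ k)) x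
        = (∏ k, σ k) • ev (arrangementPoly L) x := by
      intro x
      simp only [ev_arrangementPoly, ev_signedLine, Finset.prod_smul]
    have hpabs : (∏ k, σ k) • ε = |ε| := by
      have h3 := sector_pos hpD
      have h4 := abs_ev_arrangementPoly_signed L σ p
      rw [abs_of_pos h3, hrel, hp0] at h4
      exact h4
    intro x _
    rw [hrel, ← hpabs]
    exact smul_left_cancel_iff _
  -- The component of the curve is the whole level set in that sector, which is connected.
  have hR : connectedComponentIn (realCurve (arrangementPoly L - C ε) ∩ U) p
      = level (fun k => signedLine (L k) (σ k)) U |ε| := by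
    refine connectedComponentIn_eq_of_isPreconnected hpre ?_ ⟨hpD, (hsgn p hpD).2 hp0⟩ ?_
    · intro x hx
      exact ⟨(hcurve x).2 ((hsgn x hx.1).1 hx.2), hx.1.1⟩
    · have hs := connectedComponentIn_subset (realCurve (arrangementPoly L - C ε) ∩ U) p
      have hx0 : ∀ x ∈ connectedComponentIn (realCurve (arrangementPoly L - C ε) ∩ U) p,
          ev (arrangementPoly L) x = ε := fun x hx => (hcurve x).1 (hs hx).1
      have h3 := mem_sector_of_isPreconnected (σ := σ) isPreconnected_connectedComponentIn
        (fun x hx => (hs hx).2) (fun x hx => hne x (hx0 x hx)) (mem_connectedComponentIn hp) hσ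
      exact fun x hx => ⟨h3 hx, (hsgn x (h3 hx)).2 (hx0 x hx)⟩
  refine ⟨p, hDA hpD, ?_⟩
  rw [hR, hD]
  exact hH

/-- The open sets of points `z` for which a given `b` satisfies the last condition cover the compact
closure of `e`, hence a thickening of it. -/
theorem eventually_stadium {e : Set Plane} (he : Convex ℝ e) (hb : Bornology.IsBounded e)
    {ℓ : Fin d} (hℓ : ∀ x ∈ e, ev (L ℓ).poly x = 0) :
    ∀ᶠ η in 𝓝[>] (0 : ℝ), Stadium L (Metric.thickening η e) (closure e) ℓ := by
  have hd : 0 < (d : ℝ) := Nat.cast_pos.2 (Fin.pos ℓ)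
  set V : Plane → Set Plane := fun b => {z | ∀ k, ev (L k).poly b = 0 ∨
    |ev (L k).poly z - ev (L k).poly b| < |ev (L k).poly b| / (2 * d)} with hV
  have hVo : ∀ b, IsOpen (V b) := by
    intro b
    have : V b = ⋂ k, {z | ev (L k).poly b = 0 ∨
        |ev (L k).poly z - ev (L k).poly b| < |ev (L k).poly b| / (2 * d)} := by
      ext z; simp [hV]
    rw [this]
    refine isOpen_iInter_of_finite fun k => ?_
    by_cases h0 : ev (L k).poly b = 0
    · simp [h0]
    · simp only [h0, false_or]
      exact isOpen_lt ((continuous_ev _).sub continuous_const).abs continuous_const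
  have hVb : ∀ b, b ∈ V b := by
    intro b k
    by_cases h0 : ev (L k).poly b = 0
    · exact Or.inl h0
    · right
      rw [sub_self, abs_zero]
      have := abs_pos.2 h0
      positivity
  obtain ⟨δ, hδ, hsub⟩ := hb.isCompact_closure.exists_thickening_subset_open
    (isOpen_biUnion fun b (_ : b ∈ closure e) => hVo b)
    fun b hb => Set.mem_iUnion₂.2 ⟨b, hb, hVb b⟩
  filter_upwards [Ioo_mem_nhdsGT hδ] with η hη
  refine ⟨Metric.isOpen_thickening, he.thickening η, hb.thickening,
    Metric.closure_subset_thickening hη.1 e, hb.isCompact_closure, ?_, fun z hz => ?_⟩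
  · exact fun x hx => closure_minimal hℓ (isClosed_eq (continuous_ev _) continuous_const) hx
  · have h1 : z ∈ Metric.thickening δ (closure e) := by
      rw [Metric.thickening_closure]
      exact Metric.thickening_mono hη.2.le e hz
    obtain ⟨b, hb, hz2⟩ := Set.mem_iUnion₂.1 (hsub h1)
    exact ⟨b, hb, hz2⟩

theorem respectsEdge_of_mem_boundedEdges (hL : IsGenericArrangement L) {e : Set Plane}
    (he : e ∈ boundedEdges L) :
    RespectsEdge L (𝓝[≠] (0 : ℝ)) (fun ε => realCurve (arrangementPoly L - C ε)) e := by
  obtain ⟨ℓ, m, m', hE, rfl⟩ := exists_isEdge_of_mem_boundedEdges hL he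
  filter_upwards [eventually_stadium (convex_openSegment _ _) he.1
    fun x hx => ev_eq_zero_of_mem_openSegment hL hE.ne hE.ne' hx] with η hη ρ hρ
  exact hη.eventually_respects hρ

end

section


section

/-! ### Nonsingularity of the small level curves. -/

variable {d : ℕ} {L : Fin d → LineEq}

/-- The logarithmic derivative of a product. -/
theorem ev_dirD_prod_linePoly (L : Fin d → LineEq) (v x : Plane) (s : Finset (Fin d))
    (h : ∀ k, ev (L k).poly x ≠ 0) :
    ev (dirD v (∏ k ∈ s, (L k).poly)) x = (∏ k ∈ s, ev (L k).poly x) *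
      ∑ k ∈ s, (v 0 * (L k).a + v 1 * (L k).b) / ev (L k).poly x := by
  induction s using Finset.cons_induction_on with
  | empty => simp
  | cons k s hk ih =>
    rw [Finset.prod_cons, Finset.prod_cons, Finset.sum_cons, dirD_mul, ev_add, ev_mul, ev_mul, ih,
      ev_prod, dirD_linePoly, ev_C]
    have := h k
    field_simp

/-- The nonzero critical values of the product. -/
def criticalValues (L : Fin d → LineEq) : Set ℝ :=
  {c | c ≠ 0 ∧ ∃ x, ev (arrangementPoly L) x = c ∧ ∀ v, ev (dirD v (arrangementPoly L)) x = 0}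

/-- The logarithm of the absolute value of the product is concave on a chamber. The difference of
its derivatives along `x - y` at `y` and at `x` is a sum of the nonnegative terms `(Lₖ x - Lₖ y) ^ 2
/ (Lₖ x * Lₖ y)`, and it vanishes at critical points. -/
theorem ev_eq_of_critical {x y : Plane} (hx : ∀ v, ev (dirD v (arrangementPoly L)) x = 0)
    (hy : ∀ v, ev (dirD v (arrangementPoly L)) y = 0)
    (h : ∀ k, 0 < ev (L k).poly x * ev (L k).poly y) (k : Fin d) :
    ev (L k).poly x = ev (L k).poly y := by
  have hsum : ∀ z : Plane, (∀ v, ev (dirD v (arrangementPoly L)) z = 0) →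
      (∀ k, ev (L k).poly z ≠ 0) →
      ∑ k, (ev (L k).poly x - ev (L k).poly y) / ev (L k).poly z = 0 := by
    intro z hz hz0
    have h1 := hz (x - y)
    rw [arrangementPoly, ev_dirD_prod_linePoly L _ _ _ hz0] at h1
    rw [← (mul_eq_zero.1 h1).resolve_left (Finset.prod_ne_zero_iff.2 fun k _ => hz0 k)]
    refine Finset.sum_congr rfl fun k _ => ?_
    rw [ev_linePoly _ x, ev_linePoly _ y, PiLp.sub_apply, PiLp.sub_apply]
    ring
  have hx0 : ∀ k, ev (L k).poly x ≠ 0 := fun k => left_ne_zero_of_mul (h k).ne'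
  have hy0 : ∀ k, ev (L k).poly y ≠ 0 := fun k => right_ne_zero_of_mul (h k).ne'
  have h0 : ∑ k, (ev (L k).poly x - ev (L k).poly y) ^ 2 /
      (ev (L k).poly x * ev (L k).poly y) = 0 := by
    rw [← sub_eq_zero.2 ((hsum y hy hy0).trans (hsum x hx hx0).symm), ← Finset.sum_sub_distrib]
    refine Finset.sum_congr rfl fun k _ => ?_
    have := hx0 k
    have := hy0 k
    field_simp
  have h1 := (Finset.sum_eq_zero_iff_of_nonneg fun k _ =>
    div_nonneg (sq_nonneg _) (h k).le).1 h0 k (Finset.mem_univ k)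
  exact sub_eq_zero.1 (pow_eq_zero_iff two_ne_zero |>.1
    ((div_eq_zero_iff.1 h1).resolve_right (h k).ne'))

/-- Each of the finitely many sign patterns of the factors carries at most one critical value. -/
theorem finite_criticalValues (L : Fin d → LineEq) : (criticalValues L).Finite := by
  refine (Set.finite_iUnion fun σ : Fin d → ℤˣ => Set.Subsingleton.finite
    (s := {c | ∃ x, ev (arrangementPoly L) x = c ∧ (∀ v, ev (dirD v (arrangementPoly L)) x = 0) ∧
      ∀ k, 0 < σ k • ev (L k).poly x}) ?_).subset ?_
  · rintro _ ⟨x, rfl, hx, hxs⟩ _ ⟨y, rfl, hy, hys⟩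
    rw [ev_arrangementPoly, ev_arrangementPoly]
    refine Finset.prod_congr rfl fun k _ => ev_eq_of_critical hx hy (fun k => ?_) k
    have h1 := mul_pos (hxs k) (hys k)
    rcases Int.units_eq_one_or (σ k) with h | h <;> simpa [h] using h1
  · rintro c ⟨hc, x, rfl, hx⟩
    rw [ev_arrangementPoly, Finset.prod_ne_zero_iff] at hc
    exact Set.mem_iUnion.2 ⟨fun k => unitSign (ev (L k).poly x), x, rfl, hx,
      fun k => unitSign_smul_pos (hc k (Finset.mem_univ k))⟩

theorem totalDegree_linePoly_le (l : LineEq) : l.poly.totalDegree ≤ 1 := by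
  have h : ∀ (c : ℝ) (j : Fin 2), (C c * X j).totalDegree ≤ 1 := fun c j =>
    (MvPolynomial.totalDegree_mul _ _).trans (by simp)
  refine (MvPolynomial.totalDegree_add _ _).trans (max_le ?_ (by simp))
  exact (MvPolynomial.totalDegree_add _ _).trans (max_le (h _ _) (h _ _))

theorem totalDegree_arrangementPoly_le (L : Fin d → LineEq) :
    (arrangementPoly L).totalDegree ≤ d :=
  (MvPolynomial.totalDegree_finsetProd _ _).trans
    ((Finset.sum_le_sum fun k _ => totalDegree_linePoly_le (L k)).trans (by simp))

theorem isSmallDeformation_sub_C (L : Fin d → LineEq) :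
    IsSmallDeformation L (𝓝[≠] (0 : ℝ)) (fun ε => arrangementPoly L - C ε) where
  degree_le := Eventually.of_forall fun ε => (MvPolynomial.totalDegree_sub _ _).trans
    (max_le (totalDegree_arrangementPoly_le L) (by simp))
  tendsto m := by
    have h : Continuous fun ε : ℝ => (arrangementPoly L - C ε).coeff m := by
      simp only [MvPolynomial.coeff_sub, MvPolynomial.coeff_C]
      split_ifs <;> fun_prop
    simpa using h.continuousWithinAt (s := {0}ᶜ) (x := 0) |>.tendsto
  nonsingular := by
    -- `criticalValues` omits `0` by definition and is finite, so a neighbourhood of `0` avoids it.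
    have h0 : (criticalValues L)ᶜ ∈ 𝓝 (0 : ℝ) :=
      (finite_criticalValues L).isClosed.isOpen_compl.mem_nhds fun h => h.1 rfl
    filter_upwards [nhdsWithin_le_nhds h0, self_mem_nhdsWithin] with ε hε hε0 p hp
    by_contra! h
    have hp0 : ev (arrangementPoly L - C ε) p = 0 := hp
    rw [ev_sub, ev_C, sub_eq_zero] at hp0
    refine hε ⟨hε0, p, hp0, fun v => ?_⟩
    have h1 : ∀ j, ev (pderiv j (arrangementPoly L)) p = 0 := by
      intro j
      have := h j
      rwa [map_sub, MvPolynomial.pderiv_C, sub_zero] at this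
    rw [dirD, ev_add, ev_mul, ev_mul, h1, h1]
    ring

end

end

/-- An equality for `d ≥ 2`; for `d ≤ 1` truncated subtraction makes both sides `0`. -/
theorem mul_two_mul_sub_three_le (d : ℕ) : d * (2 * d - 3) ≤ d * (d - 1) + d * (d - 2) := by
  rw [← mul_add]
  exact Nat.mul_le_mul_left d (by omega)

end PlaneCurve

end

theorem mainTheorem1 {d : ℕ} (L : Fin d → LineEq) (hL : IsGenericArrangement L) :
    -- (i) an arbitrary small real deformation
    (∀ {ι : Type*} (l : Filter ι) (F : ι → MvPolynomial (Fin 2) ℝ),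
      IsSmallDeformation L l F →
      ∀ᶠ i in l,
        ((d * (d - 1) : ℕ) : ℕ∞) +
          {e ∈ boundedEdges L | RespectsEdge L l (fun i => realCurve (F i)) e}.encard ≤
            (evoluteCusps (realCurve (F i))).encard) ∧
    -- (ii) the deformation given by the equation `∏ L i = ε`, with small `ε ≠ 0` of either sign
    (IsSmallDeformation L (𝓝[≠] (0 : ℝ)) (fun ε => arrangementPoly L - MvPolynomial.C ε) ∧
      (∀ e ∈ boundedEdges L,
        RespectsEdge L (𝓝[≠] (0 : ℝ))
          (fun ε => realCurve (arrangementPoly L - MvPolynomial.C ε)) e) ∧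
      ∀ᶠ ε in 𝓝[≠] (0 : ℝ),
        ((d * (2 * d - 3) : ℕ) : ℕ∞) ≤
            (evoluteCusps (realCurve (arrangementPoly L - MvPolynomial.C ε))).encard ∧
          ((d * (2 * d - 3) : ℕ) : ℕ∞) ≤
            (vertices (realCurve (arrangementPoly L - MvPolynomial.C ε))).encard) := by
  open PlaneCurve in
  refine ⟨fun l F hF => ?_, isSmallDeformation_sub_C L,
    fun e he => respectsEdge_of_mem_boundedEdges hL he, ?_⟩
  · filter_upwards [eventually_encard_le hL hF
      (E := {e ∈ boundedEdges L | RespectsEdge L l (fun i => realCurve (F i)) e}) fun e he =>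
      ⟨exists_isEdge_of_mem_boundedEdges hL he.1, he.2⟩] with i hi
    exact hi.trans (Set.encard_le_encard fun p hp => (curvExtrema_subset _ hp).1)
  · filter_upwards [eventually_encard_le hL (isSmallDeformation_sub_C L)
      (E := boundedEdges L) fun e he =>
      ⟨exists_isEdge_of_mem_boundedEdges hL he, respectsEdge_of_mem_boundedEdges hL he⟩] with ε hε
    have h : ((d * (2 * d - 3) : ℕ) : ℕ∞) ≤
        (curvExtrema (arrangementPoly L - MvPolynomial.C ε)).encard := by
      refine le_trans ?_ ((add_le_add_right (le_encard_boundedEdges hL) _).trans hε)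
      exact_mod_cast mul_two_mul_sub_three_le d
    exact ⟨h.trans (Set.encard_le_encard fun p hp => (curvExtrema_subset _ hp).1),
      h.trans (Set.encard_le_encard fun p hp => (curvExtrema_subset _ hp).2)⟩
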